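/- Let $m\ge 1$ and $\mathcal L=\mathbb C[q,q^{-1}]$. Let $\mathcal W$ be the Coxeter group of type $C_{m-1}$ with simple reflections $s_0,\dots,s_{m-2}$ (the edge labelled $4$ joins $s_0$ and $s_1$) and length function $\ell$. Let $\mathcal H$ be its Hecke algebra over $\mathcal L$, with standard basis $H_w$ and relations $H_vH_w=H_{vw}$ if $\ell(v)+\ell(w)=\ell(vw)$ and $H_{s_i}^2=H_e+(q^{-1}-q)H_{s_i}$, and put $C_{s_i}=H_{s_i}-q^{-1}H_e$. Let $\mathcal H_{\mathcal P}\subseteq\mathcal H$ be the subalgebra generated by $C_{s_1},\dots,C_{s_{m-2}}$, acting on $\mathcal L$ from the right by $1.H_{s_i}=q^{-1}$, and let $\mathcal M=\mathcal L\otimes_{\mathcal H_{\mathcal P}}\mathcal H$, a right $\mathcal H$-module. Let $\mathcal P^{\min}$ be the set of all $w\in\mathcal W$ with $\ell(s_iw)>\ell(w)$ for all $i\ge 1$, let $M_w=1\otimes H_w$ for $w\in\mathcal P^{\min}$, and let $\overline{(\cdot)}$ be the involution of $\mathcal M$ induced by $q\mapsto q^{-1}$, $H_w\mapsto H_{w^{-1}}^{-1}$.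 For $w\in\mathcal P^{\min}$ the Kazhdan–Lusztig element $\underline M_w$ is the unique bar invariant element of $M_w+\sum_{v\ne w}q^{-1}\mathbb Z[q^{-1}]M_v$, where $v$ runs through $\mathcal P^{\min}$. A cup diagram on $m$ vertices is a non-intersecting arrangement, in a rectangle with $m$ vertices on its upper edge, of cups (joining two vertices) and rays (joining a vertex to the lower edge), every vertex being an end of exactly one cup or ray; cups and rays that are accessible from the left edge of the rectangle may carry one marker. Diagrams are taken up to planar isotopy fixing the boundary. Let $C_{\mathrm{KL}}(m)$ be the set of cup diagrams on $m$ vertices for which the number of marked rays plus the number of unmarked cups is even. The group $\mathcal W$ acts from the right on sequences of length $m-1$ in the symbols $\land,\lor$: $s_0$ changes the first symbol, and $s_i$ ($i\ge1$) exchanges the symbols at positions $i$ and $i+1$. For $w\in\mathcal P^{\min}$ let $\lambda_w$ be the image of $\lor\cdots\lor$ under $w$, and let $\lambda_w^\dagger$ be the sequence of length $m$ obtained by adding on the left that symbol which makes the number of $\land$'s even. The diagram $\mathbf a_w$ is constructed from $\lambda_w^\dagger$ as follows: first connect neighboured $\lor\land$ by unmarked cups successively, ignoring symbols that are already connected; then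 connect the remaining neighboured $\land$'s pairwise by marked cups, starting from the left; finally attach rays to the remaining symbols, where a ray is marked if and only if its symbol is $\land$. **Proposition.** The assignment $w\mapsto\mathbf a_w$ is a bijection $\mathcal P^{\min}\to C_{\mathrm{KL}}(m)$, every $w\in\mathcal P^{\min}$ has a (unique) Kazhdan–Lusztig element $\underline M_w$, and $\underline M_w\mapsto\mathbf a_w$ defines an isomorphism of $\mathcal L$-modules from $\mathcal M$ to the free $\mathcal L$-module $\mathcal L[C_{\mathrm{KL}}(m)]$. Under this identification the right action of $\mathcal H$ is given as follows. Represent $C_{s_0}$ by the sum of two pictures, one with an unmarked cup at the top vertices $1,2$ and an unmarked cap at the bottom vertices $1,2$, the other with the same cup and cap both marked, each with vertical strands at all other vertices. For $1\le i\le m-2$ represent $C_{s_i}$ by the picture with an unmarked cup and an unmarked cap at the vertices $i+1,i+2$ and vertical strands at all other vertices. For $\mathbf a\in C_{\mathrm{KL}}(m)$ and $0\le i\le m-2$ the element $\mathbf a.C_{s_i}$ is obtained by putting the picture of $C_{s_i}$ on top of $\mathbf a$ and simplifying by the following relations, and the result lies in $\mathcal L[C_{\mathrm{KL}}(m)]$: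 two markers on the same component cancel; an unmarked closed circle is replaced by the factor $-(q+q^{-1})$ and a marked circle by $0$; a component with both ends on the lower edge is replaced by $0$ if it is unmarked and by $1$ (that is, it is removed) if it is marked. -/

import Mathlib

open scoped LaurentPolynomial TensorProduct

namespace CupHecke

noncomputable section

/-! ### Hecke algebra of a Coxeter group and its parabolic modules -/

/-- The ring `𝓛 = ℂ[q, q⁻¹]` of Laurent polynomials. -/
abbrev Laurent : Type := LaurentPolynomial ℂ

/-- The variable `q`. -/
def q : Laurent := LaurentPolynomial.T 1

/-- The inverse `q⁻¹` of the variable. -/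
def qInv : Laurent := LaurentPolynomial.T (-1)

/-- The `ℂ`-linear involution `q ↦ q⁻¹` of `𝓛`. -/
def conj : Laurent →+* Laurent := (LaurentPolynomial.invert (R := ℂ)).toRingEquiv.toRingHom

theorem conj_T (k : ℤ) : conj (LaurentPolynomial.T k) = LaurentPolynomial.T (-k) :=
  LaurentPolynomial.invert_T k

section Hecke

variable {B : Type} (M : CoxeterMatrix B)

/-- The length function of the Coxeter group of `M`. -/
def len (w : M.Group) : ℕ := M.toCoxeterSystem.length w

/-- The defining relations of the Hecke algebra with generators `H_w`, `w ∈ W`. -/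
inductive HeckeRel : FreeAlgebra Laurent M.Group → FreeAlgebra Laurent M.Group → Prop
  | one : HeckeRel (FreeAlgebra.ι Laurent 1) 1
  | mul (v w : M.Group) (h : len M v + len M w = len M (v * w)) :
      HeckeRel (FreeAlgebra.ι Laurent v * FreeAlgebra.ι Laurent w) (FreeAlgebra.ι Laurent (v * w))
  | quad (i : B) :
      HeckeRel (FreeAlgebra.ι Laurent (M.simple i) * FreeAlgebra.ι Laurent (M.simple i))
        (1 + (qInv - q) • FreeAlgebra.ι Laurent (M.simple i))

/-- The Hecke algebra of the Coxeter group of `M` over `ℂ[q, q⁻¹]`. -/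
def Hecke : Type := RingQuot (HeckeRel M)

instance : Ring (Hecke M) := inferInstanceAs (Ring (RingQuot (HeckeRel M)))

instance : Algebra Laurent (Hecke M) := inferInstanceAs (Algebra Laurent (RingQuot (HeckeRel M)))

/-- The standard basis element `H_w`. -/
def H (w : M.Group) : Hecke M := RingQuot.mkAlgHom Laurent (HeckeRel M) (FreeAlgebra.ι Laurent w)

/-- The Kazhdan–Lusztig generator `C_s = H_s - q⁻¹ H_e`. -/
def C (i : B) : Hecke M := H M (M.simple i) - qInv • H M 1

variable {M}

theorem H_one : H M 1 = 1 := by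
  have h := RingQuot.mkAlgHom_rel Laurent (HeckeRel.one (M := M))
  rw [map_one] at h
  exact h

theorem H_mul {v w : M.Group} (h : len M v + len M w = len M (v * w)) :
    H M v * H M w = H M (v * w) := by
  have h' := RingQuot.mkAlgHom_rel Laurent (HeckeRel.mul v w h)
  rw [map_mul] at h'
  exact h'

theorem H_quad (i : B) :
    H M (M.simple i) * H M (M.simple i) = 1 + (qInv - q) • H M (M.simple i) := by
  have h' := RingQuot.mkAlgHom_rel Laurent (HeckeRel.quad (M := M) i)
  rw [map_mul, map_add, map_one, map_smul] at h'
  exact h'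

theorem H_quad_inv (i : B) :
    H M (M.simple i) * (H M (M.simple i) - (qInv - q) • 1) = 1 := by
  rw [mul_sub, H_quad, mul_smul_comm, mul_one, add_sub_cancel_right]

theorem H_quad_inv' (i : B) :
    (H M (M.simple i) - (qInv - q) • 1) * H M (M.simple i) = 1 := by
  rw [sub_mul, H_quad, smul_mul_assoc, one_mul, add_sub_cancel_right]

theorem isUnit_H_simple (i : B) : IsUnit (H M (M.simple i)) :=
  ⟨⟨_, _, H_quad_inv i, H_quad_inv' i⟩, rfl⟩

theorem isUnit_H (w : M.Group) : IsUnit (H M w) := by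
  induction hn : len M w generalizing w with
  | zero =>
    have : w = 1 := M.toCoxeterSystem.length_eq_zero_iff.1 hn
    rw [this, H_one]
    exact isUnit_one
  | succ n ih =>
    have hw : w ≠ 1 := by
      rintro rfl
      simp [len] at hn
    obtain ⟨i, hi⟩ := M.toCoxeterSystem.exists_leftDescent_of_ne_one hw
    have h1 := (M.toCoxeterSystem.isLeftDescent_iff).1 hi
    set v := M.simple i * w with hv
    have hs : M.simple i * v = w := by
      rw [hv]
      exact M.toCoxeterSystem.simple_mul_simple_cancel_left i
    have hlv : len M v + 1 = len M w := h1
    have hl1 : len M (M.simple i) = 1 := M.toCoxeterSystem.length_simple i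
    have : H M (M.simple i) * H M v = H M w := by
      rw [H_mul, hs]
      rw [hs]; omega
    rw [← this]
    exact (isUnit_H_simple i).mul (ih v (by omega))

variable (M)

/-- Algebra homomorphisms out of the Hecke algebra. -/
def heckeLift {A : Type} [Ring A] [Algebra Laurent A] (f : M.Group → A) (h1 : f 1 = 1)
    (hm : ∀ v w, len M v + len M w = len M (v * w) → f v * f w = f (v * w))
    (hq : ∀ i, f (M.simple i) * f (M.simple i) = 1 + (qInv - q) • f (M.simple i)) :
    Hecke M →ₐ[Laurent] A :=
  RingQuot.liftAlgHom Laurent ⟨FreeAlgebra.lift Laurent f, by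
    intro x y h
    induction h with
    | one => simpa using h1
    | mul v w h => simpa using hm v w h
    | quad i => simpa using hq i⟩

theorem heckeLift_H {A : Type} [Ring A] [Algebra Laurent A] (f : M.Group → A) (h1 : f 1 = 1)
    (hm : ∀ v w, len M v + len M w = len M (v * w) → f v * f w = f (v * w))
    (hq : ∀ i, f (M.simple i) * f (M.simple i) = 1 + (qInv - q) • f (M.simple i))
    (w : M.Group) : heckeLift M f h1 hm hq (H M w) = f w := by
  unfold heckeLift H
  erw [RingQuot.liftAlgHom_mkAlgHom_apply]
  simp

theorem hecke_algHom_ext {A : Type} [Ring A] [Algebra Laurent A] {f g : Hecke M →ₐ[Laurent] A}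
    (h : ∀ w, f (H M w) = g (H M w)) : f = g := by
  refine RingQuot.ringQuot_ext' Laurent f g ?_
  refine FreeAlgebra.hom_ext ?_
  funext w
  exact h w

/-- The one-dimensional representation `H_w ↦ q^{-ℓ(w)}`; it sends every `H_s` to `q⁻¹`. -/
def chi : Hecke M →ₐ[Laurent] Laurent :=
  heckeLift M (fun w ↦ LaurentPolynomial.T (-(len M w : ℤ)))
    (by simp [len])
    (fun v w h ↦ by
      rw [← LaurentPolynomial.T_add, ← h]
      congr 1; push_cast; ring)
    (fun i ↦ by
      have : len M (M.simple i) = 1 := M.toCoxeterSystem.length_simple i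
      simp only [this, q, qInv, smul_eq_mul, sub_mul, ← LaurentPolynomial.T_add]
      norm_num)

theorem chi_H_simple (i : B) : chi M (H M (M.simple i)) = qInv := by
  have : len M (M.simple i) = 1 := M.toCoxeterSystem.length_simple i
  simp [chi, heckeLift_H, this, qInv]

/-- The Hecke algebra with scalars acting through the involution `q ↦ q⁻¹`. -/
def HeckeBar : Type := Hecke M

instance : Ring (HeckeBar M) := inferInstanceAs (Ring (Hecke M))

instance : Algebra Laurent (HeckeBar M) :=
  RingHom.toAlgebra' ((algebraMap Laurent (Hecke M)).comp
    conj)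
    (fun c x ↦ Algebra.commutes (A := Hecke M) (conj c) x)

theorem heckeBar_smul (c : Laurent) (x : HeckeBar M) :
    c • x = ((conj c • (show Hecke M from x) : Hecke M) : HeckeBar M) :=
  (Algebra.smul_def (A := Hecke M) (conj c) x).symm

/-- The bar involution as an algebra homomorphism to the twisted algebra. -/
def barAlgHom : Hecke M →ₐ[Laurent] HeckeBar M :=
  heckeLift M (A := HeckeBar M) (fun w ↦ (Ring.inverse (H M w⁻¹) : Hecke M))
    (by
      change Ring.inverse (H M 1⁻¹) = (1 : Hecke M)
      rw [inv_one, H_one, Ring.inverse_one])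
    (fun v w h ↦ by
      change Ring.inverse (H M v⁻¹) * Ring.inverse (H M w⁻¹) = (Ring.inverse (H M (v * w)⁻¹))
      have hl : len M w⁻¹ + len M v⁻¹ = len M (w⁻¹ * v⁻¹) := by
        rw [← mul_inv_rev]
        simp only [len, CoxeterSystem.length_inv] at h ⊢
        omega
      rw [mul_inv_rev, ← H_mul hl]
      obtain ⟨a, ha⟩ := isUnit_H (M := M) v⁻¹
      obtain ⟨b, hb⟩ := isUnit_H (M := M) w⁻¹
      rw [← ha, ← hb, ← Units.val_mul, Ring.inverse_unit, Ring.inverse_unit, Ring.inverse_unit,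
        mul_inv_rev, Units.val_mul])
    (fun i ↦ by
      have hs : (M.simple i)⁻¹ = M.simple i := M.toCoxeterSystem.inv_simple i
      have hi : Ring.inverse (H M (M.simple i)⁻¹) = H M (M.simple i) - (qInv - q) • 1 := by
        rw [hs]
        have : H M (M.simple i) = ((⟨_, _, H_quad_inv i, H_quad_inv' i⟩ : (Hecke M)ˣ) : Hecke M) :=
          rfl
        rw [this, Ring.inverse_unit]
        rfl
      have hqq : conj (qInv - q) = -(qInv - q) := by
        simp [q, qInv, conj_T]
      refine Eq.trans ?_ (congrArg (fun y : HeckeBar M ↦ 1 + y)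
        (heckeBar_smul M (qInv - q) (Ring.inverse (H M (M.simple i)⁻¹) : Hecke M)).symm)
      change Ring.inverse (H M (M.simple i)⁻¹) * Ring.inverse (H M (M.simple i)⁻¹) =
        1 + conj (qInv - q) • Ring.inverse (H M (M.simple i)⁻¹)
      rw [hqq, hi]
      set x := H M (M.simple i)
      have e : x * (x - (qInv - q) • 1) = 1 := H_quad_inv i
      calc (x - (qInv - q) • 1) * (x - (qInv - q) • 1)
          = x * (x - (qInv - q) • 1) - (qInv - q) • (x - (qInv - q) • 1) := by
            rw [sub_mul, smul_mul_assoc, one_mul]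
        _ = 1 + (-(qInv - q)) • (x - (qInv - q) • 1) := by rw [e, neg_smul, sub_eq_add_neg])

/-- The bar involution of the Hecke algebra: `q ↦ q⁻¹` and `H_w ↦ (H_{w⁻¹})⁻¹`. -/
def bar : Hecke M →+* Hecke M := (barAlgHom M).toRingHom

theorem bar_H (w : M.Group) : bar M (H M w) = Ring.inverse (H M w⁻¹) :=
  heckeLift_H M (A := HeckeBar M) _ _ _ _ w

theorem bar_smul (c : Laurent) (x : Hecke M) :
    bar M (c • x) = conj c • bar M x :=
  (map_smul (barAlgHom M) c x).trans (heckeBar_smul M c _)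

theorem bar_algebraMap (c : Laurent) :
    bar M (algebraMap Laurent (Hecke M) c) =
      algebraMap Laurent (Hecke M) (conj c) := by
  rw [Algebra.algebraMap_eq_smul_one, bar_smul, map_one, ← Algebra.algebraMap_eq_smul_one]

theorem bar_H_simple (i : B) :
    bar M (H M (M.simple i)) = H M (M.simple i) - (qInv - q) • 1 := by
  have hs : (M.simple i)⁻¹ = M.simple i := M.toCoxeterSystem.inv_simple i
  rw [bar_H, hs]
  have : H M (M.simple i) = ((⟨_, _, H_quad_inv i, H_quad_inv' i⟩ : (Hecke M)ˣ) : Hecke M) := rfl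
  rw [this, Ring.inverse_unit]
  rfl

theorem bar_C (i : B) : bar M (C M i) = C M i := by
  rw [C, H_one, map_sub, bar_H_simple, bar_smul, map_one, qInv, conj_T,
    sub_smul, q]
  simp only [neg_neg]
  abel

/-- The parabolic subalgebra generated by the `C_s` with `s` in the set `J`. -/
def parabolicSubalgebra (J : Set B) : Subalgebra Laurent (Hecke M) :=
  Algebra.adjoin Laurent (C M '' J)

theorem bar_mem_parabolicSubalgebra (J : Set B) {h : Hecke M} (hh : h ∈ parabolicSubalgebra M J) :
    bar M h ∈ parabolicSubalgebra M J := by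
  induction hh using Algebra.adjoin_induction with
  | mem x hx =>
    obtain ⟨i, hi, rfl⟩ := hx
    rw [bar_C]
    exact Algebra.subset_adjoin ⟨i, hi, rfl⟩
  | algebraMap r =>
    rw [bar_algebraMap]
    exact Subalgebra.algebraMap_mem _ _
  | add x y _ _ hx hy =>
    rw [map_add]
    exact add_mem hx hy
  | mul x y _ _ hx hy =>
    rw [map_mul]
    exact mul_mem hx hy

theorem chi_bar_mem (J : Set B) {h : Hecke M} (hh : h ∈ parabolicSubalgebra M J) :
    chi M (bar M h) = conj (chi M h) := by
  have hC : ∀ i, chi M (C M i) = 0 := fun i ↦ by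
    rw [C, map_sub, chi_H_simple, map_smul, H_one, map_one, smul_eq_mul, mul_one, sub_self]
  induction hh using Algebra.adjoin_induction with
  | mem x hx =>
    obtain ⟨i, hi, rfl⟩ := hx
    rw [bar_C, hC, map_zero]
  | algebraMap r =>
    rw [bar_algebraMap, AlgHom.commutes, AlgHom.commutes]
    rfl
  | add x y _ _ hx hy => simp only [map_add, hx, hy]
  | mul x y _ _ hx hy => simp only [map_mul, hx, hy]

/-- The relations `(l . h) ⊗ x = l ⊗ (h x)` for `h` in the parabolic subalgebra, which acts on `𝓛`
from the right by `1 . H_s = q⁻¹`. -/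
def balanced (J : Set B) : Submodule Laurent (Laurent ⊗[Laurent] Hecke M) :=
  Submodule.span Laurent
    {t | ∃ h ∈ parabolicSubalgebra M J, ∃ (l : Laurent) (x : Hecke M),
      t = (l * chi M h) ⊗ₜ[Laurent] x - l ⊗ₜ[Laurent] (h * x)}

/-- The parabolic Hecke module: the tensor product of `𝓛` and the Hecke algebra over the
parabolic subalgebra for `J`. -/
abbrev ParabolicModule (J : Set B) : Type := (Laurent ⊗[Laurent] Hecke M) ⧸ balanced M J

/-- The pure tensor `l ⊗ x` in the parabolic Hecke module. -/
def tmul (J : Set B) (l : Laurent) (x : Hecke M) : ParabolicModule M J :=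
  (balanced M J).mkQ (l ⊗ₜ[Laurent] x)

theorem balanced_le (J : Set B) (h : Hecke M) :
    balanced M J ≤ (balanced M J).comap
      (TensorProduct.map LinearMap.id (LinearMap.mulRight Laurent h)) := by
  refine Submodule.span_le.2 ?_
  rintro _ ⟨k, hk, l, x, rfl⟩
  refine Submodule.subset_span ⟨k, hk, l, x * h, ?_⟩
  simp [mul_assoc]

/-- The right action of `h`, that is, `(l ⊗ x) . h = l ⊗ (x h)`. -/
def rightAct (J : Set B) (h : Hecke M) : ParabolicModule M J →ₗ[Laurent] ParabolicModule M J :=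
  (balanced M J).mapQ (balanced M J)
    (TensorProduct.map LinearMap.id (LinearMap.mulRight Laurent h)) (balanced_le M J h)

theorem rightAct_mul (J : Set B) (h k : Hecke M) :
    rightAct M J (h * k) = rightAct M J k ∘ₗ rightAct M J h := by
  refine Submodule.linearMap_qext _ (TensorProduct.ext' fun l x ↦ ?_)
  change tmul M J l (x * (h * k)) = tmul M J l (x * h * k)
  rw [mul_assoc]

theorem rightAct_tmul (J : Set B) (h : Hecke M) (l : Laurent) (x : Hecke M) :
    rightAct M J h (tmul M J l x) = tmul M J l (x * h) := by
  rw [rightAct, tmul, Submodule.mkQ_apply, Submodule.mapQ_apply, TensorProduct.map_tmul]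
  rfl

/-- The involution `l ⊗ x ↦ l̄ ⊗ x̄` before passing to the quotient. -/
def barTensor : Laurent ⊗[Laurent] Hecke M →+ Laurent ⊗[Laurent] Hecke M :=
  TensorProduct.liftAddHom
    (AddMonoidHom.mk' (fun l ↦ AddMonoidHom.mk'
        (fun x ↦ (conj l) ⊗ₜ[Laurent] (bar M x))
        (fun x y ↦ by rw [map_add, TensorProduct.tmul_add]))
      (fun l k ↦ by
        ext x
        simp [TensorProduct.add_tmul]))
    (fun r l x ↦ by
      simp only [AddMonoidHom.mk'_apply]
      rw [bar_smul, smul_eq_mul, map_mul, ← TensorProduct.smul_tmul, smul_eq_mul])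

theorem barTensor_tmul (l : Laurent) (x : Hecke M) :
    barTensor M (l ⊗ₜ x) = (conj l) ⊗ₜ[Laurent] (bar M x) := rfl

theorem barTensor_smul (c : Laurent) (t : Laurent ⊗[Laurent] Hecke M) :
    barTensor M (c • t) = conj c • barTensor M t := by
  induction t with
  | zero => simp
  | tmul l x =>
    rw [TensorProduct.smul_tmul', barTensor_tmul, barTensor_tmul, smul_eq_mul, map_mul,
      TensorProduct.smul_tmul', smul_eq_mul]
  | add x y hx hy => rw [smul_add, map_add, hx, hy, map_add, smul_add]

/-- The bar involution `l ⊗ x ↦ l̄ ⊗ x̄` of the parabolic Hecke module. -/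
def barModule (J : Set B) : ParabolicModule M J →+ ParabolicModule M J :=
  QuotientAddGroup.map (balanced M J).toAddSubgroup (balanced M J).toAddSubgroup (barTensor M) (by
    intro t ht
    change barTensor M t ∈ balanced M J
    have ht' : t ∈ balanced M J := ht
    induction ht' using Submodule.span_induction with
    | mem x hx =>
      obtain ⟨h, hh, l, x, rfl⟩ := hx
      refine Submodule.subset_span ⟨bar M h, bar_mem_parabolicSubalgebra M J hh,
        conj l, bar M x, ?_⟩
      rw [map_sub, barTensor_tmul, barTensor_tmul, map_mul, map_mul, chi_bar_mem M J hh]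
    | zero => simp
    | add x y hx hy hx' hy' =>
      rw [map_add]
      exact add_mem (hx' hx) (hy' hy)
    | smul c x hx hx' =>
      rw [barTensor_smul]
      exact Submodule.smul_mem _ _ (hx' hx))

theorem barModule_tmul (J : Set B) (l : Laurent) (x : Hecke M) :
    barModule M J (tmul M J l x) = tmul M J (conj l) (bar M x) := rfl

/-- The smallest representatives of the right cosets of the parabolic subgroup for `J`. -/
def MinCoset (J : Set B) : Type :=
  {w : M.Group // ∀ i ∈ J, len M w < len M (M.simple i * w)}

/-- The standard basis element `M_w = 1 ⊗ H_w`. -/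
def stdBasis (J : Set B) (w : MinCoset M J) : ParabolicModule M J := tmul M J 1 (H M w.1)

/-- `x` is the Kazhdan–Lusztig element of `w`: it is bar invariant and lies in
`M_w + ∑_{v ≠ w} q⁻¹ ℤ[q⁻¹] M_v`. -/
def IsKL (J : Set B) (w : MinCoset M J) (x : ParabolicModule M J) : Prop :=
  barModule M J x = x ∧
    ∃ c : MinCoset M J →₀ Polynomial ℤ, c w = 0 ∧
      x = stdBasis M J w +
        c.sum fun v p ↦ (qInv * Polynomial.aeval qInv p : Laurent) • stdBasis M J v

end Hecke

/-! ### Type C -/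

/-- The Coxeter matrix of type `C_n`, with nodes `0, …, n - 1`; the edge labelled `4` joins the
nodes `0` and `1`. -/
def coxC (n : ℕ) : CoxeterMatrix (Fin n) := (CoxeterMatrix.B n).reindex Fin.revPerm

/-- The nodes `1, …, n - 1`, which generate the maximal parabolic subgroup of type `A`. -/
def typeA (n : ℕ) : Set (Fin n) := {i | i.val ≠ 0}

/-- Sequences of length `m` in the symbols `∧` (encoded as `true`) and `∨` (`false`). -/
abbrev Word (m : ℕ) : Type := Fin m → Bool

/-- `s_0` changes the symbol at the first position, and `s_i` with `i ≥ 1` permutes the symbols at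
the `i`-th and the `(i+1)`-st position, counted from `1`. -/
def simpleOnWord {n : ℕ} (i : Fin n) (l : Word n) : Word n :=
  if i.val = 0 then Function.update l i (!(l i))
  else l ∘ Equiv.swap ⟨i.val - 1, by omega⟩ i

theorem coxC_apply (n : ℕ) (i j : Fin n) :
    coxC n i j = if i = j then 1
      else if (i.val = 0 ∧ j.val = 1) ∨ (j.val = 0 ∧ i.val = 1) then 4
      else if j.val + 1 = i.val ∨ i.val + 1 = j.val then 3 else 2 := by
  have : coxC n i j = CoxeterMatrix.B n (Fin.rev i) (Fin.rev j) := rfl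
  rw [this]
  change (if Fin.rev i = Fin.rev j then 1
      else (if ((Fin.rev i : Fin n) : ℕ) = n - 1 ∧ ((Fin.rev j : Fin n) : ℕ) = n - 2 ∨
          ((Fin.rev j : Fin n) : ℕ) = n - 1 ∧ ((Fin.rev i : Fin n) : ℕ) = n - 2 then 4
        else (if ((Fin.rev j : Fin n) : ℕ) + 1 = (Fin.rev i : Fin n) ∨
          ((Fin.rev i : Fin n) : ℕ) + 1 = (Fin.rev j : Fin n) then 3 else 2))) = _
  have hi := i.2
  have hj := j.2
  simp only [Fin.val_rev, Fin.ext_iff]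
  split_ifs <;> omega

theorem simpleOnWord_apply {n : ℕ} (i : Fin n) (l : Word n) (k : Fin n) :
    simpleOnWord i l k =
      if i.val = 0 then (if k = i then !(l i) else l k)
      else if k = i then l ⟨i.val - 1, by omega⟩
      else if k.val + 1 = i.val then l i else l k := by
  unfold simpleOnWord
  split_ifs with h1 h2 h3 h3
  · subst h2; simp
  · simp [h2]
  · subst h3; simp
  · have hk : (⟨i.val - 1, by omega⟩ : Fin n) = k := Fin.ext (by simp; omega)
    rw [hk, Function.comp_apply, Equiv.swap_apply_left]
  · rename_i h2
    rw [Function.comp_apply, Equiv.swap_apply_of_ne_of_ne _ h2]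
    intro h
    rw [Fin.ext_iff] at h
    simp at h; omega

theorem simpleOnWord_simpleOnWord {n : ℕ} (i : Fin n) (l : Word n) :
    simpleOnWord i (simpleOnWord i l) = l := by
  unfold simpleOnWord
  split_ifs with h
  · simp
  · funext k
    simp

/-- The permutation of the set of words given by `s_i`. -/
def simplePerm {n : ℕ} (i : Fin n) : Equiv.Perm (Word n) where
  toFun := simpleOnWord i
  invFun := simpleOnWord i
  left_inv := simpleOnWord_simpleOnWord i
  right_inv := simpleOnWord_simpleOnWord i

theorem simplePerm_apply {n : ℕ} (i : Fin n) (l : Word n) : simplePerm i l = simpleOnWord i l := rfl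

theorem simplePerm_mul_self {n : ℕ} (i : Fin n) : simplePerm i * simplePerm i = 1 :=
  Equiv.ext fun l ↦ simpleOnWord_simpleOnWord i l

theorem pow_four_of {G : Type} [Group G] {a b : G} (ha : a * a = 1) (hb : b * b = 1)
    (h : a * b * a * b = b * a * b * a) : (a * b) ^ 4 = 1 := by
  have : (a * b) ^ 4 = (a * b * a * b) * (a * b * a * b) := by
    simp only [pow_succ, pow_zero, one_mul, mul_assoc]
  rw [this]; nth_rewrite 1 [h]
  calc b * a * b * a * (a * b * a * b) = b * a * b * (a * a) * b * a * b := by simp only [mul_assoc]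
    _ = 1 := by
      rw [ha]; simp only [mul_one, mul_assoc]
      rw [← mul_assoc b b, hb, one_mul, ← mul_assoc a a, ha, one_mul, hb]

theorem pow_three_of {G : Type} [Group G] {a b : G} (ha : a * a = 1) (hb : b * b = 1)
    (h : a * b * a = b * a * b) : (a * b) ^ 3 = 1 := by
  have : (a * b) ^ 3 = (a * b * a) * (b * a * b) := by
    simp only [pow_succ, pow_zero, one_mul, mul_assoc]
  rw [this, ← h]
  calc a * b * a * (a * b * a) = a * b * (a * a) * b * a := by simp only [mul_assoc]
    _ = 1 := by
      rw [ha]; simp only [mul_one, mul_assoc]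
      rw [← mul_assoc b b, hb, one_mul, ha]

theorem pow_two_of {G : Type} [Group G] {a b : G} (ha : a * a = 1) (hb : b * b = 1)
    (h : a * b = b * a) : (a * b) ^ 2 = 1 := by
  rw [pow_two]; nth_rewrite 1 [h]
  rw [mul_assoc, ← mul_assoc a a, ha, one_mul, hb]

theorem simplePerm_braid_four {n : ℕ} {i j : Fin n} (hi : i.val = 0) (hj : j.val = 1) :
    simplePerm i * simplePerm j * simplePerm i * simplePerm j =
      simplePerm j * simplePerm i * simplePerm j * simplePerm i := by
  ext l k
  simp only [Equiv.Perm.mul_apply, simplePerm_apply, simpleOnWord_apply, Fin.ext_iff]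
  grind

theorem simplePerm_braid_three {n : ℕ} {i j : Fin n} (hi : i.val ≠ 0) (hj : j.val = i.val + 1) :
    simplePerm i * simplePerm j * simplePerm i = simplePerm j * simplePerm i * simplePerm j := by
  ext l k
  simp only [Equiv.Perm.mul_apply, simplePerm_apply, simpleOnWord_apply, Fin.ext_iff]
  grind

theorem simplePerm_comm {n : ℕ} {i j : Fin n} (h : i.val + 1 < j.val) :
    simplePerm i * simplePerm j = simplePerm j * simplePerm i := by
  ext l k
  simp only [Equiv.Perm.mul_apply, simplePerm_apply, simpleOnWord_apply, Fin.ext_iff]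
  grind

theorem simplePerm_isLiftable (n : ℕ) : (coxC n).IsLiftable (simplePerm (n := n)) := by
  intro i j
  have hi := simplePerm_mul_self i
  have hj := simplePerm_mul_self j
  rw [coxC_apply]
  split_ifs with h1 h2 h3
  · subst h1
    rw [pow_one, hi]
  · refine pow_four_of hi hj ?_
    rcases h2 with h | h
    · exact simplePerm_braid_four h.1 h.2
    · exact (simplePerm_braid_four h.1 h.2).symm
  · refine pow_three_of hi hj ?_
    rcases h3 with h | h
    · exact (simplePerm_braid_three (by omega) h.symm).symm
    · exact simplePerm_braid_three (by omega) h.symm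
  · refine pow_two_of hi hj ?_
    rcases lt_or_gt_of_ne (fun h ↦ h1 (Fin.ext h) : i.val ≠ j.val) with h | h
    · exact simplePerm_comm (by omega)
    · exact (simplePerm_comm (by omega)).symm

/-- The left action of the Weyl group of type `C_n` on words in which `s_i` acts as above. -/
def wordHom (n : ℕ) : (coxC n).Group →* Equiv.Perm (Word n) :=
  (coxC n).toCoxeterSystem.lift ⟨simplePerm, simplePerm_isLiftable n⟩

/-- The right action `l . w` of the Weyl group of type `C_n` on words. -/
def wordAct {n : ℕ} (l : Word n) (w : (coxC n).Group) : Word n := wordHom n w⁻¹ l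

theorem wordAct_mul {n : ℕ} (l : Word n) (v w : (coxC n).Group) :
    wordAct l (v * w) = wordAct (wordAct l v) w := by
  simp [wordAct, mul_inv_rev]

theorem wordAct_simple {n : ℕ} (l : Word n) (i : Fin n) :
    wordAct l ((coxC n).simple i) = simpleOnWord i l := by
  have h : ((coxC n).simple i)⁻¹ = (coxC n).toCoxeterSystem.simple i :=
    (coxC n).toCoxeterSystem.inv_simple i
  rw [wordAct, h, wordHom, CoxeterSystem.lift_apply_simple]
  rfl

/-- The word consisting of `n` symbols `∨`. -/
def allDown (n : ℕ) : Word n := fun _ ↦ false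

/-- The word `l†`, obtained from `l` by adding one symbol on the left such that the number of
symbols `∧` becomes even. -/
def dagger {n : ℕ} (l : Word n) : Word (n + 1) :=
  Fin.cons (decide (Odd (Finset.univ.filter fun k ↦ l k = true).card)) l

/-! ### Cup diagrams -/

/-- Combinatorial data of a marked diagram on `m` vertices: `partner i = j ≠ i` if `i` and `j` are
joined by a cup, `partner i = i` if there is a ray at `i`; `marked` is the set of the vertices at
which a marked cup or a marked ray ends. -/
@[ext]
structure Diagram (m : ℕ) where
  partner : Fin m → Fin m
  marked : Finset (Fin m)

/-- The planarity and accessibility conditions for cup diagrams. -/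
structure Diagram.IsCupDiagram {m : ℕ} (d : Diagram m) : Prop where
  partner_partner : ∀ i, d.partner (d.partner i) = i
  /-- Below a cup there are neither rays nor ends of cups that cross it. -/
  noncrossing : ∀ i j, i < j → j < d.partner i →
    d.partner j ≠ j ∧ i < d.partner j ∧ d.partner j < d.partner i
  marked_partner : ∀ i, i ∈ d.marked → d.partner i ∈ d.marked
  /-- A marked cup or ray with left end `i` is accessible from the left: there is no ray to the left
  of it, and it is not nested in a cup. -/
  accessible : ∀ i, i ∈ d.marked → i ≤ d.partner i → ∀ j, j < i →
    d.partner j ≠ j ∧ d.partner j < i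

/-- The number of marked rays. -/
def Diagram.markedRays {m : ℕ} (d : Diagram m) : ℕ :=
  (Finset.univ.filter fun i ↦ d.partner i = i ∧ i ∈ d.marked).card

/-- The number of unmarked cups, counted by their left ends. -/
def Diagram.unmarkedCups {m : ℕ} (d : Diagram m) : ℕ :=
  (Finset.univ.filter fun i ↦ i < d.partner i ∧ i ∉ d.marked).card

/-- The set `C_KL(m)` of cup diagrams on `m` vertices such that the number of marked rays plus the
number of unmarked cups is even. -/
def CKL (m : ℕ) : Type :=
  {d : Diagram m // d.IsCupDiagram ∧ Even (d.markedRays + d.unmarkedCups)}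

/-! ### The cup diagram of a word -/

/-- The vertex `k` is an end of one of the cups in `S`. -/
def Connected {m : ℕ} (S : Finset (Fin m × Fin m)) (k : Fin m) : Prop :=
  ∃ p ∈ S, p.1 = k ∨ p.2 = k

/-- `i < j` are not connected to a cup in `S`, but all vertices between them are. -/
def Neighboured {m : ℕ} (S : Finset (Fin m × Fin m)) (i j : Fin m) : Prop :=
  i < j ∧ ¬ Connected S i ∧ ¬ Connected S j ∧ ∀ k, i < k → k < j → Connected S k

/-- The sets of unmarked cups that arise by successively connecting neighboured symbols `∨∧`. -/
inductive UnmarkedStage {m : ℕ} (l : Word m) : Finset (Fin m × Fin m) → Prop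
  | start : UnmarkedStage l ∅
  | step (S : Finset (Fin m × Fin m)) (i j : Fin m) : UnmarkedStage l S → Neighboured S i j →
      l i = false → l j = true → UnmarkedStage l (insert (i, j) S)

/-- The sets of marked cups that arise, after the unmarked cups `U` have been drawn, by successively
connecting the leftmost two neighboured symbols `∧`. -/
inductive MarkedStage {m : ℕ} (l : Word m) (U : Finset (Fin m × Fin m)) :
    Finset (Fin m × Fin m) → Prop
  | start : MarkedStage l U ∅
  | step (V : Finset (Fin m × Fin m)) (i j : Fin m) : MarkedStage l U V → Neighboured (U ∪ V) i j →
      l i = true → l j = true → (∀ k, k < i → l k = true → Connected (U ∪ V) k) →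
      MarkedStage l U (insert (i, j) V)

/-- `d` is the diagram constructed from the word `l`: first connect neighboured `∨∧` by unmarked
cups as long as possible, then connect the remaining neighboured `∧` pairwise by marked cups
starting from the left, and finally attach rays to the remaining symbols, where a ray is marked if
and only if its symbol is `∧`. -/
def IsDiagramOf {m : ℕ} (l : Word m) (d : Diagram m) : Prop :=
  ∃ U V : Finset (Fin m × Fin m),
    UnmarkedStage l U ∧
    (¬ ∃ i j, Neighboured U i j ∧ l i = false ∧ l j = true) ∧
    MarkedStage l U V ∧
    (¬ ∃ i j, Neighboured (U ∪ V) i j ∧ l i = true ∧ l j = true) ∧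
    (∀ p ∈ U ∪ V, d.partner p.1 = p.2 ∧ d.partner p.2 = p.1) ∧
    (∀ k, ¬ Connected (U ∪ V) k → d.partner k = k) ∧
    (∀ k, k ∈ d.marked ↔ Connected V k ∨ (¬ Connected (U ∪ V) k ∧ l k = true))

/-! ### Stacking -/

/-- Combinatorial data of a marked diagram with `m` vertices at the top (`Sum.inl`) and `m` vertices
at the bottom (`Sum.inr`): `partner` gives the other end of the strand at a vertex, and `marked` is
the set of ends of marked strands. -/
structure Tangle (m : ℕ) where
  partner : Fin m ⊕ Fin m → Fin m ⊕ Fin m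
  marked : Finset (Fin m ⊕ Fin m)

/-- The diagram with a strand from each top vertex to the opposite bottom vertex, except for a cup at
the `(i+1)`-st and `(i+2)`-nd top vertices (counted from `1`) and a cap at the bottom
vertices opposite to them; the cup and the cap are both marked if `b` is true and both unmarked
otherwise. -/
def capCup {n : ℕ} (i : Fin n) (b : Bool) : Tangle (n + 1) where
  partner
    | Sum.inl k =>
      if k = i.castSucc then Sum.inl i.succ
      else if k = i.succ then Sum.inl i.castSucc else Sum.inr k
    | Sum.inr k =>
      if k = i.castSucc then Sum.inr i.succ
      else if k = i.succ then Sum.inr i.castSucc else Sum.inl k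
  marked :=
    if b then {Sum.inl i.castSucc, Sum.inl i.succ, Sum.inr i.castSucc, Sum.inr i.succ} else ∅

section Stack

variable {m : ℕ} (t : Tangle m) (d : Diagram m)

/-- The picture obtained by putting `t` on top of `d`: the top vertices of `t` are `Sum.inl k`, and
the bottom vertices of `t` are glued to the vertices of `d` to form the points `Sum.inr k`. Two of
these points lie in the same connected component if they are linked by strands of `t` and cups of
`d`. -/
def stackSetoid : Setoid (Fin m ⊕ Fin m) :=
  Relation.EqvGen.setoid fun x y ↦
    t.partner x = y ∨ ∃ k, x = Sum.inr k ∧ y = Sum.inr (d.partner k)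

/-- The connected components of the stacked picture. -/
abbrev Component : Type := Quotient (stackSetoid t d)

/-- The component of a point. -/
def comp (x : Fin m ⊕ Fin m) : Component t d := Quotient.mk (stackSetoid t d) x

/-- The marked strands of `t`, as unordered pairs of ends. -/
def Tangle.markedArcs : Finset (Sym2 (Fin m ⊕ Fin m)) := t.marked.image fun x ↦ s(x, t.partner x)

/-- The marked cups and rays of `d`, as unordered pairs of vertices; a ray at `k` is `s(k, k)`. -/
def Diagram.markedArcs : Finset (Sym2 (Fin m)) := d.marked.image fun k ↦ s(k, d.partner k)

open Classical in
/-- The number of markers on a component. -/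
def markers (c : Component t d) : ℕ :=
  (t.markedArcs.filter fun e ↦ ∀ x ∈ e, comp t d x = c).card +
    (d.markedArcs.filter fun e ↦ ∀ k ∈ e, comp t d (Sum.inr k) = c).card

/-- The component has an end on the upper edge of the picture. -/
def HasUpperEnd (c : Component t d) : Prop := ∃ k, comp t d (Sum.inl k) = c

/-- The component has an end on the lower edge of the picture, that is, it contains a ray of `d`. -/
def HasLowerEnd (c : Component t d) : Prop := ∃ k, d.partner k = k ∧ comp t d (Sum.inr k) = c

open Classical in
/-- The scalar by which a component without upper end is replaced, where pairs of markers on the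
same component cancel. Circles give `-(q + q⁻¹)` if unmarked and `0` if marked. Components with both
ends on the lower edge give `0` if unmarked and `1` if marked. -/
def weight (c : Component t d) : Laurent :=
  if HasUpperEnd t d c then 1
  else if HasLowerEnd t d c then (if Odd (markers t d c) then 1 else 0)
  else (if Odd (markers t d c) then 0 else -(q + qInv))

open Classical in
/-- The diagram that remains when all components without upper end are removed and pairs of markers
on the same component are cancelled. -/
def reduced : Diagram m where
  partner k :=
    if h : ∃ k', k' ≠ k ∧ comp t d (Sum.inl k') = comp t d (Sum.inl k) then h.choose else k
  marked := Finset.univ.filter fun k ↦ Odd (markers t d (comp t d (Sum.inl k)))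

open Classical in
/-- The value of the stacked picture, in the free `𝓛`-module on all diagrams. -/
def stack : Diagram m →₀ Laurent :=
  letI : Fintype (Component t d) := Fintype.ofFinite _
  Finsupp.single (reduced t d) (∏ c : Component t d, weight t d c)

end Stack

/-- The result of putting the picture of `C_{s_i}` on top of `d`. For `i = 0` this picture is the sum
of the unmarked and the marked cap-cup at the vertices `1` and `2`; for `i ≥ 1` it is the unmarked
cap-cup at the vertices `i + 1` and `i + 2`. -/
def generatorStack {n : ℕ} (i : Fin n) (d : Diagram (n + 1)) : Diagram (n + 1) →₀ Laurent :=
  if i.val = 0 then stack (capCup i false) d + stack (capCup i true) d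
  else stack (capCup i false) d

/-- The inclusion of the free `𝓛`-module on `C_KL(m)` into the free `𝓛`-module on all diagrams. -/
def inclusion (m : ℕ) : (CKL m →₀ Laurent) →ₗ[Laurent] (Diagram m →₀ Laurent) :=
  Finsupp.lmapDomain Laurent Laurent Subtype.val

end

end CupHecke

/-! Both sides are embedded in one free module, the Laurent-valued functions on words of length n =
m - 1 in ∧ and ∨.

Algebraic side. The map w ↦ ∨⋯∨ . w is a bijection from minimal coset representatives to words, and
the length of w is the `height` of its word (`isShort_iff`, `minCosetEquiv`). That the M_w form a
basis (`wordEquiv`) needs a linear map out of the Hecke algebra which separates the H_w. It comes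
from the regular representation: on the free module on the group, left and right multiplication by
generators commute by the folding condition, so an operator built from left multiplications is
determined by its value at 1. In word coordinates C_{s_i} becomes an explicit two-term operator
(`wordEquiv_rightAct_C`).

Diagram side. A diagram a is expanded into the function l ↦ weight of l† on a (`CKL.vec`). The
weight is zero unless l† orients a, and otherwise it is -q⁻¹ to the number of clockwise cups. On
words l†, every s_i that moves l, including s_0, changes both symbols at two neighbouring positions.
The operator of C_{s_0} therefore splits into the part where the first two symbols differ and the
part where they agree, and these are the unmarked and the marked picture. Since weights are products
over strands, finitely many identities on the strands meeting the cap show that a cap-cup turns the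
weight of d into a scalar times the weight of the joined diagram (`Diagram.capCupOp_weight`). An
analysis of connected components identifies the same scalar and diagram with the topological
simplification (`stack_capCup`). Hence the expansion intertwines the two actions.

Comparison. The expansion of a is 1 at the word of a and lies in q⁻¹ℤ[q⁻¹] at every other word. A
degree argument then gives injectivity (`cupExpansion_injective`). Surjectivity holds because the
image contains ∨⋯∨ and is stable under all C_{s_i} (`range_cupExpansion`). Comparing ranks shows
that every word belongs to a diagram. The drawing procedure is matched separately: a cup diagram is
constructed from l if and only if its word is l (`isDiagramOf_iff`).

Kazhdan–Lusztig property. The scalars -(q + q⁻¹), 0 and 1 are invariant under q ↦ q⁻¹, so the bar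
involution fixes all diagrams (`parabolicCupEquiv_barModule`). With the shape of the expansion this
makes them Kazhdan–Lusztig elements. Uniqueness is the usual argument: a bar invariant element with
coefficients of negative degree is zero (`isKL_iff`). -/

namespace CoxeterSystem

/-! ### Parity of inversion sequences and the folding condition. -/

variable {B W : Type*} [Group W] {M : CoxeterMatrix B} (cs : CoxeterSystem M W)

open scoped Classical in
/-- The simple reflection `s_i` acting on pairs of a group element and a sign. -/
noncomputable def signedConj (i : B) : Function.End (W × ZMod 2) := fun p ↦
  (cs.simple i * p.1 * cs.simple i, p.2 + if p.1 = cs.simple i then 1 else 0)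

-- With x = s_i s_j, the elements x^{-l} s_j for l < 2k are those against which the 2k alternating
-- factors successively test `p.1`; the sign counts modulo 2 how often the test succeeds.
open scoped Classical in
theorem signedConj_mul_pow (i j : B) (k : ℕ) (p : W × ZMod 2) :
    ((cs.signedConj i * cs.signedConj j) ^ k : Function.End (W × ZMod 2)) p =
      ((cs.simple i * cs.simple j) ^ k * p.1 * ((cs.simple i * cs.simple j) ^ k)⁻¹,
        p.2 + ∑ l ∈ Finset.range (2 * k),
          if p.1 = ((cs.simple i * cs.simple j) ^ l)⁻¹ * cs.simple j then 1 else 0) := by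
  induction k with
  | zero => exact Prod.ext (by simp; rfl) (by simp; rfl)
  | succ k ih =>
    have hj : cs.simple j * (cs.simple i * cs.simple j) * cs.simple j =
        (cs.simple i * cs.simple j)⁻¹ := by
      simp [mul_assoc]
    set x := cs.simple i * cs.simple j with hx
    have hjj : cs.simple j * cs.simple j = 1 := cs.simple_mul_simple_self j
    have hii : cs.simple i * cs.simple i = 1 := cs.simple_mul_simple_self i
    have hc : ∀ l : ℕ, cs.simple j * x ^ l = (x ^ l)⁻¹ * cs.simple j := by
      intro l
      have h1 : (MulAut.conj (cs.simple j)) x = x⁻¹ := by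
        rw [MulAut.conj_apply, cs.inv_simple, hj]
      have h2 := map_pow (MulAut.conj (cs.simple j)) x l
      rw [h1, MulAut.conj_apply, cs.inv_simple, inv_pow] at h2
      rw [← h2, mul_assoc, hjj, mul_one]
    have hi : cs.simple i = x * cs.simple j := by rw [hx, mul_assoc, hjj, mul_one]
    -- The two new factors test the conjugated element against s_j and then s_i. Pulled back to
    -- `p.1`, these tests are the terms l = 2k and l = 2k + 1.
    have e1 : x ^ k * p.1 * (x ^ k)⁻¹ = cs.simple j ↔ p.1 = (x ^ (2 * k))⁻¹ * cs.simple j := by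
      rw [mul_inv_eq_iff_eq_mul, hc, ← eq_inv_mul_iff_mul_eq, two_mul, pow_add, mul_inv_rev,
        mul_assoc]
    have e2 : cs.simple j * (x ^ k * p.1 * (x ^ k)⁻¹) * cs.simple j = cs.simple i ↔
        p.1 = (x ^ (2 * k + 1))⁻¹ * cs.simple j := by
      have : cs.simple j * (x ^ k * p.1 * (x ^ k)⁻¹) * cs.simple j = cs.simple i ↔
          x ^ k * p.1 * (x ^ k)⁻¹ = x⁻¹ * cs.simple j := by
        have hji : x⁻¹ * cs.simple j = cs.simple j * cs.simple i * cs.simple j := by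
          rw [hx]; simp
        rw [hji]
        constructor
        · intro h
          rw [← h]
          simp only [mul_assoc, hjj, mul_one]
          rw [← mul_assoc (cs.simple j), hjj, one_mul]
        · intro h
          rw [h]
          simp only [mul_assoc, hjj, mul_one]
          rw [← mul_assoc (cs.simple j), hjj, one_mul]
      rw [this, mul_inv_eq_iff_eq_mul, mul_assoc, hc, ← eq_inv_mul_iff_mul_eq]
      have : (x ^ (2 * k + 1))⁻¹ = (x ^ k)⁻¹ * (x⁻¹ * (x ^ k)⁻¹) := by group
      rw [this]; simp only [mul_assoc]
    rw [pow_succ']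
    change cs.signedConj i (cs.signedConj j
      (((cs.signedConj i * cs.signedConj j) ^ k : Function.End (W × ZMod 2)) p)) = _
    rw [ih]
    simp only [signedConj]
    refine Prod.ext ?_ ?_
    · change _ = x ^ (k + 1) * p.1 * (x ^ (k + 1))⁻¹
      have : x⁻¹ = cs.simple j * cs.simple i := by rw [hx]; simp
      rw [pow_succ', mul_inv_rev, this]
      simp only [hx, mul_assoc]
    · simp only [e1, e2]
      rw [show 2 * (k + 1) = 2 * k + 1 + 1 by ring, Finset.sum_range_succ, Finset.sum_range_succ]
      ring

/-- Since x^{M i j} = 1, the terms of the sign repeat with period M i j, so they cancel in pairs in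
`ZMod 2`. -/
theorem signedConj_isLiftable : M.IsLiftable cs.signedConj := by
  classical
  intro i j
  have h := cs.simple_mul_simple_pow i j
  funext p
  rw [signedConj_mul_pow, h]
  refine Prod.ext (by simp; rfl) ?_
  change p.2 + _ = p.2
  rw [two_mul, Finset.sum_range_add]
  have : ∀ l, (cs.simple i * cs.simple j) ^ (M i j + l) = (cs.simple i * cs.simple j) ^ l :=
    fun l ↦ by rw [pow_add, h, one_mul]
  simp only [this]
  rw [CharTwo.add_self_eq_zero, add_zero]

/-- The action of a Coxeter group on pairs of a group element and a sign. -/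
noncomputable def signedConjHom : W →* Function.End (W × ZMod 2) :=
  cs.lift ⟨cs.signedConj, cs.signedConj_isLiftable⟩

-- The left side depends only on the group element. Hence the parity of the multiplicity of an
-- element in `rightInvSeq` is the same for all words, reduced or not, with the same product.
open scoped Classical in
theorem signedConjHom_wordProd (ω : List B) (p : W × ZMod 2) :
    cs.signedConjHom (cs.wordProd ω) p =
      (cs.wordProd ω * p.1 * (cs.wordProd ω)⁻¹, p.2 + ((cs.rightInvSeq ω).count p.1 : ℕ)) := by
  induction ω with
  | nil => exact Prod.ext (by simp; rfl) (by simp; rfl)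
  | cons i ω ih =>
    rw [cs.wordProd_cons, map_mul]
    change cs.signedConjHom (cs.simple i) (cs.signedConjHom (cs.wordProd ω) p) = _
    rw [ih, signedConjHom, cs.lift_apply_simple]
    refine Prod.ext ?_ ?_
    · simp [signedConj, mul_assoc]
    · simp only [signedConj, rightInvSeq, List.count_cons, Nat.cast_add, add_assoc]
      congr 2
      have : cs.wordProd ω * p.1 * (cs.wordProd ω)⁻¹ = cs.simple i ↔
          (cs.wordProd ω)⁻¹ * cs.simple i * cs.wordProd ω = p.1 := by
        constructor
        · intro h; rw [← h]; group
        · intro h; rw [← h]; group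
      by_cases h : cs.wordProd ω * p.1 * (cs.wordProd ω)⁻¹ = cs.simple i
      · simp [h, this.1 h]
      · simp [h, mt this.2 h]

/-- A right descent of an element occurs in the right inversion sequence of every reduced word. -/
theorem simple_mem_rightInvSeq {ω : List B} {j : B}
    (h : cs.IsRightDescent (cs.wordProd ω) j) : cs.simple j ∈ cs.rightInvSeq ω := by
  classical
  -- A reduced word of w s_j followed by j is a reduced word of w in whose inversion sequence s_j
  -- occurs exactly once. By parity s_j also occurs in that of `ω`.
  obtain ⟨ω', hω', he⟩ := cs.exists_isReduced (cs.wordProd ω * cs.simple j)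
  have hprod : cs.wordProd (ω'.concat j) = cs.wordProd ω := by
    rw [cs.wordProd_concat, ← he, cs.simple_mul_simple_cancel_right]
  have hred : cs.IsReduced (ω'.concat j) := by
    have h1 := cs.isRightDescent_iff.1 h
    have h2 : cs.length (cs.wordProd ω') = ω'.length := hω'
    rw [IsReduced, hprod, List.length_concat, ← h2, ← he, h1]
  have hmem : cs.simple j ∈ cs.rightInvSeq (ω'.concat j) := by
    rw [rightInvSeq_concat]; simp
  have hcount := List.count_eq_one_of_mem hred.nodup_rightInvSeq hmem
  have h1 := cs.signedConjHom_wordProd (ω'.concat j) (cs.simple j, 0)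
  rw [hprod, cs.signedConjHom_wordProd ω, hcount] at h1
  have h2 := congrArg Prod.snd h1
  by_contra hn
  rw [List.count_eq_zero_of_not_mem hn] at h2
  simp at h2

/-- The folding condition. -/
theorem simple_mul_eq_mul_simple {w : W} {i j : B} (hi : ¬ cs.IsLeftDescent w i)
    (hj : ¬ cs.IsRightDescent w j) (hij : cs.IsRightDescent (cs.simple i * w) j) :
    cs.simple i * w = w * cs.simple j := by
  obtain ⟨ω, hω, rfl⟩ := cs.exists_isReduced w
  rw [← cs.wordProd_cons] at hij
  have h := cs.simple_mem_rightInvSeq hij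
  -- The first entry is w⁻¹ s_i w, and equality with it is the claim. The other entries are right
  -- inversions of w, and s_j is none.
  rw [rightInvSeq, List.mem_cons] at h
  rcases h with h | h
  · rw [h]; group
  · exact absurd ((cs.isRightInversion_simple_iff_isRightDescent _ _).1
      (cs.isRightInversion_of_mem_rightInvSeq hω h)) hj

/-- If multiplication on one side affects a descent on the other, the folding condition applies: to
w itself, or to s_i w when s_i is a left descent. -/
theorem simple_mul_eq_mul_simple_of_not_iff {w : W} {i j : B}
    (h : ¬ (cs.IsRightDescent (cs.simple i * w) j ↔ cs.IsRightDescent w j) ∨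
      ¬ (cs.IsLeftDescent (w * cs.simple j) i ↔ cs.IsLeftDescent w i)) :
    cs.simple i * w = w * cs.simple j := by
  have h1 := cs.length_simple_mul w i
  have h2 := cs.length_mul_simple w j
  have h3 := cs.length_mul_simple (cs.simple i * w) j
  have h4 := cs.length_simple_mul (w * cs.simple j) i
  rw [← mul_assoc] at h4
  simp only [IsRightDescent, IsLeftDescent, ← mul_assoc] at h
  by_cases hi : cs.IsLeftDescent w i
  · have hi' := hi
    rw [IsLeftDescent] at hi'
    have key := cs.simple_mul_eq_mul_simple (w := cs.simple i * w) (i := i) (j := j)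
      (by rw [IsLeftDescent, cs.simple_mul_simple_cancel_left]; omega)
      (by rw [IsRightDescent]; omega)
      (by rw [IsRightDescent, cs.simple_mul_simple_cancel_left]; omega)
    rw [cs.simple_mul_simple_cancel_left] at key
    nth_rw 2 [key]
    rw [cs.simple_mul_simple_cancel_right]
  · have hi' := hi
    rw [IsLeftDescent] at hi'
    exact cs.simple_mul_eq_mul_simple hi (by rw [IsRightDescent]; omega)
      (by rw [IsRightDescent]; omega)

end CoxeterSystem

namespace CupHecke

/-! ### The regular representation of a Hecke algebra -/

section Regular

variable {B : Type} (M : CoxeterMatrix B)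

open scoped Classical in
/-- Left multiplication by `H_s` on the free module on the Coxeter group. -/
noncomputable def leftOp (i : B) : Module.End Laurent (M.Group →₀ Laurent) :=
  Finsupp.linearCombination Laurent fun w ↦ Finsupp.single (M.simple i * w) 1 +
    if len M (M.simple i * w) < len M w then (qInv - q) • Finsupp.single w 1 else 0

open scoped Classical in
/-- Right multiplication by `H_s` on the free module on the Coxeter group. -/
noncomputable def rightOp (i : B) : Module.End Laurent (M.Group →₀ Laurent) :=
  Finsupp.linearCombination Laurent fun w ↦ Finsupp.single (w * M.simple i) 1 +
    if len M (w * M.simple i) < len M w then (qInv - q) • Finsupp.single w 1 else 0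

open scoped Classical in
theorem leftOp_single (i : B) (w : M.Group) :
    leftOp M i (Finsupp.single w 1) = Finsupp.single (M.simple i * w) 1 +
      if len M (M.simple i * w) < len M w then (qInv - q) • Finsupp.single w 1 else 0 := by
  rw [leftOp, Finsupp.linearCombination_single, one_smul]

open scoped Classical in
theorem rightOp_single (i : B) (w : M.Group) :
    rightOp M i (Finsupp.single w 1) = Finsupp.single (w * M.simple i) 1 +
      if len M (w * M.simple i) < len M w then (qInv - q) • Finsupp.single w 1 else 0 := by
  rw [rightOp, Finsupp.linearCombination_single, one_smul]

theorem simple_mul_cancel_left (i : B) (w : M.Group) : M.simple i * (M.simple i * w) = w :=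
  M.toCoxeterSystem.simple_mul_simple_cancel_left i

theorem simple_mul_cancel_right (i : B) (w : M.Group) : w * M.simple i * M.simple i = w :=
  M.toCoxeterSystem.simple_mul_simple_cancel_right i

theorem len_simple_mul (i : B) (w : M.Group) :
    len M (M.simple i * w) = len M w + 1 ∨ len M (M.simple i * w) + 1 = len M w :=
  M.toCoxeterSystem.length_simple_mul w i

theorem len_mul_simple (i : B) (w : M.Group) :
    len M (w * M.simple i) = len M w + 1 ∨ len M (w * M.simple i) + 1 = len M w :=
  M.toCoxeterSystem.length_mul_simple w i

theorem len_simple (i : B) : len M (M.simple i) = 1 := M.toCoxeterSystem.length_simple i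

/-- If s_i w ≠ w s_j, neither multiplication affects the descent on the other side, and both
composites have the same terms. If s_i w = w s_j, the two operators agree on w and on w s_j. -/
theorem leftOp_commute_rightOp (i j : B) : Commute (leftOp M i) (rightOp M j) := by
  classical
  refine Finsupp.lhom_ext' fun w ↦ LinearMap.ext_ring ?_
  change leftOp M i (rightOp M j (Finsupp.single w 1)) =
    rightOp M j (leftOp M i (Finsupp.single w 1))
  rw [rightOp_single, leftOp_single, map_add, map_add, apply_ite (leftOp M i),
    apply_ite (rightOp M j), map_smul, map_smul, map_zero, map_zero, leftOp_single,
    rightOp_single, leftOp_single, rightOp_single, mul_assoc]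
  by_cases h : M.simple i * w = w * M.simple j
  · simp only [h, ← mul_assoc, simple_mul_cancel_right]
  · have h1 : len M (M.simple i * (w * M.simple j)) < len M (w * M.simple j) ↔
        len M (M.simple i * w) < len M w := by
      by_contra hn
      exact h (M.toCoxeterSystem.simple_mul_eq_mul_simple_of_not_iff (Or.inr hn))
    have h2 : len M (M.simple i * (w * M.simple j)) < len M (M.simple i * w) ↔
        len M (w * M.simple j) < len M w := by
      rw [← mul_assoc]
      by_contra hn
      exact h (M.toCoxeterSystem.simple_mul_eq_mul_simple_of_not_iff (Or.inl hn))
    simp only [h1, h2]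
    split_ifs <;> module

/-- Left multiplication by a product of generators. -/
noncomputable def wordOp (ω : List B) : Module.End Laurent (M.Group →₀ Laurent) :=
  (ω.map (leftOp M)).prod

theorem wordOp_append (ω ω' : List B) : wordOp M (ω ++ ω') = wordOp M ω * wordOp M ω' := by
  simp [wordOp]

theorem wordOp_commute_rightOp (ω : List B) (j : B) : Commute (wordOp M ω) (rightOp M j) :=
  Commute.list_prod_left _ _ fun x hx ↦ by
    obtain ⟨i, -, rfl⟩ := List.mem_map.1 hx
    exact leftOp_commute_rightOp M i j

theorem wordOp_single_one {ω : List B} (h : M.toCoxeterSystem.IsReduced ω) :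
    wordOp M ω (Finsupp.single 1 1) = Finsupp.single (M.toCoxeterSystem.wordProd ω) 1 := by
  induction ω with
  | nil => simp [wordOp]
  | cons i ω ih =>
    have hω : M.toCoxeterSystem.IsReduced ω := h.drop 1
    have hd : ¬ len M (M.simple i * M.toCoxeterSystem.wordProd ω) <
        len M (M.toCoxeterSystem.wordProd ω) := by
      have h' := h.eq
      rw [M.toCoxeterSystem.wordProd_cons, List.length_cons, ← hω.eq] at h'
      change len M (M.simple i * M.toCoxeterSystem.wordProd ω) = _ + 1 at h'
      rw [h', not_lt]
      exact Nat.le_succ _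
    have : wordOp M (i :: ω) = leftOp M i * wordOp M ω := by simp [wordOp]
    rw [this, Module.End.mul_apply, ih hω, leftOp_single, if_neg hd, add_zero,
      M.toCoxeterSystem.wordProd_cons]
    rfl

/-- Right operators along a reduced word lead from 1 to any basis element and commute with `wordOp`,
so the value at 1 determines everything. This makes `groupOp` independent of the reduced word and
replaces Matsumoto's theorem. -/
theorem wordOp_ext {ω ω' : List B}
    (h : wordOp M ω (Finsupp.single 1 1) = wordOp M ω' (Finsupp.single 1 1)) :
    wordOp M ω = wordOp M ω' := by
  refine Finsupp.lhom_ext' fun w ↦ LinearMap.ext_ring ?_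
  change wordOp M ω (Finsupp.single w 1) = wordOp M ω' (Finsupp.single w 1)
  induction hk : len M w generalizing w with
  | zero =>
    rw [M.toCoxeterSystem.length_eq_zero_iff.1 hk]
    exact h
  | succ k ih =>
    have hw : w ≠ 1 := by
      rintro rfl
      simp [len] at hk
    obtain ⟨j, hj⟩ := M.toCoxeterSystem.exists_rightDescent_of_ne_one hw
    have hj' : len M (w * M.simple j) < len M w := hj
    have hk' := len_mul_simple M j w
    have e : rightOp M j (Finsupp.single (w * M.simple j) 1) = Finsupp.single w 1 := by
      rw [rightOp_single, simple_mul_cancel_right, if_neg hj'.not_gt, add_zero]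
    have c := fun ω ↦ LinearMap.congr_fun (wordOp_commute_rightOp M ω j).eq
      (Finsupp.single (w * M.simple j) 1)
    simp only [Module.End.mul_apply, e] at c
    rw [c, c, ih _ (by omega)]

/-- Left multiplication by `H_w`. -/
noncomputable def groupOp (w : M.Group) : Module.End Laurent (M.Group →₀ Laurent) :=
  wordOp M (M.toCoxeterSystem.exists_isReduced w).choose

theorem groupOp_wordProd {ω : List B} (h : M.toCoxeterSystem.IsReduced ω) :
    groupOp M (M.toCoxeterSystem.wordProd ω) = wordOp M ω := by
  have h' := (M.toCoxeterSystem.exists_isReduced (M.toCoxeterSystem.wordProd ω)).choose_spec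
  refine wordOp_ext M ?_
  rw [wordOp_single_one M h, wordOp_single_one M h'.1, ← h'.2]

theorem groupOp_single_one (w : M.Group) : groupOp M w (Finsupp.single 1 1) = Finsupp.single w 1 := by
  obtain ⟨ω, h, rfl⟩ := M.toCoxeterSystem.exists_isReduced w
  rw [groupOp_wordProd M h, wordOp_single_one M h]

theorem groupOp_simple (i : B) : groupOp M (M.simple i) = leftOp M i := by
  have h : M.toCoxeterSystem.IsReduced [i] := by
    rw [CoxeterSystem.IsReduced, M.toCoxeterSystem.wordProd_singleton,
      M.toCoxeterSystem.length_simple, List.length_singleton]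
  have := groupOp_wordProd M h
  rw [M.toCoxeterSystem.wordProd_singleton] at this
  refine this.trans ?_
  simp [wordOp]

theorem leftOp_mul_self (i : B) : leftOp M i * leftOp M i = 1 + (qInv - q) • leftOp M i := by
  classical
  refine Finsupp.lhom_ext' fun w ↦ LinearMap.ext_ring ?_
  change leftOp M i (leftOp M i (Finsupp.single w 1)) =
    Finsupp.single w 1 + (qInv - q) • leftOp M i (Finsupp.single w 1)
  have h := len_simple_mul M i w
  rw [leftOp_single, map_add, leftOp_single, simple_mul_cancel_left, apply_ite (leftOp M i),
    map_smul, map_zero, leftOp_single]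
  by_cases hd : len M (M.simple i * w) < len M w
  · simp only [if_neg hd.not_gt, if_pos hd, add_zero]
  · simp only [if_neg hd, if_pos (show len M w < len M (M.simple i * w) by omega), add_zero]

theorem groupOp_one : groupOp M 1 = 1 := by
  have h : M.toCoxeterSystem.IsReduced [] := by simp [CoxeterSystem.IsReduced]
  have := groupOp_wordProd M h
  rwa [M.toCoxeterSystem.wordProd_nil] at this

theorem groupOp_mul {v w : M.Group} (h : len M v + len M w = len M (v * w)) :
    groupOp M v * groupOp M w = groupOp M (v * w) := by
  obtain ⟨ω, hω, rfl⟩ := M.toCoxeterSystem.exists_isReduced v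
  obtain ⟨ω', hω', rfl⟩ := M.toCoxeterSystem.exists_isReduced w
  rw [len, len, len, ← M.toCoxeterSystem.wordProd_append, hω.eq, hω'.eq] at h
  rw [groupOp_wordProd M hω, groupOp_wordProd M hω', ← wordOp_append,
    ← M.toCoxeterSystem.wordProd_append, groupOp_wordProd]
  rw [CoxeterSystem.IsReduced, ← h, List.length_append]

/-- The regular representation of the Hecke algebra. -/
noncomputable def regular : Hecke M →ₐ[Laurent] Module.End Laurent (M.Group →₀ Laurent) :=
  heckeLift M (groupOp M) (groupOp_one M) (fun _ _ h ↦ groupOp_mul M h)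
    (fun i ↦ by rw [groupOp_simple, leftOp_mul_self])

theorem regular_H (w : M.Group) : regular M (H M w) = groupOp M w :=
  heckeLift_H M _ _ _ _ w

/-- The linear map from the Hecke algebra to the free module on the group that sends `H_w` to `w`. -/
noncomputable def toFree : Hecke M →ₗ[Laurent] (M.Group →₀ Laurent) :=
  LinearMap.applyₗ (Finsupp.single 1 1) ∘ₗ (regular M).toLinearMap

theorem toFree_H (w : M.Group) : toFree M (H M w) = Finsupp.single w 1 := by
  change regular M (H M w) (Finsupp.single 1 1) = _
  rw [regular_H, groupOp_single_one]

theorem toFree_H_simple_mul (i : B) (x : Hecke M) :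
    toFree M (H M (M.simple i) * x) = leftOp M i (toFree M x) := by
  change regular M (H M (M.simple i) * x) (Finsupp.single 1 1) = _
  rw [map_mul, Module.End.mul_apply, regular_H, groupOp_simple]
  rfl

theorem H_simple_mul_of_lt {i : B} {w : M.Group} (h : len M w < len M (M.simple i * w)) :
    H M (M.simple i) * H M w = H M (M.simple i * w) := by
  have h1 := len_simple M i
  have h2 := len_simple_mul M i w
  exact H_mul (by omega)

theorem H_mul_simple_of_lt {i : B} {w : M.Group} (h : len M w < len M (w * M.simple i)) :
    H M w * H M (M.simple i) = H M (w * M.simple i) := by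
  have h1 := len_simple M i
  have h2 := len_mul_simple M i w
  exact H_mul (by omega)

theorem H_mul_simple_of_gt {i : B} {w : M.Group} (h : len M (w * M.simple i) < len M w) :
    H M w * H M (M.simple i) = H M (w * M.simple i) + (qInv - q) • H M w := by
  have := H_mul_simple_of_lt M (i := i) (w := w * M.simple i) (by rwa [simple_mul_cancel_right])
  rw [simple_mul_cancel_right] at this
  rw [← this, mul_assoc, H_quad, mul_add, mul_one, mul_smul_comm]

theorem H_simple_mul_of_gt {i : B} {w : M.Group} (h : len M (M.simple i * w) < len M w) :
    H M (M.simple i) * H M w = H M (M.simple i * w) + (qInv - q) • H M w := by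
  have := H_simple_mul_of_lt M (i := i) (w := M.simple i * w) (by rwa [simple_mul_cancel_left])
  rw [simple_mul_cancel_left] at this
  rw [← this, ← mul_assoc, H_quad, add_mul, one_mul, smul_mul_assoc]

/-- The two multiplication rules make the span stable under left multiplication by each H_s, hence
by each H_w and by the whole algebra. As it contains 1, it is everything. -/
theorem span_range_H : Submodule.span Laurent (Set.range (H M)) = ⊤ := by
  set S := Submodule.span Laurent (Set.range (H M)) with hS
  have hH : ∀ w, H M w ∈ S := fun w ↦ Submodule.subset_span ⟨w, rfl⟩
  have hsimple : ∀ i, ∀ x ∈ S, H M (M.simple i) * x ∈ S := by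
    intro i x hx
    induction hx using Submodule.span_induction with
    | mem x hx =>
      obtain ⟨w, rfl⟩ := hx
      rcases lt_or_gt_of_ne (M.toCoxeterSystem.length_simple_mul_ne w i) with h | h
      · rw [H_simple_mul_of_gt M h]
        exact add_mem (hH _) (S.smul_mem _ (hH _))
      · rw [H_simple_mul_of_lt M h]
        exact hH _
    | zero => simp
    | add x y _ _ hx hy => rw [mul_add]; exact add_mem hx hy
    | smul c x _ hx => rw [mul_smul_comm]; exact S.smul_mem _ hx
  have hgroup : ∀ w, ∀ x ∈ S, H M w * x ∈ S := by
    intro w x hx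
    induction hk : len M w generalizing w with
    | zero => rw [M.toCoxeterSystem.length_eq_zero_iff.1 hk, H_one, one_mul]; exact hx
    | succ k ih =>
      have hw : w ≠ 1 := by
        rintro rfl
        simp [len] at hk
      obtain ⟨i, hi⟩ := M.toCoxeterSystem.exists_leftDescent_of_ne_one hw
      have h1 : len M (M.simple i * w) + 1 = len M w := M.toCoxeterSystem.isLeftDescent_iff.1 hi
      have := H_simple_mul_of_lt M (i := i) (w := M.simple i * w)
        (by rw [simple_mul_cancel_left]; omega)
      rw [simple_mul_cancel_left] at this
      rw [← this, mul_assoc]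
      exact hsimple _ _ (ih _ (by omega))
  let π : FreeAlgebra Laurent M.Group →ₐ[Laurent] Hecke M :=
    RingQuot.mkAlgHom Laurent (HeckeRel M)
  rw [eq_top_iff]
  rintro x -
  obtain ⟨y, hy⟩ : ∃ y, π y = x := RingQuot.mkAlgHom_surjective Laurent (HeckeRel M) x
  subst hy
  -- Stability under left multiplication, unlike mere membership, passes to products in the free
  -- algebra.
  suffices ∀ z ∈ S, π y * z ∈ S by
    have h := this (H M 1) (hH 1)
    rwa [H_one, mul_one] at h
  induction y using FreeAlgebra.induction with
  | grade0 r =>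
    intro z hz
    rw [AlgHom.commutes, ← Algebra.smul_def]
    exact S.smul_mem _ hz
  | grade1 w => exact hgroup w
  | mul a b ha hb =>
    intro z hz
    rw [map_mul, mul_assoc]
    exact ha _ (hb _ hz)
  | add a b ha hb =>
    intro z hz
    rw [map_add, add_mul]
    exact add_mem (ha _ hz) (hb _ hz)

end Regular

end CupHecke

namespace CupHecke

/-! ### Words and minimal coset representatives -/

section Words

variable {n : ℕ}

/-- The sum of the positions, counted from `1`, of the symbols `∧`. -/
def height (l : Word n) : ℕ := ∑ k : Fin n, if l k = true then k.val + 1 else 0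

theorem simpleOnWord_eq_self_iff (i : Fin n) (l : Word n) :
    simpleOnWord i l = l ↔ i.val ≠ 0 ∧ l ⟨i.val - 1, by omega⟩ = l i := by
  constructor
  · intro h
    have h1 := congrFun h i
    rw [simpleOnWord_apply] at h1
    by_cases h0 : i.val = 0
    · simp [h0] at h1
    · simpa [h0] using h1
  · rintro ⟨h0, h⟩
    funext k
    rw [simpleOnWord_apply]
    simp only [if_neg h0]
    split_ifs with h1 h2
    · rw [h1, h]
    · rw [← h]
      congr 1
      exact Fin.ext (by simp; omega)
    · rfl

/-- A ∧ at position i is removed if i = 0 and otherwise moves one place to the left; a ∨ there means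
that a ∧ is created at the first place or arrives from the left. The height changes by one, written
without subtraction. -/
theorem height_simpleOnWord (i : Fin n) (l : Word n) (h : simpleOnWord i l ≠ l) :
    height (simpleOnWord i l) + (if l i = true then 1 else 0) =
      height l + (if l i = true then 0 else 1) := by
  unfold height
  rw [← Finset.add_sum_erase _ _ (Finset.mem_univ i),
    ← Finset.add_sum_erase (a := i) Finset.univ (fun k : Fin n ↦ if l k = true then k.val + 1 else 0)
      (Finset.mem_univ i)]
  by_cases h0 : i.val = 0
  · have : ∀ k ∈ Finset.univ.erase i, (if simpleOnWord i l k = true then k.val + 1 else 0) =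
        if l k = true then k.val + 1 else 0 := by
      intro k hk
      rw [simpleOnWord_apply, if_pos h0, if_neg (Finset.ne_of_mem_erase hk)]
    rw [Finset.sum_congr rfl this, simpleOnWord_apply, if_pos h0, if_pos rfl]
    cases l i <;> simp [h0, add_comm]
  · set j : Fin n := ⟨i.val - 1, by omega⟩ with hj
    have hji : j ≠ i := fun h ↦ h0 (by have := congrArg Fin.val h; simp [hj] at this; omega)
    have hjm : j ∈ Finset.univ.erase i := Finset.mem_erase.2 ⟨hji, Finset.mem_univ _⟩
    rw [← Finset.add_sum_erase _ _ hjm,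
      ← Finset.add_sum_erase _ (fun k : Fin n ↦ if l k = true then k.val + 1 else 0) hjm]
    have : ∀ k ∈ (Finset.univ.erase i).erase j,
        (if simpleOnWord i l k = true then k.val + 1 else 0) =
          if l k = true then k.val + 1 else 0 := by
      intro k hk
      rw [Finset.mem_erase, Finset.mem_erase] at hk
      have hkj : k.val + 1 ≠ i.val := fun hki ↦ hk.1 (Fin.ext (by simp [hj]; omega))
      have : simpleOnWord i l k = l k := by simp [simpleOnWord_apply, h0, hk.2.1, hkj]
      rw [this]
    have hjv : j.val + 1 = i.val := by simp [hj]; omega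
    have ei : simpleOnWord i l i = l j := by simp [simpleOnWord_apply, h0, hj]
    have ej : simpleOnWord i l j = l i := by simp [simpleOnWord_apply, h0, hji, hjv]
    rw [Finset.sum_congr rfl this, ei, ej]
    have hne : l j ≠ l i := fun he ↦ h ((simpleOnWord_eq_self_iff i l).2 ⟨h0, he⟩)
    cases h1 : l i <;> cases h2 : l j <;> simp_all <;> omega

theorem height_allDown : height (allDown n) = 0 := by simp [height, allDown]

/-- Walk to the left from any ∧ as long as the preceding symbol is also ∧. The walk ends at the
first position, where s_0 acts, or just after a ∨. -/
theorem exists_reduction {l : Word n} (h : l ≠ allDown n) :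
    ∃ i, l i = true ∧ simpleOnWord i l ≠ l := by
  have : ∃ k, l k = true := by
    by_contra hn
    push Not at hn
    exact h (funext fun k ↦ by simpa [allDown] using hn k)
  obtain ⟨⟨k, hk⟩, hl⟩ := this
  induction k with
  | zero => exact ⟨_, hl, fun h ↦ ((simpleOnWord_eq_self_iff _ _).1 h).1 rfl⟩
  | succ k ih =>
    by_cases hp : l ⟨k, by omega⟩ = true
    · exact ih _ hp
    · refine ⟨_, hl, fun h ↦ hp ?_⟩
      exact ((simpleOnWord_eq_self_iff _ _).1 h).2.trans hl

/-- Induction on words, adding one symbol `∧` or moving one to the right in each step. -/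
theorem word_induction {p : Word n → Prop} (one : p (allDown n))
    (step : ∀ l i, l i = false → simpleOnWord i l ≠ l → p l → p (simpleOnWord i l)) (l : Word n) :
    p l := by
  induction hk : height l generalizing l with
  | zero =>
    by_cases h : l = allDown n
    · exact h ▸ one
    · obtain ⟨i, hi, hl⟩ := exists_reduction h
      have := height_simpleOnWord i l hl
      simp only [hi, if_true] at this
      omega
  | succ k ih =>
    by_cases h : l = allDown n
    · exact h ▸ one
    · obtain ⟨i, hi, hl⟩ := exists_reduction h
      have := height_simpleOnWord i l hl
      simp only [hi, if_true] at this
      have h1 : simpleOnWord i l i = false := by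
        rw [simpleOnWord_apply]
        by_cases h0 : i.val = 0
        · simp [h0, hi]
        · rw [if_neg h0, if_pos rfl]
          have : l ⟨i.val - 1, by omega⟩ ≠ l i := fun he ↦
            hl ((simpleOnWord_eq_self_iff i l).2 ⟨h0, he⟩)
          simpa [hi] using this
      have := step (simpleOnWord i l) i h1 (by rw [simpleOnWord_simpleOnWord]; exact hl.symm)
        (ih _ (by omega))
      rwa [simpleOnWord_simpleOnWord] at this

theorem wordAct_one (l : Word n) : wordAct l 1 = l := by simp [wordAct]

theorem wordAct_mul_simple (l : Word n) (w : (coxC n).Group) (i : Fin n) :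
    wordAct l (w * (coxC n).simple i) = simpleOnWord i (wordAct l w) := by
  rw [wordAct_mul, wordAct_simple]

theorem wordAct_allDown_simple_mul {i : Fin n} (hi : i ∈ typeA n) (w : (coxC n).Group) :
    wordAct (allDown n) ((coxC n).simple i * w) = wordAct (allDown n) w := by
  rw [wordAct_mul, wordAct_simple, (simpleOnWord_eq_self_iff i _).2 ⟨hi, rfl⟩]

theorem len_one : len (coxC n) 1 = 0 := (coxC n).toCoxeterSystem.length_one

theorem len_eq_zero {w : (coxC n).Group} : len (coxC n) w = 0 ↔ w = 1 :=
  (coxC n).toCoxeterSystem.length_eq_zero_iff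

theorem exists_eq_mul_simple {w : (coxC n).Group} {k : ℕ} (hw : len (coxC n) w = k + 1) :
    ∃ v i, w = v * (coxC n).simple i ∧ len (coxC n) v = k := by
  have h : w ≠ 1 := by
    rintro rfl
    rw [len_one] at hw
    omega
  obtain ⟨i, hi⟩ := (coxC n).toCoxeterSystem.exists_rightDescent_of_ne_one h
  refine ⟨w * (coxC n).simple i, i, (simple_mul_cancel_right _ _ _).symm, ?_⟩
  have h1 := len_mul_simple (coxC n) i w
  have h2 : len (coxC n) (w * (coxC n).simple i) < len (coxC n) w := hi
  omega

/-- Each letter of a reduced expression raises the height by at most one, starting from 0. -/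
theorem height_le_len (w : (coxC n).Group) : height (wordAct (allDown n) w) ≤ len (coxC n) w := by
  induction hk : len (coxC n) w generalizing w with
  | zero => rw [len_eq_zero.1 hk, wordAct_one, height_allDown]
  | succ k ih =>
    obtain ⟨v, i, rfl, hv⟩ := exists_eq_mul_simple hk
    have := ih v hv
    rw [wordAct_mul_simple]
    by_cases h : simpleOnWord i (wordAct (allDown n) v) = wordAct (allDown n) v
    · rw [h]; omega
    · have := height_simpleOnWord i _ h
      split_ifs at this <;> omega

/-- The length of `w` is the height of the word `∨⋯∨ . w`. -/
def IsShort (w : (coxC n).Group) : Prop := len (coxC n) w = height (wordAct (allDown n) w)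

theorem IsShort.mul_simple {v : (coxC n).Group} {i : Fin n} (hv : IsShort v)
    (h1 : wordAct (allDown n) v i = false)
    (h2 : simpleOnWord i (wordAct (allDown n) v) ≠ wordAct (allDown n) v) :
    IsShort (v * (coxC n).simple i) := by
  have h := height_simpleOnWord i _ h2
  have h3 := height_le_len (v * (coxC n).simple i)
  have h4 := len_mul_simple (coxC n) i v
  rw [IsShort] at hv ⊢
  rw [wordAct_mul_simple] at h3 ⊢
  simp only [h1] at h
  simp at h
  omega

theorem exists_isShort (l : Word n) : ∃ w, IsShort w ∧ wordAct (allDown n) w = l := by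
  induction l using word_induction with
  | one => exact ⟨1, by rw [IsShort, len_one, wordAct_one, height_allDown], wordAct_one _⟩
  | step l i h1 h2 ih =>
    obtain ⟨w, hw, rfl⟩ := ih
    exact ⟨w * (coxC n).simple i, hw.mul_simple h1 h2, wordAct_mul_simple _ _ _⟩

/-- In a short element every letter has to raise the height, in particular the last one, and what
precedes it is short again. -/
theorem IsShort.exists_eq_mul_simple {w : (coxC n).Group} (hw : IsShort w) {k : ℕ}
    (hk : len (coxC n) w = k + 1) :
    ∃ v i, w = v * (coxC n).simple i ∧ IsShort v ∧ len (coxC n) v = k ∧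
      wordAct (allDown n) v = simpleOnWord i (wordAct (allDown n) w) ∧
      wordAct (allDown n) w i = true ∧
      simpleOnWord i (wordAct (allDown n) w) ≠ wordAct (allDown n) w := by
  obtain ⟨v, i, rfl, hv⟩ := CupHecke.exists_eq_mul_simple hk
  have e : wordAct (allDown n) v =
      simpleOnWord i (wordAct (allDown n) (v * (coxC n).simple i)) := by
    rw [wordAct_mul_simple, simpleOnWord_simpleOnWord]
  have h1 := height_le_len v
  rw [IsShort] at hw
  have hne : simpleOnWord i (wordAct (allDown n) (v * (coxC n).simple i)) ≠
      wordAct (allDown n) (v * (coxC n).simple i) := by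
    intro h
    rw [e, h] at h1
    omega
  have h2 := height_simpleOnWord i _ hne
  rw [← e] at h2
  refine ⟨v, i, rfl, ?_, hv, e, ?_, hne⟩
  · rw [IsShort]
    split_ifs at h2 <;> omega
  · split_ifs at h2 with h3
    · exact h3
    · omega

/-! The braid relations. -/

theorem simple_comm {i j : Fin n} (h : i.val + 1 < j.val) :
    (coxC n).simple i * (coxC n).simple j = (coxC n).simple j * (coxC n).simple i := by
  have h1 : ((coxC n).simple i * (coxC n).simple j) ^ (coxC n i j) = 1 :=
    (coxC n).toCoxeterSystem.simple_mul_simple_pow i j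
  rw [coxC_apply, if_neg (by rintro rfl; omega), if_neg (by omega), if_neg (by omega), pow_two,
    mul_eq_one_iff_eq_inv, mul_inv_rev] at h1
  have hi : ((coxC n).simple i)⁻¹ = (coxC n).simple i := (coxC n).toCoxeterSystem.inv_simple i
  have hj : ((coxC n).simple j)⁻¹ = (coxC n).simple j := (coxC n).toCoxeterSystem.inv_simple j
  rwa [hi, hj] at h1

theorem simple_braid_three {i j : Fin n} (hi : i.val ≠ 0) (h : i.val + 1 = j.val) :
    (coxC n).simple i * (coxC n).simple j * (coxC n).simple i =
      (coxC n).simple j * (coxC n).simple i * (coxC n).simple j := by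
  have h1 : ((coxC n).simple i * (coxC n).simple j) ^ (coxC n i j) = 1 :=
    (coxC n).toCoxeterSystem.simple_mul_simple_pow i j
  rw [coxC_apply, if_neg (by rintro rfl; omega), if_neg (by omega), if_pos (by omega)] at h1
  have h2 : ((coxC n).simple i * (coxC n).simple j) ^ 3 =
    ((coxC n).simple i * (coxC n).simple j * (coxC n).simple i) *
      ((coxC n).simple j * (coxC n).simple i * (coxC n).simple j) := by
    simp only [pow_succ, pow_zero, one_mul, mul_assoc]
  have hi : ((coxC n).simple i)⁻¹ = (coxC n).simple i := (coxC n).toCoxeterSystem.inv_simple i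
  have hj : ((coxC n).simple j)⁻¹ = (coxC n).simple j := (coxC n).toCoxeterSystem.inv_simple j
  rw [h2, mul_eq_one_iff_eq_inv] at h1
  simpa only [mul_inv_rev, hi, hj, mul_assoc] using h1

theorem simple_braid_four {i j : Fin n} (hi : i.val = 0) (hj : j.val = 1) :
    (coxC n).simple i * (coxC n).simple j * (coxC n).simple i * (coxC n).simple j =
      (coxC n).simple j * (coxC n).simple i * (coxC n).simple j * (coxC n).simple i := by
  have h1 : ((coxC n).simple i * (coxC n).simple j) ^ (coxC n i j) = 1 :=
    (coxC n).toCoxeterSystem.simple_mul_simple_pow i j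
  rw [coxC_apply, if_neg (by rintro rfl; omega), if_pos (by omega)] at h1
  have h2 : ((coxC n).simple i * (coxC n).simple j) ^ 4 =
    ((coxC n).simple i * (coxC n).simple j * (coxC n).simple i * (coxC n).simple j) *
      ((coxC n).simple i * (coxC n).simple j * (coxC n).simple i * (coxC n).simple j) := by
    simp only [pow_succ, pow_zero, one_mul, mul_assoc]
  have hi : ((coxC n).simple i)⁻¹ = (coxC n).simple i := (coxC n).toCoxeterSystem.inv_simple i
  have hj : ((coxC n).simple j)⁻¹ = (coxC n).simple j := (coxC n).toCoxeterSystem.inv_simple j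
  rw [h2, mul_eq_one_iff_eq_inv] at h1
  simpa only [mul_inv_rev, hi, hj, mul_assoc] using h1

/-- A diamond argument on the last letters i and j. Adjacent letters cannot both occur: with ∧ at
both positions the larger reflection would fix the word. Equal letters are cancelled, and distant
ones commute. -/
theorem IsShort.unique {w w' : (coxC n).Group} (hw : IsShort w) (hw' : IsShort w')
    (h : wordAct (allDown n) w = wordAct (allDown n) w') : w = w' := by
  induction hk : len (coxC n) w using Nat.strong_induction_on generalizing w w' with
  | _ k ih =>
    have hk' : len (coxC n) w' = k := by
      rw [IsShort] at hw hw'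
      rw [hw', ← h, ← hw, hk]
    cases k with
    | zero => rw [len_eq_zero.1 hk, len_eq_zero.1 hk']
    | succ k =>
      obtain ⟨v, i, rfl, hv, hvk, hvl, hi, hne⟩ := hw.exists_eq_mul_simple hk
      obtain ⟨v', j, rfl, hv', hvk', hvl', hj, hne'⟩ := hw'.exists_eq_mul_simple hk'
      rw [← h] at hvl' hj hne'
      set l := wordAct (allDown n) (v * (coxC n).simple i) with hl
      -- the case of two commuting reductions
      have comm : ∀ (v v' : (coxC n).Group) (i j : Fin n), i.val + 1 < j.val → IsShort v →
          IsShort v' → len (coxC n) v = k → len (coxC n) v' = k →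
          wordAct (allDown n) v = simpleOnWord i l → wordAct (allDown n) v' = simpleOnWord j l →
          l i = true → l j = true → simpleOnWord i l ≠ l → simpleOnWord j l ≠ l →
          v * (coxC n).simple i = v' * (coxC n).simple j := by
        intro v v' i j hij hv hv' hvk hvk' hvl hvl' hi hj hne hne'
        -- The bottom of the diamond: a short element whose word has both moves undone. By induction
        -- x s_j = v and x s_i = v'.
        obtain ⟨x, hx, hxl⟩ := exists_isShort (simpleOnWord j (simpleOnWord i l))
        have hc : simpleOnWord j (simpleOnWord i l) = simpleOnWord i (simpleOnWord j l) :=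
          congrFun (congrArg DFunLike.coe (simplePerm_comm hij)).symm l
        have val : ∀ k : Fin n, k ≠ i → k.val + 1 ≠ i.val → simpleOnWord i l k = l k := by
          intro k h1 h2
          rw [simpleOnWord_apply]
          split_ifs <;> simp_all
        have val' : ∀ k : Fin n, k ≠ j → k.val + 1 ≠ j.val → simpleOnWord j l k = l k := by
          intro k h1 h2
          rw [simpleOnWord_apply]
          split_ifs <;> simp_all
        have hj0 : j.val ≠ 0 := by omega
        have h1 : simpleOnWord j (simpleOnWord i l) ≠ simpleOnWord i l := by
          intro he
          refine hne' ((simpleOnWord_eq_self_iff _ _).2 ⟨hj0, ?_⟩)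
          have := ((simpleOnWord_eq_self_iff _ _).1 he).2
          rwa [val _ (by rw [Ne, Fin.ext_iff]; simp; omega) (by simp; omega),
            val _ (by rw [Ne, Fin.ext_iff]; omega) (by omega)] at this
        have h2 : simpleOnWord i (simpleOnWord j l) ≠ simpleOnWord j l := by
          intro he
          have h0 := ((simpleOnWord_eq_self_iff _ _).1 he).1
          refine hne ((simpleOnWord_eq_self_iff _ _).2 ⟨h0, ?_⟩)
          have := ((simpleOnWord_eq_self_iff _ _).1 he).2
          rwa [val' _ (by rw [Ne, Fin.ext_iff]; simp; omega) (by simp; omega),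
            val' _ (by rw [Ne, Fin.ext_iff]; omega) (by omega)] at this
        have flip : ∀ (a : Fin n) (l : Word n), simpleOnWord a l ≠ l → l a = true →
            simpleOnWord a l a = false := by
          intro a l hne ha
          rw [Ne, simpleOnWord_eq_self_iff] at hne
          rw [simpleOnWord_apply]
          by_cases h0 : a.val = 0
          · simp [h0, ha]
          · simpa [h0, ha] using hne
        have e1 : x * (coxC n).simple j = v := by
          refine (ih k (by omega) hv ?_ ?_ hvk).symm
          · refine hx.mul_simple ?_ ?_
            · rw [hxl]
              exact flip _ _ h1 ((val _ (by rw [Ne, Fin.ext_iff]; omega) (by omega)).trans hj)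
            · rw [hxl, simpleOnWord_simpleOnWord]; exact h1.symm
          · rw [wordAct_mul_simple, hxl, simpleOnWord_simpleOnWord, hvl]
        have e2 : x * (coxC n).simple i = v' := by
          refine (ih k (by omega) hv' ?_ ?_ hvk').symm
          · refine hx.mul_simple ?_ ?_
            · rw [hxl, hc]
              exact flip _ _ h2 ((val' _ (by rw [Ne, Fin.ext_iff]; omega) (by omega)).trans hi)
            · rw [hxl, hc, simpleOnWord_simpleOnWord]; exact h2.symm
          · rw [wordAct_mul_simple, hxl, hc, simpleOnWord_simpleOnWord, hvl']
        rw [← e1, ← e2, mul_assoc, mul_assoc, simple_comm hij]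
      have adj : ∀ i j : Fin n, i.val + 1 = j.val → l i = true → l j = true →
          simpleOnWord j l ≠ l → False := by
        intro i j hij hi hj hne
        refine hne ((simpleOnWord_eq_self_iff _ _).2 ⟨by omega, ?_⟩)
        rw [hj, ← hi]
        congr 1
        exact Fin.ext (by simp; omega)
      rcases lt_trichotomy i.val j.val with hij | hij | hij
      · rcases Nat.lt_or_ge (i.val + 1) j.val with h' | h'
        · exact comm v v' i j h' hv hv' hvk hvk' hvl hvl' hi hj hne hne'
        · exact (adj i j (by omega) hi hj hne').elim
      · have : i = j := Fin.ext hij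
        subst this
        rw [ih k (by omega) hv hv' (by rw [hvl, hvl']) hvk]
      · rcases Nat.lt_or_ge (j.val + 1) i.val with h' | h'
        · exact (comm v' v j i h' hv' hv hvk' hvk hvl' hvl hj hi hne' hne).symm
        · exact (adj j i (by omega) hj hi hne).elim

/-- Uniqueness of short elements turns every possible reduction of the word into a possible last
letter of v. -/
theorem IsShort.exists_mul_simple {v : (coxC n).Group} (hv : IsShort v) {i : Fin n}
    (h1 : wordAct (allDown n) v i = true)
    (h2 : simpleOnWord i (wordAct (allDown n) v) ≠ wordAct (allDown n) v) :
    ∃ x, IsShort x ∧ v = x * (coxC n).simple i ∧ len (coxC n) v = len (coxC n) x + 1 ∧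
      wordAct (allDown n) x = simpleOnWord i (wordAct (allDown n) v) := by
  obtain ⟨x, hx, hxl⟩ := exists_isShort (simpleOnWord i (wordAct (allDown n) v))
  have h := height_simpleOnWord i _ h2
  simp only [h1, if_true] at h
  have hlen : len (coxC n) v = len (coxC n) x + 1 := by
    rw [IsShort] at hx hv
    rw [hxl] at hx
    omega
  refine ⟨x, hx, ?_, hlen, hxl⟩
  refine hv.unique ?_ ?_
  · have h3 := height_le_len (x * (coxC n).simple i)
    have h4 := len_mul_simple (coxC n) i x
    rw [IsShort] at hv ⊢
    rw [wordAct_mul_simple, hxl, simpleOnWord_simpleOnWord] at h3 ⊢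
    omega
  · rw [wordAct_mul_simple, hxl, simpleOnWord_simpleOnWord]

end Words

end CupHecke

namespace CupHecke

/-! ### Minimal coset representatives are the short elements. -/

section MinimalCosets

variable {n : ℕ}

/-- A form of Deodhar's lemma. If the last letter a of w is far from i, it commutes with s_i. If it
is adjacent, one or two further letters can be split off, and a braid relation moves a reflection to
the left of them, where it fixes the word of a shorter element. -/
theorem IsShort.mul_simple_of_fixed {w : (coxC n).Group} (hw : IsShort w) {i : Fin n}
    (h : simpleOnWord i (wordAct (allDown n) w) = wordAct (allDown n) w) :
    ∃ j ∈ typeA n, w * (coxC n).simple i = (coxC n).simple j * w := by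
  induction hk : len (coxC n) w using Nat.strong_induction_on generalizing w i with
  | _ k ih =>
    obtain ⟨h0, hl⟩ := (simpleOnWord_eq_self_iff _ _).1 h
    cases k with
    | zero => exact ⟨i, h0, by rw [len_eq_zero.1 hk, one_mul, mul_one]⟩
    | succ k =>
      obtain ⟨v, a, rfl, hv, hvk, hvl, ha, hne⟩ := hw.exists_eq_mul_simple hk
      set l := wordAct (allDown n) (v * (coxC n).simple a) with hldef
      have hval := simpleOnWord_apply a l
      have hai : a ≠ i := by rintro rfl; exact hne h
      have hfar : a.val + 1 < i.val ∨ i.val + 1 < a.val →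
          ∃ j ∈ typeA n, v * (coxC n).simple a * (coxC n).simple i =
            (coxC n).simple j * (v * (coxC n).simple a) := by
        intro hd
        have hfix : simpleOnWord i (wordAct (allDown n) v) = wordAct (allDown n) v := by
          refine (simpleOnWord_eq_self_iff _ _).2 ⟨h0, ?_⟩
          have e1 : wordAct (allDown n) v ⟨i.val - 1, by omega⟩ = l ⟨i.val - 1, by omega⟩ := by
            rw [hvl, hval]
            simp only [Fin.ext_iff]
            split_ifs <;> first | rfl | omega
          have e2 : wordAct (allDown n) v i = l i := by
            rw [hvl, hval]
            simp only [Fin.ext_iff]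
            split_ifs <;> first | rfl | omega
          rw [e1, e2, hl]
        obtain ⟨j, hj, hvj⟩ := ih k (by omega) hv hfix hvk
        refine ⟨j, hj, ?_⟩
        have hc : (coxC n).simple a * (coxC n).simple i = (coxC n).simple i * (coxC n).simple a := by
          rcases hd with hd | hd
          · exact simple_comm hd
          · exact (simple_comm hd).symm
        rw [mul_assoc, hc, ← mul_assoc, hvj, mul_assoc]
      have hprev : ∀ b : Fin n, b.val ≠ 0 → ∀ l : Word n, simpleOnWord b l ≠ l →
          l ⟨b.val - 1, by omega⟩ ≠ l b := fun b hb l hn he ↦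
        hn ((simpleOnWord_eq_self_iff _ _).2 ⟨hb, he⟩)
      rcases lt_trichotomy a.val i.val with hlt | heq | hlt
      · rcases Nat.lt_or_ge (a.val + 1) i.val with h' | h'
        · exact hfar (Or.inl h')
        have hia : i.val = a.val + 1 := by omega
        have hpa : (⟨i.val - 1, by omega⟩ : Fin n) = a := Fin.ext (by simp; omega)
        rw [hpa] at hl
        have hva : wordAct (allDown n) v a = false := by
          rw [hvl, hval]
          by_cases ha0 : a.val = 0
          · simp [ha0, ha]
          · have := hprev a ha0 l hne
            rw [ha] at this
            simp only [if_neg ha0, if_true]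
            simpa using this
        have hvi : wordAct (allDown n) v i = true := by
          rw [hvl, hval, if_neg hai.symm, if_neg hai.symm, if_neg (by omega : ¬ i.val + 1 = a.val),
            ite_self, ← hl, ha]
        obtain ⟨x, hx, hvx, hxk, hxl⟩ := hv.exists_mul_simple hvi (fun he ↦ by
          have := ((simpleOnWord_eq_self_iff _ _).1 he).2
          rw [hpa, hva, hvi] at this
          exact Bool.noConfusion this)
        have hxa : wordAct (allDown n) x a = true := by
          rw [hxl, simpleOnWord_apply, if_neg h0, if_neg hai, if_pos hia.symm, hvi]
        by_cases ha0 : a.val = 0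
        -- Here a = 0 and w = y s_0 s_1 s_0, where the word of y starts with ∨∨. The braid relation
        -- of length four gives w s_1 = y s_1 s_0 s_1 s_0.
        · have hxi : wordAct (allDown n) x i = false := by
            rw [hxl, simpleOnWord_apply, if_neg h0, if_pos rfl, hpa, hva]
          obtain ⟨y, hy, hxy, hyk, hyl⟩ := hx.exists_mul_simple hxa (fun he ↦
            ((simpleOnWord_eq_self_iff _ _).1 he).1 ha0)
          have hfix : simpleOnWord i (wordAct (allDown n) y) = wordAct (allDown n) y := by
            refine (simpleOnWord_eq_self_iff _ _).2 ⟨h0, ?_⟩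
            rw [hpa, hyl, simpleOnWord_apply, simpleOnWord_apply, if_pos ha0, if_pos ha0,
              if_pos rfl, if_neg hai.symm, hxa, hxi]
            rfl
          obtain ⟨j, hj, hyj⟩ := ih _ (by omega) hy hfix rfl
          refine ⟨j, hj, ?_⟩
          rw [hvx, hxy]
          have hb := simple_braid_four (n := n) ha0 (show i.val = 1 by omega)
          simp only [mul_assoc] at hb ⊢
          rw [hb, ← mul_assoc, hyj]
          simp only [mul_assoc]
        -- At positions a - 1, a, i the words of w, v, x are ∨∧∧, ∧∨∧, ∧∧∨, so s_a fixes the last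
        -- one; w s_i = x s_i s_a s_i = x s_a s_i s_a.
        · have hfix : simpleOnWord a (wordAct (allDown n) x) = wordAct (allDown n) x := by
            refine (simpleOnWord_eq_self_iff _ _).2 ⟨ha0, ?_⟩
            have h3 := hprev a ha0 l hne
            have h4 : l ⟨a.val - 1, by omega⟩ = false := by rw [ha] at h3; simpa using h3
            have h5 : simpleOnWord i (wordAct (allDown n) v) ⟨a.val - 1, by omega⟩ =
                wordAct (allDown n) v ⟨a.val - 1, by omega⟩ := by
              rw [simpleOnWord_apply]
              simp only [Fin.ext_iff]
              split_ifs <;> first | rfl | omega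
            rw [hxa, hxl, h5, hvl, hval, if_neg ha0, if_neg (by rw [Fin.ext_iff]; simp; omega),
              if_pos (by simp; omega), ha]
          obtain ⟨j, hj, hxj⟩ := ih _ (by omega) hx hfix rfl
          refine ⟨j, hj, ?_⟩
          rw [hvx]
          have hb := simple_braid_three (n := n) ha0 hia.symm
          simp only [mul_assoc] at hb ⊢
          rw [← hb, ← mul_assoc, hxj]
          simp only [mul_assoc]
      · exact absurd (Fin.ext heq) hai
      · rcases Nat.lt_or_ge (i.val + 1) a.val with h' | h'
        · exact hfar (Or.inr h')
        -- At positions i - 1, i, a the words of w, v and of x below are ∨∨∧, ∨∧∨, ∧∨∨, and again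
        -- s_a fixes the last one.
        have hia : a.val = i.val + 1 := by omega
        have ha0 : a.val ≠ 0 := by omega
        have hpa : (⟨a.val - 1, by omega⟩ : Fin n) = i := Fin.ext (by simp; omega)
        have hli : l i = false := by
          have := hprev a ha0 l hne
          rw [hpa, ha] at this
          simpa using this
        have hvi : wordAct (allDown n) v i = true := by
          rw [hvl, hval, if_neg ha0, if_neg hai.symm, if_pos hia.symm, ha]
        have hva : wordAct (allDown n) v a = false := by
          rw [hvl, hval, if_neg ha0, if_pos rfl, hpa, hli]
        have hvp : wordAct (allDown n) v ⟨i.val - 1, by omega⟩ = false := by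
          rw [hvl, hval, if_neg ha0, if_neg (by rw [Fin.ext_iff]; simp; omega),
            if_neg (by simp; omega), hl, hli]
        obtain ⟨x, hx, hvx, hxk, hxl⟩ := hv.exists_mul_simple hvi (fun he ↦ by
          have := ((simpleOnWord_eq_self_iff _ _).1 he).2
          rw [hvp, hvi] at this
          exact Bool.noConfusion this)
        have hfix : simpleOnWord a (wordAct (allDown n) x) = wordAct (allDown n) x := by
          refine (simpleOnWord_eq_self_iff _ _).2 ⟨ha0, ?_⟩
          rw [hpa, hxl, simpleOnWord_apply, simpleOnWord_apply, if_neg h0, if_neg h0, if_pos rfl,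
            if_neg hai, if_neg (by omega), hvp, hva]
        obtain ⟨j, hj, hxj⟩ := ih _ (by omega) hx hfix rfl
        refine ⟨j, hj, ?_⟩
        rw [hvx]
        have hb := simple_braid_three (n := n) h0 hia.symm
        simp only [mul_assoc] at hb ⊢
        rw [hb, ← mul_assoc, hxj]
        simp only [mul_assoc]

/-- Left multiplication by s_i with i ≥ 1 keeps the word, so the height bounds the length from below
on the whole coset. Conversely, removing the last letter keeps minimality, and that letter must
raise the height: one that fixes the word could be moved to the far left, and one that lowers the
height would shorten the element. -/
theorem isShort_iff (w : (coxC n).Group) :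
    IsShort w ↔ ∀ i ∈ typeA n, len (coxC n) w < len (coxC n) ((coxC n).simple i * w) := by
  constructor
  · intro hw i hi
    have h1 := height_le_len ((coxC n).simple i * w)
    rw [wordAct_allDown_simple_mul hi, ← hw] at h1
    have := len_simple_mul (coxC n) i w
    omega
  · intro h
    induction hk : len (coxC n) w generalizing w with
    | zero => rw [len_eq_zero.1 hk, IsShort, len_one, wordAct_one, height_allDown]
    | succ k ih =>
      obtain ⟨v, i, rfl, hvk⟩ := exists_eq_mul_simple hk
      have hv : IsShort v := by
        refine ih v (fun j hj ↦ ?_) hvk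
        have h1 := h j hj
        have h2 := len_simple_mul (coxC n) j v
        have h3 := len_mul_simple (coxC n) i ((coxC n).simple j * v)
        rw [mul_assoc] at h3
        omega
      by_cases hfix : simpleOnWord i (wordAct (allDown n) v) = wordAct (allDown n) v
      · obtain ⟨j, hj, hvj⟩ := hv.mul_simple_of_fixed hfix
        have := h j hj
        rw [hvj, simple_mul_cancel_left, ← hvj] at this
        omega
      · cases hvi : wordAct (allDown n) v i
        · exact hv.mul_simple hvi hfix
        · obtain ⟨x, -, rfl, hx, -⟩ := hv.exists_mul_simple hvi hfix
          rw [simple_mul_cancel_right] at hk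
          omega

/-- The bijection between minimal coset representatives and words. -/
noncomputable def minCosetEquiv (n : ℕ) : MinCoset (coxC n) (typeA n) ≃ Word n :=
  Equiv.ofBijective (fun w ↦ wordAct (allDown n) w.1)
    ⟨fun w w' h ↦ Subtype.ext
      (((isShort_iff w.1).2 w.2).unique ((isShort_iff w'.1).2 w'.2) h),
    fun l ↦ by
      obtain ⟨w, hw, hl⟩ := exists_isShort l
      exact ⟨⟨w, (isShort_iff w).1 hw⟩, hl⟩⟩

theorem minCosetEquiv_apply (w : MinCoset (coxC n) (typeA n)) :
    minCosetEquiv n w = wordAct (allDown n) w.1 := rfl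

theorem len_minCoset (w : MinCoset (coxC n) (typeA n)) :
    len (coxC n) w.1 = height (minCosetEquiv n w) := (isShort_iff w.1).2 w.2

end MinimalCosets

/-! ### The parabolic module in terms of words -/

section WordModule

variable {n : ℕ}

/-- The parabolic module of type `C_n`. -/
abbrev Parabolic (n : ℕ) : Type := ParabolicModule (coxC n) (typeA n)

theorem tmul_add (l : Laurent) (x y : Hecke (coxC n)) :
    tmul (coxC n) (typeA n) l (x + y) =
      tmul (coxC n) (typeA n) l x + tmul (coxC n) (typeA n) l y := by
  rw [tmul, TensorProduct.tmul_add, map_add]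
  rfl

theorem tmul_smul (c l : Laurent) (x : Hecke (coxC n)) :
    tmul (coxC n) (typeA n) l (c • x) = c • tmul (coxC n) (typeA n) l x := by
  rw [tmul, TensorProduct.tmul_smul, map_smul]
  rfl

theorem tmul_eq_smul (l : Laurent) (x : Hecke (coxC n)) :
    tmul (coxC n) (typeA n) l x = l • tmul (coxC n) (typeA n) 1 x := by
  rw [tmul, tmul, ← map_smul, TensorProduct.smul_tmul', smul_eq_mul, mul_one]

theorem tmul_mul_of_mem {h : Hecke (coxC n)} (hh : h ∈ parabolicSubalgebra (coxC n) (typeA n))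
    (x : Hecke (coxC n)) :
    tmul (coxC n) (typeA n) 1 (h * x) = chi (coxC n) h • tmul (coxC n) (typeA n) 1 x := by
  rw [← tmul_eq_smul]
  refine ((Submodule.Quotient.eq _).2 ?_).symm
  exact Submodule.subset_span ⟨h, hh, 1, x, by rw [one_mul]⟩

theorem H_simple_mem {i : Fin n} (hi : i ∈ typeA n) :
    H (coxC n) ((coxC n).simple i) ∈ parabolicSubalgebra (coxC n) (typeA n) := by
  have : H (coxC n) ((coxC n).simple i) = C (coxC n) i + qInv • 1 := by
    rw [C, H_one, sub_add_cancel]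
  rw [this]
  exact add_mem (Algebra.subset_adjoin ⟨i, hi, rfl⟩) (Subalgebra.smul_mem _ (one_mem _) _)

theorem tmul_H_simple_mul {i : Fin n} (hi : i ∈ typeA n) (x : Hecke (coxC n)) :
    tmul (coxC n) (typeA n) 1 (H (coxC n) ((coxC n).simple i) * x) =
      qInv • tmul (coxC n) (typeA n) 1 x := by
  rw [tmul_mul_of_mem (H_simple_mem hi), chi_H_simple]

/-- A left descent s_i of w with i ≥ 1 gives 1 ⊗ H_w = q⁻¹ (1 ⊗ H_{s_i w}), and descending in length
ends at minimal representatives. -/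
theorem span_stdBasis : Submodule.span Laurent (Set.range (stdBasis (coxC n) (typeA n))) = ⊤ := by
  set S := Submodule.span Laurent (Set.range (stdBasis (coxC n) (typeA n)))
  have hH : ∀ w, tmul (coxC n) (typeA n) 1 (H (coxC n) w) ∈ S := by
    intro w
    induction hk : len (coxC n) w using Nat.strong_induction_on generalizing w with
    | _ k ih =>
      by_cases hw : ∀ i ∈ typeA n, len (coxC n) w < len (coxC n) ((coxC n).simple i * w)
      · exact Submodule.subset_span ⟨⟨w, hw⟩, rfl⟩
      · push Not at hw
        obtain ⟨i, hi, hl⟩ := hw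
        have h1 := len_simple_mul (coxC n) i w
        have := H_simple_mul_of_lt (coxC n) (i := i) (w := (coxC n).simple i * w)
          (by rw [simple_mul_cancel_left]; omega)
        rw [simple_mul_cancel_left] at this
        rw [← this, tmul_H_simple_mul hi]
        exact S.smul_mem _ (ih _ (by omega) _ rfl)
  have hx : ∀ x, tmul (coxC n) (typeA n) 1 x ∈ S := by
    intro x
    have : x ∈ Submodule.span Laurent (Set.range (H (coxC n))) := by
      rw [span_range_H]; trivial
    induction this using Submodule.span_induction with
    | mem x hx => obtain ⟨w, rfl⟩ := hx; exact hH w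
    | zero => rw [tmul, TensorProduct.tmul_zero, map_zero]; exact S.zero_mem
    | add x y _ _ hx hy => rw [tmul_add]; exact add_mem hx hy
    | smul c x _ hx => rw [tmul_smul]; exact S.smul_mem _ hx
  rw [eq_top_iff]
  rintro y -
  obtain ⟨t, rfl⟩ := Submodule.mkQ_surjective _ y
  induction t with
  | zero => rw [map_zero]; exact S.zero_mem
  | tmul l x =>
    change tmul (coxC n) (typeA n) l x ∈ S
    rw [tmul_eq_smul]
    exact S.smul_mem _ (hx x)
  | add a b ha hb => rw [map_add]; exact add_mem ha hb

/-- The linear map that sends `w` to `q^{h - ℓ(w)}` times the word `∨⋯∨ . w`, where `h` is the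
height of this word. -/
noncomputable def freeToWords (n : ℕ) : ((coxC n).Group →₀ Laurent) →ₗ[Laurent] (Word n → Laurent) :=
  Finsupp.linearCombination Laurent fun w ↦
    Pi.single (wordAct (allDown n) w)
      (LaurentPolynomial.T (height (wordAct (allDown n) w) - len (coxC n) w : ℤ))

theorem freeToWords_single (w : (coxC n).Group) :
    freeToWords n (Finsupp.single w 1) = Pi.single (wordAct (allDown n) w)
      (LaurentPolynomial.T (height (wordAct (allDown n) w) - len (coxC n) w : ℤ)) := by
  rw [freeToWords, Finsupp.linearCombination_single, one_smul]

/-- The reflection changes only the length, not the word. The power q^{h-ℓ} is chosen such that both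
multiplication rules give the factor q⁻¹, which lets the map descend to the tensor product. -/
theorem freeToWords_leftOp {i : Fin n} (hi : i ∈ typeA n) (f : (coxC n).Group →₀ Laurent) :
    freeToWords n (leftOp (coxC n) i f) = qInv • freeToWords n f := by
  suffices freeToWords n ∘ₗ leftOp (coxC n) i = qInv • freeToWords n from
    LinearMap.congr_fun this f
  refine Finsupp.lhom_ext' fun w ↦ LinearMap.ext_ring ?_
  change freeToWords n (leftOp (coxC n) i (Finsupp.single w 1)) =
    qInv • freeToWords n (Finsupp.single w 1)
  rw [leftOp_single, map_add, apply_ite (freeToWords n), map_smul, map_zero, freeToWords_single,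
    freeToWords_single, wordAct_allDown_simple_mul hi, ← Pi.single_smul', ← Pi.single_smul']
  have h := len_simple_mul (coxC n) i w
  split_ifs with hd
  · rw [← Pi.single_add]
    congr 1
    have : (len (coxC n) ((coxC n).simple i * w) : ℤ) = len (coxC n) w - 1 := by omega
    rw [this, q, qInv, smul_eq_mul, smul_eq_mul, sub_mul, ← LaurentPolynomial.T_add,
      ← LaurentPolynomial.T_add]
    ring_nf
  · rw [add_zero]
    congr 1
    have : (len (coxC n) ((coxC n).simple i * w) : ℤ) = len (coxC n) w + 1 := by omega
    rw [this, qInv, smul_eq_mul, ← LaurentPolynomial.T_add]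
    congr 1
    ring

theorem freeToWords_toFree_mul {h : Hecke (coxC n)}
    (hh : h ∈ parabolicSubalgebra (coxC n) (typeA n)) (x : Hecke (coxC n)) :
    freeToWords n (toFree (coxC n) (h * x)) =
      chi (coxC n) h • freeToWords n (toFree (coxC n) x) := by
  induction hh using Algebra.adjoin_induction generalizing x with
  | mem y hy =>
    obtain ⟨i, hi, rfl⟩ := hy
    have : chi (coxC n) (C (coxC n) i) = 0 := by
      rw [C, map_sub, chi_H_simple, map_smul, H_one, map_one, smul_eq_mul, mul_one, sub_self]
    rw [this, zero_smul, C, H_one, sub_mul, smul_mul_assoc, one_mul, map_sub, map_sub,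
      toFree_H_simple_mul, freeToWords_leftOp hi, map_smul, map_smul, sub_self]
  | algebraMap r =>
    rw [AlgHom.commutes, ← Algebra.smul_def, map_smul, map_smul]
    rfl
  | add y z _ _ hy hz => rw [add_mul, map_add, map_add, hy, hz, map_add, add_smul]
  | mul y z _ _ hy hz => rw [mul_assoc, hy, hz, map_mul, smul_smul]

/-- The linear map from the parabolic module to functions on words which sends `M_w` to the word
`∨⋯∨ . w`. -/
noncomputable def toWords (n : ℕ) : Parabolic n →ₗ[Laurent] (Word n → Laurent) :=
  (balanced (coxC n) (typeA n)).liftQ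
    (TensorProduct.lift ((LinearMap.lsmul Laurent (Word n → Laurent)).compl₂
      (freeToWords n ∘ₗ toFree (coxC n))))
    (by
      refine Submodule.span_le.2 ?_
      rintro _ ⟨h, hh, l, x, rfl⟩
      simp [freeToWords_toFree_mul hh, mul_smul, smul_comm l ((chi (coxC n)) h)])

theorem toWords_tmul (l : Laurent) (x : Hecke (coxC n)) :
    toWords n (tmul (coxC n) (typeA n) l x) = l • freeToWords n (toFree (coxC n) x) :=
  (Submodule.liftQ_apply _ _ _).trans rfl

theorem toWords_stdBasis (w : MinCoset (coxC n) (typeA n)) :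
    toWords n (stdBasis (coxC n) (typeA n) w) = Pi.single (minCosetEquiv n w) 1 := by
  rw [stdBasis, toWords_tmul, toFree_H, freeToWords_single, one_smul, len_minCoset,
    ← minCosetEquiv_apply, sub_self, LaurentPolynomial.T_zero]

/-- The linear map from functions on words to the parabolic module which sends the word
`∨⋯∨ . w` to `M_w`. -/
noncomputable def ofWords (n : ℕ) : (Word n → Laurent) →ₗ[Laurent] Parabolic n :=
  (Pi.basisFun Laurent (Word n)).constr Laurent
    fun l ↦ stdBasis (coxC n) (typeA n) ((minCosetEquiv n).symm l)

theorem ofWords_single (l : Word n) :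
    ofWords n (Pi.single l 1) = stdBasis (coxC n) (typeA n) ((minCosetEquiv n).symm l) := by
  rw [← Pi.basisFun_apply, ofWords, Module.Basis.constr_basis]

/-- The parabolic module is the free module on words. -/
noncomputable def wordEquiv (n : ℕ) : Parabolic n ≃ₗ[Laurent] (Word n → Laurent) :=
  LinearEquiv.ofLinearMap (toWords n) (ofWords n)
    (by
      refine (Pi.basisFun Laurent (Word n)).ext fun l ↦ ?_
      rw [Pi.basisFun_apply, LinearMap.comp_apply, ofWords_single, toWords_stdBasis,
        Equiv.apply_symm_apply, LinearMap.id_apply])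
    (by
      refine LinearMap.ext_on_range span_stdBasis fun w ↦ ?_
      rw [LinearMap.comp_apply, toWords_stdBasis, ofWords_single, Equiv.symm_apply_apply,
        LinearMap.id_apply])

theorem wordEquiv_stdBasis (w : MinCoset (coxC n) (typeA n)) :
    wordEquiv n (stdBasis (coxC n) (typeA n) w) = Pi.single (minCosetEquiv n w) 1 :=
  toWords_stdBasis w

/-- The action of `C_{s_i}` on functions on words. -/
noncomputable def wordOpC (i : Fin n) : (Word n → Laurent) →ₗ[Laurent] (Word n → Laurent) :=
  LinearMap.pi fun l ↦ if simpleOnWord i l = l then 0 else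
    LinearMap.proj (simpleOnWord i l) - (if l i = true then q else qInv) • LinearMap.proj l

theorem wordOpC_apply (i : Fin n) (f : Word n → Laurent) (l : Word n) :
    wordOpC i f l = if simpleOnWord i l = l then 0 else
      f (simpleOnWord i l) - (if l i = true then q else qInv) * f l := by
  rw [wordOpC, LinearMap.pi_apply]
  split_ifs <;> rfl

theorem wordOpC_single (i : Fin n) (l : Word n) :
    wordOpC i (Pi.single l 1) = if simpleOnWord i l = l then 0 else
      Pi.single (simpleOnWord i l) 1 - (if l i = true then q else qInv) • Pi.single l 1 := by
  funext k
  rw [wordOpC_apply]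
  have e : simpleOnWord i k = l ↔ k = simpleOnWord i l :=
    ⟨fun h ↦ by rw [← h, simpleOnWord_simpleOnWord], fun h ↦ by rw [h, simpleOnWord_simpleOnWord]⟩
  by_cases h : simpleOnWord i l = l
  · rw [if_pos h]
    split_ifs with hk
    · rfl
    all_goals
      have hkl : k ≠ l := by rintro rfl; exact hk h
      have hkl' : simpleOnWord i k ≠ l := by rwa [Ne, e, h]
      simp [hkl, hkl']
  · rw [if_neg h, Pi.sub_apply, Pi.smul_apply]
    by_cases hkl : k = l
    · subst hkl
      rw [if_neg h, Pi.single_eq_of_ne h, Pi.single_eq_of_ne (Ne.symm h), smul_eq_mul]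
    · rw [Pi.single_eq_of_ne hkl, smul_zero, mul_zero, sub_zero, sub_zero]
      by_cases hk : simpleOnWord i k = l
      · have := e.1 hk
        rw [hk, if_neg (Ne.symm hkl), Pi.single_eq_same, this, Pi.single_eq_same]
      · rw [Pi.single_eq_of_ne hk, Pi.single_eq_of_ne (mt e.2 hk), ite_self]

/-- If s_i fixes the word, then w s_i = s_j w and H_{s_i} acts by q⁻¹, so C_{s_i} kills M_w.
Otherwise the coefficient of M_w is -q⁻¹ going up, and (q⁻¹ - q) - q⁻¹ = -q going down. -/
theorem wordEquiv_rightAct_C (i : Fin n) (x : Parabolic n) :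
    wordEquiv n (rightAct (coxC n) (typeA n) (C (coxC n) i) x) = wordOpC i (wordEquiv n x) := by
  suffices (wordEquiv n).toLinearMap ∘ₗ rightAct (coxC n) (typeA n) (C (coxC n) i) =
      wordOpC i ∘ₗ (wordEquiv n).toLinearMap from LinearMap.congr_fun this x
  refine LinearMap.ext_on_range span_stdBasis fun w ↦ ?_
  change toWords n (rightAct (coxC n) (typeA n) (C (coxC n) i) (stdBasis (coxC n) (typeA n) w)) =
    wordOpC i (toWords n (stdBasis (coxC n) (typeA n) w))
  have hw : IsShort w.1 := (isShort_iff w.1).2 w.2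
  rw [toWords_stdBasis, wordOpC_single, stdBasis, rightAct_tmul, C, H_one, mul_sub, mul_smul_comm,
    mul_one, toWords_tmul, one_smul, map_sub, map_sub, map_smul, map_smul, toFree_H,
    freeToWords_single, ← hw, sub_self, LaurentPolynomial.T_zero, ← minCosetEquiv_apply]
  by_cases hfix : simpleOnWord i (minCosetEquiv n w) = minCosetEquiv n w
  · obtain ⟨j, hj, hwj⟩ := hw.mul_simple_of_fixed hfix
    have hlt := (isShort_iff w.1).1 hw j hj
    rw [if_pos hfix, H_mul_simple_of_lt (coxC n) (by rwa [hwj]), hwj,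
      ← H_simple_mul_of_lt (coxC n) hlt, toFree_H_simple_mul, freeToWords_leftOp hj, toFree_H,
      freeToWords_single, ← hw, sub_self, LaurentPolynomial.T_zero, ← minCosetEquiv_apply, sub_self]
  · rw [if_neg hfix]
    cases hi : minCosetEquiv n w i
    · have hws := hw.mul_simple hi hfix
      have hh := height_simpleOnWord i _ hfix
      have hlt : len (coxC n) w.1 < len (coxC n) (w.1 * (coxC n).simple i) := by
        rw [hws, hw, wordAct_mul_simple, ← minCosetEquiv_apply]
        simp only [hi] at hh
        simp at hh
        omega
      rw [H_mul_simple_of_lt (coxC n) hlt, toFree_H, freeToWords_single, ← hws, sub_self,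
        LaurentPolynomial.T_zero, wordAct_mul_simple, ← minCosetEquiv_apply]
      simp
    · obtain ⟨x, hx, hwx, hlen, hxl⟩ := hw.exists_mul_simple hi hfix
      have hwx' : w.1 * (coxC n).simple i = x := by rw [hwx, simple_mul_cancel_right]
      rw [H_mul_simple_of_gt (coxC n) (by rw [hwx']; omega), hwx', map_add, map_add, map_smul,
        map_smul, toFree_H, toFree_H, freeToWords_single, freeToWords_single, ← hx, ← hw, sub_self,
        sub_self, LaurentPolynomial.T_zero, hxl, ← minCosetEquiv_apply, if_pos rfl]
      module

end WordModule

end CupHecke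

namespace CupHecke

/-! ### Cup diagrams and words -/

section Diagrams

variable {m : ℕ}

/-- The word of a diagram: unmarked cups give `∨∧`, marked cups give `∧∧`, unmarked rays give `∨`
and marked rays give `∧`. -/
def Diagram.word (d : Diagram m) : Word m := fun k ↦ decide (k ∈ d.marked ∨ d.partner k < k)

theorem Diagram.word_eq_true {d : Diagram m} {k : Fin m} :
    d.word k = true ↔ k ∈ d.marked ∨ d.partner k < k := by simp [Diagram.word]

theorem Diagram.word_eq_false {d : Diagram m} {k : Fin m} :
    d.word k = false ↔ k ∉ d.marked ∧ k ≤ d.partner k := by simp [Diagram.word]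

namespace Diagram.IsCupDiagram

variable {d d' : Diagram m}

theorem partner_mem_marked_iff (hd : d.IsCupDiagram) (k : Fin m) :
    d.partner k ∈ d.marked ↔ k ∈ d.marked :=
  ⟨fun h ↦ by simpa [hd.partner_partner] using hd.marked_partner _ h, hd.marked_partner k⟩

/-- Strands inside a cup are unmarked. -/
theorem notMem_marked (hd : d.IsCupDiagram) {i k : Fin m} (h1 : i < k) (h2 : k < d.partner i) :
    k ∉ d.marked := by
  have h := hd.noncrossing i k h1 h2
  intro hk
  rcases le_total k (d.partner k) with hle | hle
  · have := hd.accessible k hk hle i h1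
    exact absurd this.2 (not_lt.2 h2.le)
  · have := hd.accessible (d.partner k) (hd.marked_partner k hk)
      (by rwa [hd.partner_partner]) i h.2.1
    exact absurd this.2 (not_lt.2 h.2.2.le)

/-- Induction on the width of the cup. The strands inside agree, so in d' neither end can be joined
to the inside. If the right end had any partner in d' other than i, planarity or accessibility would
force the partner of i to be inside. -/
theorem partner_eq_of_word_eq (hd : d.IsCupDiagram) (hd' : d'.IsCupDiagram) (h : d.word = d'.word)
    {i : Fin m} (hi : i < d.partner i) (hm : i ∉ d.marked) :
    d'.partner i = d.partner i ∧ i ∉ d'.marked := by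
  induction hN : (d.partner i).val - i.val using Nat.strong_induction_on generalizing i with
  | _ N ih =>
    have inner : ∀ k, i < k → k < d.partner i → i < d'.partner k ∧ d'.partner k < d.partner i := by
      intro k h1 h2
      have h3 := hd.noncrossing i k h1 h2
      have hk := hd.notMem_marked h1 h2
      rcases lt_or_gt_of_ne h3.1 with hlt | hlt
      · have := (ih _ (by rw [hd.partner_partner]; omega) (i := d.partner k)
          (by rwa [hd.partner_partner]) (by rwa [hd.partner_mem_marked_iff]) rfl).1
        rw [hd.partner_partner] at this
        have e := hd'.partner_partner (d.partner k)
        rw [this] at e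
        rw [e]
        exact h3.2
      · rw [(ih _ (by omega) hlt hk rfl).1]
        exact h3.2
    have hi' : d'.word i = false := by
      rw [← h, Diagram.word_eq_false]
      exact ⟨hm, hi.le⟩
    have hj' : d'.word (d.partner i) = true := by
      rw [← h, Diagram.word_eq_true, hd.partner_partner]
      exact Or.inr hi
    rw [Diagram.word_eq_false] at hi'
    rw [Diagram.word_eq_true] at hj'
    refine ⟨?_, hi'.1⟩
    set j := d.partner i
    have pp := hd'.partner_partner
    have hright : ¬ (i < d'.partner i ∧ d'.partner i < j) := fun hc ↦ by
      have := (inner _ hc.1 hc.2).1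
      rw [pp] at this
      exact lt_irrefl _ this
    have hleft : ¬ (i < d'.partner j ∧ d'.partner j < j) := fun hc ↦ by
      have := (inner _ hc.1 hc.2).2
      rw [pp] at this
      exact lt_irrefl _ this
    have houter : ¬ (d'.partner j < i) := fun hc ↦ by
      have := hd'.noncrossing (d'.partner j) i hc (by rwa [pp])
      rw [pp] at this
      exact hright ⟨lt_of_le_of_ne hi'.2 this.1.symm, this.2.2⟩
    rcases lt_or_ge (d'.partner j) j with hlt | hge
    · have : d'.partner j = i := by
        rcases lt_trichotomy (d'.partner j) i with h1 | h1 | h1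
        · exact absurd h1 houter
        · exact h1
        · exact absurd ⟨h1, hlt⟩ hleft
      rw [← this, pp]
    · have hjm : j ∈ d'.marked := hj'.resolve_right (not_lt.2 hge)
      have := hd'.accessible j hjm hge i hi
      exact absurd ⟨lt_of_le_of_ne hi'.2 this.1.symm, this.2⟩ hright

/-- A ∧ that is unmarked in d' is the right end of an unmarked cup of d', and that cup is also an
unmarked cup of d. -/
theorem mem_marked_of_word_eq (hd : d.IsCupDiagram) (hd' : d'.IsCupDiagram)
    (h : d.word = d'.word) {k : Fin m} (hk : k ∈ d.marked) : k ∈ d'.marked := by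
  have h1 : d'.word k = true := by
    rw [← h, Diagram.word_eq_true]
    exact Or.inl hk
  rw [Diagram.word_eq_true] at h1
  by_contra hn
  have h2 := h1.resolve_left hn
  have h3 := hd'.partner_eq_of_word_eq hd h.symm (i := d'.partner k)
    (by rwa [hd'.partner_partner]) (by rwa [hd'.partner_mem_marked_iff])
  rw [hd'.partner_partner] at h3
  refine h3.2 ?_
  rw [← hd.partner_mem_marked_iff, h3.1]
  exact hk

theorem marked_eq_of_word_eq (hd : d.IsCupDiagram) (hd' : d'.IsCupDiagram)
    (h : d.word = d'.word) : d.marked = d'.marked :=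
  Finset.ext fun _ ↦ ⟨hd.mem_marked_of_word_eq hd' h, hd'.mem_marked_of_word_eq hd h.symm⟩

theorem partner_eq_of_notMem (hd : d.IsCupDiagram) (hd' : d'.IsCupDiagram)
    (h : d.word = d'.word) {k : Fin m} (hk : k ∉ d.marked) (hp : d.partner k ≠ k) :
    d'.partner k = d.partner k := by
  rcases lt_or_gt_of_ne hp with hlt | hlt
  · have := (hd.partner_eq_of_word_eq hd' h (i := d.partner k) (by rwa [hd.partner_partner])
      (by rwa [hd.partner_mem_marked_iff])).1
    rw [hd.partner_partner] at this
    rw [← this, hd'.partner_partner, this]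
  · exact (hd.partner_eq_of_word_eq hd' h hlt hk).1

/-- Marked strands with the same left end in diagrams with the same marked vertices cannot differ if
the marked strands to the left of them agree. -/
theorem partner_le_of_marked_eq (hd : d.IsCupDiagram) (hd' : d'.IsCupDiagram)
    (h : d.marked = d'.marked) {k : Fin m} (hk : k ∈ d.marked) (hle : k ≤ d.partner k)
    (ih : ∀ i < k, i ∈ d.marked → d'.partner i = d.partner i) :
    ¬ d.partner k < d'.partner k ∧ ¬ (d'.partner k = k ∧ k < d.partner k) := by
  constructor
  · intro hlt
    rcases hle.eq_or_lt with he | hlt'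
    · have hj := hd'.marked_partner k (h ▸ hk)
      rw [← h] at hj
      set j := d'.partner k with hjdef
      have hjk : d'.partner j = k := hd'.partner_partner k
      have hkj : k < j := by omega
      -- Since d has a ray at k, accessibility forces the marked strand of d at j to start to the
      -- left of k, where d' has the same strand.
      rcases le_total j (d.partner j) with h1 | h1
      · have := hd.accessible j hj h1 k hkj
        exact this.1 he.symm
      · have hp := hd.marked_partner j hj
        rcases lt_trichotomy (d.partner j) k with h2 | h2 | h2
        · have := ih _ h2 hp
          rw [hd.partner_partner] at this
          have h3 : d'.partner (d'.partner (d.partner j)) = k := by rw [this, hjk]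
          rw [hd'.partner_partner] at h3
          omega
        · have := hd.partner_partner j
          rw [h2] at this
          omega
        · have := hd.accessible (d.partner j) hp (by rwa [hd.partner_partner]) k h2
          exact this.1 he.symm
    · exact hd'.notMem_marked hlt' hlt (h ▸ hd.marked_partner k hk)
  · rintro ⟨he, hlt⟩
    have hj := hd.marked_partner k hk
    set j := d.partner k with hjdef
    have hjk : d.partner j = k := hd.partner_partner k
    rw [h] at hj
    rcases le_total j (d'.partner j) with h1 | h1
    · exact (hd'.accessible j hj h1 k hlt).1 he
    · have hp := hd'.marked_partner j hj
      rcases lt_trichotomy (d'.partner j) k with h2 | h2 | h2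
      · have := ih _ h2 (h ▸ hp)
        rw [hd'.partner_partner] at this
        have h3 : d.partner (d.partner (d'.partner j)) = k := by rw [← this, hjk]
        rw [hd.partner_partner] at h3
        omega
      · have := hd'.partner_partner j
        rw [h2] at this
        omega
      · exact (hd'.accessible (d'.partner j) hp (by rwa [hd'.partner_partner]) k h2).1 he

/-- A cup diagram is determined by its word. -/
theorem eq_of_word_eq (hd : d.IsCupDiagram) (hd' : d'.IsCupDiagram) (h : d.word = d'.word) :
    d = d' := by
  have hm := hd.marked_eq_of_word_eq hd' h
  refine Diagram.ext (funext fun k ↦ ?_) hm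
  by_cases hk : k ∈ d.marked
  -- Marked strands are compared from left to right. Applying `partner_le_of_marked_eq` in both
  -- directions excludes either strict inequality between the partners.
  · induction hN : k.val using Nat.strong_induction_on generalizing k with
    | _ N ih =>
      have ih' : ∀ i < k, i ∈ d.marked → d'.partner i = d.partner i :=
        fun i hi him ↦ (ih i.val (by omega) i him rfl).symm
      rcases lt_or_ge (d.partner k) k with h1 | h1
      · have := ih' _ h1 (hd.marked_partner k hk)
        rw [hd.partner_partner] at this
        rw [← hd'.partner_partner (d.partner k), this]
      rcases lt_or_ge (d'.partner k) k with h2 | h2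
      · have := ih' _ h2 (by rw [hm]; exact hd'.marked_partner k (hm ▸ hk))
        rw [hd'.partner_partner] at this
        rw [this, hd.partner_partner, ← this]
      have h3 := (hd.partner_le_of_marked_eq hd' hm hk h1 ih').1
      have h4 := (hd'.partner_le_of_marked_eq hd hm.symm (hm ▸ hk) h2
        (fun i hi him ↦ (ih' i hi (hm ▸ him)).symm)).1
      omega
  · by_cases hp : d.partner k = k
    · by_cases hp' : d'.partner k = k
      · rw [hp, hp']
      · exact hd'.partner_eq_of_notMem hd h.symm (hm ▸ hk) hp'
    · exact (hd.partner_eq_of_notMem hd' h hk hp).symm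

end Diagram.IsCupDiagram

/-! The construction of the diagram of a word. -/

theorem MarkedStage.connected {l : Word m} {U V : Finset (Fin m × Fin m)} (h : MarkedStage l U V)
    {k : Fin m} (hk : Connected V k) : ¬ Connected U k ∧ l k = true := by
  induction h with
  | start => obtain ⟨p, hp, -⟩ := hk; simp at hp
  | step V i j _ hn hi hj _ ih =>
    obtain ⟨p, hp, hpk⟩ := hk
    rw [Finset.mem_insert] at hp
    have hU : ∀ k, ¬ Connected (U ∪ V) k → ¬ Connected U k := fun k h h' ↦ by
      obtain ⟨p, hp, hpk⟩ := h'
      exact h ⟨p, Finset.mem_union_left _ hp, hpk⟩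
    rcases hp with rfl | hp
    · rcases hpk with rfl | rfl
      · exact ⟨hU _ hn.2.1, hi⟩
      · exact ⟨hU _ hn.2.2.1, hj⟩
    · exact ih ⟨p, hp, hpk⟩

theorem UnmarkedStage.mem {l : Word m} {U : Finset (Fin m × Fin m)} (h : UnmarkedStage l U)
    {p : Fin m × Fin m} (hp : p ∈ U) : p.1 < p.2 ∧ l p.1 = false ∧ l p.2 = true := by
  induction h with
  | start => simp at hp
  | step S i j _ hn hi hj ih =>
    rw [Finset.mem_insert] at hp
    rcases hp with rfl | hp
    · exact ⟨hn.1, hi, hj⟩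
    · exact ih hp

/-- Every drawing rule records the symbols it uses, in whatever order the cups are drawn. With
`eq_of_word_eq` this makes a cup diagram obtained from l independent of choices. -/
theorem IsDiagramOf.word_eq {l : Word m} {d : Diagram m} (h : IsDiagramOf l d) : d.word = l := by
  obtain ⟨U, V, hU, -, hV, h2, hp, hr, hm⟩ := h
  funext k
  by_cases hkV : Connected V k
  · rw [(hV.connected hkV).2, Diagram.word_eq_true]
    exact Or.inl ((hm k).2 (Or.inl hkV))
  by_cases hkU : Connected U k
  · have hkm : k ∉ d.marked := by
      rw [hm]
      obtain ⟨p, hpU, hpk⟩ := hkU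
      rintro (h | h)
      · exact hkV h
      · exact h.1 ⟨p, Finset.mem_union_left _ hpU, hpk⟩
    obtain ⟨p, hpU, hpk⟩ := hkU
    have h1 := hU.mem hpU
    have h2 := hp p (Finset.mem_union_left _ hpU)
    rcases hpk with rfl | rfl
    · rw [h1.2.1, Diagram.word_eq_false, h2.1]
      exact ⟨hkm, h1.1.le⟩
    · rw [h1.2.2, Diagram.word_eq_true, h2.2]
      exact Or.inr h1.1
  · have hk : ¬ Connected (U ∪ V) k := by
      rintro ⟨p, hp, hpk⟩
      rcases Finset.mem_union.1 hp with h | h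
      · exact hkU ⟨p, h, hpk⟩
      · exact hkV ⟨p, h, hpk⟩
    have h1 := hr k hk
    have h2 : k ∈ d.marked ↔ l k = true := by
      rw [hm]
      tauto
    rw [Bool.eq_iff_iff, Diagram.word_eq_true, h1, h2]
    simp

/-- The unmarked cups of `d` with right end smaller than `t`. -/
def Diagram.unmarkedBelow (d : Diagram m) (t : ℕ) : Finset (Fin m × Fin m) :=
  (Finset.univ.filter fun k ↦ k < d.partner k ∧ k ∉ d.marked ∧ (d.partner k).val < t).image
    fun k ↦ (k, d.partner k)

/-- The marked cups of `d` with right end smaller than `t`. -/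
def Diagram.markedBelow (d : Diagram m) (t : ℕ) : Finset (Fin m × Fin m) :=
  (Finset.univ.filter fun k ↦ k < d.partner k ∧ k ∈ d.marked ∧ (d.partner k).val < t).image
    fun k ↦ (k, d.partner k)

theorem Diagram.mem_unmarkedBelow {d : Diagram m} {t : ℕ} {p : Fin m × Fin m} :
    p ∈ d.unmarkedBelow t ↔
      p.2 = d.partner p.1 ∧ p.1 < p.2 ∧ p.1 ∉ d.marked ∧ p.2.val < t := by
  simp only [Diagram.unmarkedBelow, Finset.mem_image, Finset.mem_filter, Finset.mem_univ, true_and]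
  constructor
  · rintro ⟨k, hk, rfl⟩
    exact ⟨rfl, hk⟩
  · rintro ⟨h1, h2⟩
    exact ⟨p.1, by rwa [← h1], by rw [← h1]⟩

theorem Diagram.mem_markedBelow {d : Diagram m} {t : ℕ} {p : Fin m × Fin m} :
    p ∈ d.markedBelow t ↔
      p.2 = d.partner p.1 ∧ p.1 < p.2 ∧ p.1 ∈ d.marked ∧ p.2.val < t := by
  simp only [Diagram.markedBelow, Finset.mem_image, Finset.mem_filter, Finset.mem_univ, true_and]
  constructor
  · rintro ⟨k, hk, rfl⟩
    exact ⟨rfl, hk⟩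
  · rintro ⟨h1, h2⟩
    exact ⟨p.1, by rwa [← h1], by rw [← h1]⟩

namespace Diagram.IsCupDiagram

variable {d : Diagram m}

theorem connected_unmarkedBelow (hd : d.IsCupDiagram) {t : ℕ} {k : Fin m} :
    Connected (d.unmarkedBelow t) k ↔
      d.partner k ≠ k ∧ k ∉ d.marked ∧ k.val < t ∧ (d.partner k).val < t := by
  constructor
  · rintro ⟨⟨i, j⟩, hp, hk⟩
    rw [Diagram.mem_unmarkedBelow] at hp
    obtain ⟨h1, h2, h3, h4⟩ := hp
    simp only at h1 h2 h3 h4 hk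
    have pp := hd.partner_partner i
    have := hd.partner_mem_marked_iff i
    rcases hk with rfl | rfl
    · rw [← h1]
      exact ⟨h2.ne', h3, by omega, h4⟩
    · rw [h1, pp]
      rw [h1] at h2 h4
      exact ⟨h2.ne, by rwa [this], h4, by omega⟩
  · rintro ⟨h1, h2, h3, h4⟩
    rcases lt_or_gt_of_ne h1 with h | h
    · refine ⟨(d.partner k, k), Diagram.mem_unmarkedBelow.2 ?_, Or.inr rfl⟩
      exact ⟨(hd.partner_partner k).symm, h, by rwa [hd.partner_mem_marked_iff], h3⟩
    · exact ⟨(k, d.partner k), Diagram.mem_unmarkedBelow.2 ⟨rfl, h, h2, h4⟩, Or.inl rfl⟩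

theorem connected_markedBelow (hd : d.IsCupDiagram) {t : ℕ} {k : Fin m} :
    Connected (d.markedBelow t) k ↔
      d.partner k ≠ k ∧ k ∈ d.marked ∧ k.val < t ∧ (d.partner k).val < t := by
  constructor
  · rintro ⟨⟨i, j⟩, hp, hk⟩
    rw [Diagram.mem_markedBelow] at hp
    obtain ⟨h1, h2, h3, h4⟩ := hp
    simp only at h1 h2 h3 h4 hk
    have pp := hd.partner_partner i
    have := hd.partner_mem_marked_iff i
    rcases hk with rfl | rfl
    · rw [← h1]
      exact ⟨h2.ne', h3, by omega, h4⟩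
    · rw [h1, pp]
      rw [h1] at h2 h4
      exact ⟨h2.ne, by rwa [this], h4, by omega⟩
  · rintro ⟨h1, h2, h3, h4⟩
    rcases lt_or_gt_of_ne h1 with h | h
    · refine ⟨(d.partner k, k), Diagram.mem_markedBelow.2 ?_, Or.inr rfl⟩
      exact ⟨(hd.partner_partner k).symm, h, by rwa [hd.partner_mem_marked_iff], h3⟩
    · exact ⟨(k, d.partner k), Diagram.mem_markedBelow.2 ⟨rfl, h, h2, h4⟩, Or.inl rfl⟩

theorem connected_union {S T : Finset (Fin m × Fin m)} {k : Fin m} :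
    Connected (S ∪ T) k ↔ Connected S k ∨ Connected T k := by
  simp only [Connected, Finset.mem_union, or_and_right, exists_or]

/-- The cups can be drawn in the order of their right ends, because everything inside a cup is
unmarked and ends further to the left. -/
theorem unmarkedStage (hd : d.IsCupDiagram) (t : ℕ) :
    UnmarkedStage d.word (d.unmarkedBelow t) := by
  induction t with
  | zero =>
    have : d.unmarkedBelow 0 = ∅ := by simp [Diagram.unmarkedBelow]
    rw [this]
    exact .start
  | succ t ih =>
    by_cases hex : ∃ i : Fin m, i < d.partner i ∧ i ∉ d.marked ∧ (d.partner i).val = t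
    · obtain ⟨i, hi, hm, ht⟩ := hex
      have e : d.unmarkedBelow (t + 1) = insert (i, d.partner i) (d.unmarkedBelow t) := by
        ext ⟨a, b⟩
        simp only [Finset.mem_insert, Diagram.mem_unmarkedBelow, Prod.mk.injEq]
        constructor
        · rintro ⟨h1, h2, h3, h4⟩
          by_cases hb : b.val = t
          · have : b = d.partner i := Fin.ext (by omega)
            have ha : a = i := by rw [← hd.partner_partner a, ← h1, this, hd.partner_partner]
            exact Or.inl ⟨ha, this⟩
          · exact Or.inr ⟨h1, h2, h3, by omega⟩
        · rintro (⟨rfl, rfl⟩ | ⟨h1, h2, h3, h4⟩)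
          · exact ⟨rfl, hi, hm, by omega⟩
          · exact ⟨h1, h2, h3, by omega⟩
      rw [e]
      refine .step _ _ _ ih ⟨hi, ?_, ?_, fun k h1 h2 ↦ ?_⟩ ?_ ?_
      · rw [hd.connected_unmarkedBelow]; omega
      · rw [hd.connected_unmarkedBelow]; omega
      · rw [hd.connected_unmarkedBelow]
        have := hd.noncrossing i k h1 h2
        exact ⟨this.1, hd.notMem_marked h1 h2, by omega, by omega⟩
      · rw [Diagram.word_eq_false]; exact ⟨hm, hi.le⟩
      · rw [Diagram.word_eq_true, hd.partner_partner]; exact Or.inr hi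
    · have e : d.unmarkedBelow (t + 1) = d.unmarkedBelow t := by
        ext ⟨a, b⟩
        simp only [Diagram.mem_unmarkedBelow]
        constructor
        · rintro ⟨h1, h2, h3, h4⟩
          refine ⟨h1, h2, h3, ?_⟩
          by_contra hb
          exact hex ⟨a, by rwa [← h1], h3, by rw [← h1]; omega⟩
        · rintro ⟨h1, h2, h3, h4⟩
          exact ⟨h1, h2, h3, by omega⟩
      rwa [e]

/-- Again in the order of right ends. Accessibility means that everything to the left of a marked
cup is connected before it is drawn. -/
theorem markedStage (hd : d.IsCupDiagram) (t : ℕ) :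
    MarkedStage d.word (d.unmarkedBelow m) (d.markedBelow t) := by
  induction t with
  | zero =>
    have : d.markedBelow 0 = ∅ := by simp [Diagram.markedBelow]
    rw [this]
    exact .start
  | succ t ih =>
    by_cases hex : ∃ i : Fin m, i < d.partner i ∧ i ∈ d.marked ∧ (d.partner i).val = t
    · obtain ⟨i, hi, hm, ht⟩ := hex
      have e : d.markedBelow (t + 1) = insert (i, d.partner i) (d.markedBelow t) := by
        ext ⟨a, b⟩
        simp only [Finset.mem_insert, Diagram.mem_markedBelow, Prod.mk.injEq]
        constructor
        · rintro ⟨h1, h2, h3, h4⟩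
          by_cases hb : b.val = t
          · have : b = d.partner i := Fin.ext (by omega)
            have ha : a = i := by rw [← hd.partner_partner a, ← h1, this, hd.partner_partner]
            exact Or.inl ⟨ha, this⟩
          · exact Or.inr ⟨h1, h2, h3, by omega⟩
        · rintro (⟨rfl, rfl⟩ | ⟨h1, h2, h3, h4⟩)
          · exact ⟨rfl, hi, hm, by omega⟩
          · exact ⟨h1, h2, h3, by omega⟩
      have hm' := hd.marked_partner i hm
      rw [e]
      refine .step _ _ _ ih ⟨hi, ?_, ?_, fun k h1 h2 ↦ ?_⟩ ?_ ?_ ?_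
      · rw [connected_union, hd.connected_unmarkedBelow, hd.connected_markedBelow]
        rintro (h | h)
        · exact h.2.1 hm
        · omega
      · rw [connected_union, hd.connected_unmarkedBelow, hd.connected_markedBelow]
        rintro (h | h)
        · exact h.2.1 hm'
        · omega
      · rw [connected_union, hd.connected_unmarkedBelow]
        have := hd.noncrossing i k h1 h2
        exact Or.inl ⟨this.1, hd.notMem_marked h1 h2, by omega, by omega⟩
      · rw [Diagram.word_eq_true]; exact Or.inl hm
      · rw [Diagram.word_eq_true]; exact Or.inl hm'
      · intro k hk _
        have := hd.accessible i hm hi.le k hk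
        rw [connected_union, hd.connected_unmarkedBelow, hd.connected_markedBelow]
        by_cases hkm : k ∈ d.marked
        · exact Or.inr ⟨this.1, hkm, by omega, by omega⟩
        · exact Or.inl ⟨this.1, hkm, by omega, by omega⟩
    · have e : d.markedBelow (t + 1) = d.markedBelow t := by
        ext ⟨a, b⟩
        simp only [Diagram.mem_markedBelow]
        constructor
        · rintro ⟨h1, h2, h3, h4⟩
          refine ⟨h1, h2, h3, ?_⟩
          by_contra hb
          exact hex ⟨a, by rwa [← h1], h3, by rw [← h1]; omega⟩
        · rintro ⟨h1, h2, h3, h4⟩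
          exact ⟨h1, h2, h3, by omega⟩
      rwa [e]

theorem isDiagramOf_word (hd : d.IsCupDiagram) : IsDiagramOf d.word d := by
  have hU : ∀ k, Connected (d.unmarkedBelow m) k ↔ d.partner k ≠ k ∧ k ∉ d.marked := fun k ↦ by
    rw [hd.connected_unmarkedBelow]
    simp
  have hV : ∀ k, Connected (d.markedBelow m) k ↔ d.partner k ≠ k ∧ k ∈ d.marked := fun k ↦ by
    rw [hd.connected_markedBelow]
    simp
  have hUV : ∀ k, Connected (d.unmarkedBelow m ∪ d.markedBelow m) k ↔ d.partner k ≠ k :=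
    fun k ↦ by
      rw [connected_union, hU, hV]
      tauto
  refine ⟨_, _, hd.unmarkedStage m, ?_, hd.markedStage m, ?_, ?_, ?_, ?_⟩
  -- A ∨ left over at i is a ray, and a ∧ left over at j is on a marked strand, which the ray makes
  -- inaccessible. The next case, two leftover ∧, is similar.
  · rintro ⟨i, j, ⟨hij, hi, hj, -⟩, hli, hlj⟩
    rw [Diagram.word_eq_false] at hli
    rw [Diagram.word_eq_true] at hlj
    rw [hU] at hi hj
    have hpi : d.partner i = i := by tauto
    have hjm : j ∈ d.marked := by
      rcases hlj with h | h
      · exact h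
      · by_contra hn
        exact hj ⟨h.ne, hn⟩
    rcases le_total j (d.partner j) with h | h
    · exact (hd.accessible j hjm h i hij).1 hpi
    · have hp := hd.partner_partner j
      rcases lt_trichotomy i (d.partner j) with h1 | h1 | h1
      · exact (hd.accessible _ (hd.marked_partner j hjm) (by rwa [hp]) i h1).1 hpi
      · rw [← h1] at hp
        rw [hp] at hpi
        exact hij.ne' hpi
      · exact (hd.noncrossing (d.partner j) i h1 (by rwa [hp])).1 hpi
  · rintro ⟨i, j, ⟨hij, hi, hj, -⟩, hli, hlj⟩
    rw [hUV, not_not] at hi hj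
    rw [Diagram.word_eq_true, hj] at hlj
    exact (hd.accessible j (hlj.resolve_right (lt_irrefl _)) hj.ge i hij).1 hi
  · intro p hp
    have : p.2 = d.partner p.1 := by
      rcases Finset.mem_union.1 hp with h | h
      · exact (Diagram.mem_unmarkedBelow.1 h).1
      · exact (Diagram.mem_markedBelow.1 h).1
    exact ⟨this.symm, by rw [this, hd.partner_partner]⟩
  · intro k hk
    rwa [hUV, not_not] at hk
  · intro k
    rw [hV, hUV, Diagram.word_eq_true]
    by_cases h : d.partner k = k
    · simp [h]
    · simp [h]

end Diagram.IsCupDiagram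

theorem isDiagramOf_iff {d : Diagram m} (hd : d.IsCupDiagram) (l : Word m) :
    IsDiagramOf l d ↔ d.word = l :=
  ⟨fun h ↦ h.word_eq, fun h ↦ h ▸ hd.isDiagramOf_word⟩

end Diagrams

end CupHecke

namespace CupHecke

/-! ### Joining the strands at two neighbouring vertices. -/

section Join

variable {m : ℕ}

/-- The diagram obtained from `d` by joining the strands at `a` and `b`, with an additional marker
if `c` is true, and adding a new cup at `a` and `b`, which is marked if `c` is true. -/
def Diagram.join (d : Diagram m) (a b : Fin m) (c : Bool) : Diagram m where
  partner k :=
    if k = a then b else if k = b then a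
    else if k = d.partner a then (if d.partner b = b then k else d.partner b)
    else if k = d.partner b then (if d.partner a = a then k else d.partner a)
    else d.partner k
  marked := Finset.univ.filter fun k ↦
    if k = a ∨ k = b then c = true
    else if k = d.partner a ∨ k = d.partner b then
      (decide (a ∈ d.marked) ^^ decide (b ∈ d.marked) ^^ c) = true
    else k ∈ d.marked

theorem Diagram.partner_join (d : Diagram m) (a b : Fin m) (c : Bool) (k : Fin m) :
    (d.join a b c).partner k = if k = a then b else if k = b then a
      else if k = d.partner a then (if d.partner b = b then k else d.partner b)
      else if k = d.partner b then (if d.partner a = a then k else d.partner a)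
      else d.partner k := rfl

theorem Diagram.mem_marked_join (d : Diagram m) (a b : Fin m) (c : Bool) (k : Fin m) :
    k ∈ (d.join a b c).marked ↔ if k = a ∨ k = b then c = true
      else if k = d.partner a ∨ k = d.partner b then
        (decide (a ∈ d.marked) ^^ decide (b ∈ d.marked) ^^ c) = true
      else k ∈ d.marked := by
  simp [Diagram.join]

namespace Diagram.IsCupDiagram

variable {d : Diagram m} {a b : Fin m} {c : Bool}

theorem join_partner_partner (hd : d.IsCupDiagram) (hab : a ≠ b) (k : Fin m) :
    (d.join a b c).partner ((d.join a b c).partner k) = k := by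
  have h1 := hd.partner_partner a
  have h2 := hd.partner_partner b
  have h3 := hd.partner_partner k
  simp only [Diagram.partner_join]
  grind

/-- Planarity of d at i, at the two joined vertices and at their partners settles every position of
j; what remains is linear arithmetic. -/
theorem join_noncrossing (hd : d.IsCupDiagram) (hab : b.val = a.val + 1) (i j : Fin m)
    (hij : i < j) (hj : j < (d.join a b c).partner i) :
    (d.join a b c).partner j ≠ j ∧ i < (d.join a b c).partner j ∧
      (d.join a b c).partner j < (d.join a b c).partner i := by
  have pa := hd.partner_partner a
  have pb := hd.partner_partner b
  have pi := hd.partner_partner i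
  have pj := hd.partner_partner j
  have h1 := hd.noncrossing i j
  have h2 := hd.noncrossing i a
  have h3 := hd.noncrossing i b
  have h4 := hd.noncrossing (d.partner a) j
  have h5 := hd.noncrossing (d.partner b) j
  have h6 := hd.noncrossing a j
  have h7 := hd.noncrossing b j
  have h8 := hd.noncrossing a b
  have h9 := hd.noncrossing (d.partner a) (d.partner b)
  have h10 := hd.noncrossing (d.partner b) (d.partner a)
  have h11 := hd.noncrossing a (d.partner j)
  have h12 := hd.noncrossing b (d.partner j)
  have h13 := hd.noncrossing (d.partner a) (d.partner j)
  have h14 := hd.noncrossing (d.partner b) (d.partner j)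
  have h17 : d.partner a ≠ d.partner b := fun h ↦ by
    rw [h, pb] at pa
    omega
  have h18 : d.partner a = b → d.partner b = a := fun h ↦ by rw [← h, pa]
  have h19 : d.partner j = d.partner a → j = a := fun h ↦ by rw [← pj, h, pa]
  have h20 : d.partner j = d.partner b → j = b := fun h ↦ by rw [← pj, h, pb]
  have h15 : d.partner j = a → j = d.partner a := fun h ↦ by rw [← h, pj]
  have h16 : d.partner j = b → j = d.partner b := fun h ↦ by rw [← h, pj]
  simp only [pa, pb, pj] at h4 h5 h9 h10 h11 h12 h13 h14
  simp only [Diagram.partner_join] at hj ⊢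
  by_cases ia : i = a
  · simp only [ia, if_true] at hj; omega
  by_cases ib : i = b
  · simp only [ib, if_true, if_neg (show b ≠ a by omega)] at hj; omega
  simp only [if_neg ia, if_neg ib] at hj ⊢
  by_cases ix : i = d.partner a
  · subst ix
    by_cases hy : d.partner b = b
    · simp only [if_true, if_pos hy] at hj; omega
    · simp only [if_true, if_neg hy] at hj ⊢
      clear h1 h2 h3 h5 h6 h11 h12 h13 h14 pi
      split_ifs <;> omega
  by_cases iy : i = d.partner b
  · subst iy
    by_cases hx : d.partner a = a
    · simp only [if_neg ix, if_true, if_pos hx] at hj; omega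
    · simp only [if_neg ix, if_true, if_neg hx] at hj ⊢
      clear h1 h2 h3 h4 h7 h9 h11 h14 pi
      split_ifs <;> omega
  simp only [if_neg ix, if_neg iy] at hj ⊢
  clear h4 h5 h6 h7 h9 h10 h11 h12 h13 h14 h15 h16 h18 h19 h20
  by_cases ja : j = a
  · subst ja
    simp only [if_true]
    have := h1 hij hj
    have : d.partner i ≠ b := fun h ↦ iy (by rw [← h, pi])
    omega
  by_cases jb : j = b
  · subst jb
    simp only [if_true, if_neg ja]
    have := h1 hij hj
    have : i ≠ a := ia
    omega
  simp only [if_neg ja, if_neg jb]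
  have h1 := h1 hij hj
  have ha : d.partner i ≠ a := fun h ↦ ix (by rw [← h, pi])
  have hb : d.partner i ≠ b := fun h ↦ iy (by rw [← h, pi])
  split_ifs with jx hy jy hx
  · subst jx
    rw [pa] at h1
    omega
  · subst jx
    rw [pa] at h1
    omega
  · subst jy
    rw [pb] at h1
    omega
  · subst jy
    rw [pb] at h1
    omega
  · exact h1

theorem join_marked_partner (hd : d.IsCupDiagram) (i : Fin m)
    (hi : i ∈ (d.join a b c).marked) : (d.join a b c).partner i ∈ (d.join a b c).marked := by
  have pa := hd.partner_partner a
  have pb := hd.partner_partner b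
  have pi := hd.partner_partner i
  have := hd.partner_mem_marked_iff i
  rw [Diagram.mem_marked_join] at hi ⊢
  simp only [Diagram.partner_join]
  grind

theorem partner_lt_of_lt_partner (hd : d.IsCupDiagram) (hab : b.val = a.val + 1)
    (h : b < d.partner a) : a < d.partner b ∧ d.partner b < d.partner a ∧ d.partner b ≠ b := by
  have := hd.noncrossing a b (by omega) h
  exact ⟨this.2.1, this.2.2, this.1⟩

-- If c is false, a marked joined strand comes from exactly one marked strand, whose accessibility
-- carries over. A marked cap sits at the leftmost vertices, so it is accessible itself.
set_option maxHeartbeats 600000 in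
theorem join_accessible (hd : d.IsCupDiagram) (hab : b.val = a.val + 1)
    (hc : c = true → a.val = 0) (i : Fin m) (hi : i ∈ (d.join a b c).marked)
    (hle : i ≤ (d.join a b c).partner i) (j : Fin m) (hj : j < i) :
    (d.join a b c).partner j ≠ j ∧ (d.join a b c).partner j < i := by
  have pa := hd.partner_partner a
  have pb := hd.partner_partner b
  have pj := hd.partner_partner j
  have hne : d.partner a ≠ d.partner b := fun h ↦ by
    rw [h, pb] at pa
    omega
  have oth : ∀ k, k ≠ a → k ≠ b → k ≠ d.partner a → k ≠ d.partner b →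
      (d.join a b c).partner k = d.partner k := fun k h1 h2 h3 h4 ↦ by
    rw [Diagram.partner_join, if_neg h1, if_neg h2, if_neg h3, if_neg h4]
  have hpa : (d.join a b c).partner a = b := by rw [Diagram.partner_join, if_pos rfl]
  have hba : b ≠ a := fun h ↦ by rw [h] at hab; omega
  have hpb : (d.join a b c).partner b = a := by
    rw [Diagram.partner_join, if_neg hba, if_pos rfl]
  have ma := hd.accessible a
  have mb := hd.accessible b
  have mx := hd.accessible (d.partner a)
  have my := hd.accessible (d.partner b)
  rw [hd.partner_mem_marked_iff, pa] at mx
  rw [hd.partner_mem_marked_iff, pb] at my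
  rw [Diagram.mem_marked_join] at hi
  by_cases ia : i = a
  · rw [if_pos (Or.inl ia)] at hi
    have := hc hi
    omega
  by_cases ib : i = b
  · rw [ib, hpb] at hle
    omega
  rw [if_neg (by tauto)] at hi
  by_cases ix : i = d.partner a
  · rw [if_pos (Or.inl ix)] at hi
    rw [Diagram.partner_join, if_neg ia, if_neg ib, if_pos ix] at hle
    subst ix
    have hxa : d.partner a < a := by
      by_cases hy : d.partner b = b
      · have : ¬ b < d.partner a := fun h ↦ (hd.partner_lt_of_lt_partner hab h).2.2 hy
        omega
      · rw [if_neg hy] at hle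
        have : ¬ b < d.partner a := fun h ↦
          absurd (hd.partner_lt_of_lt_partner hab h).2.1 (not_lt.2 hle)
        omega
    have hcf : c = false := by
      cases c
      · rfl
      · have := hc rfl
        omega
    have hyb : b ≤ d.partner b := by
      by_cases hy : d.partner b = b
      · exact hy.ge
      · rw [if_neg hy] at hle
        by_contra hlt
        have := hd.noncrossing (d.partner a) (d.partner b) (lt_of_le_of_ne hle hne)
          (by
            have : d.partner b ≠ a := fun h ↦ ib (by rw [← h, pb])
            rw [pa]
            omega)
        rw [pa, pb] at this
        omega
    rw [oth j (by omega) (by omega) hj.ne (by omega)]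
    simp only [hcf, Bool.xor_false, bne_iff_ne, ne_eq, decide_eq_decide] at hi
    by_cases hma : a ∈ d.marked
    · exact mx hma hxa.le j hj
    · have hmb : b ∈ d.marked := by tauto
      have h := mb hmb hyb j (by omega)
      have : d.partner j ≠ d.partner a := fun h ↦ by rw [← pj, h, pa] at hj; omega
      have njx : j < d.partner a → d.partner a < d.partner j → a < d.partner j := fun h1 h2 ↦ by
        have := (hd.noncrossing j _ h1 h2).2.2
        rwa [pa] at this
      have : d.partner j ≠ a := fun h ↦ by rw [← h, pj] at hj; exact lt_irrefl _ hj
      exact ⟨h.1, by omega⟩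
  by_cases iy : i = d.partner b
  · rw [if_pos (Or.inr iy)] at hi
    rw [Diagram.partner_join, if_neg ia, if_neg ib, if_neg ix, if_pos iy] at hle
    subst iy
    by_cases hyb : d.partner b < b
    · have hxa : d.partner a ≠ a := fun h ↦ by
        have := (hd.noncrossing (d.partner b) a (by omega) (by rw [pb]; omega)).1
        exact this h
      rw [if_neg hxa] at hle
      have hxa' : d.partner a < a := by
        have h1 := (hd.noncrossing (d.partner b) a (by omega) (by rw [pb]; omega)).2.2
        rw [pb] at h1
        omega
      have hcf : c = false := by
        cases c
        · rfl
        · have := hc rfl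
          omega
      have hma : a ∉ d.marked := hd.notMem_marked (i := d.partner b) (by omega) (by rw [pb]; omega)
      simp only [hcf, Bool.xor_false, bne_iff_ne, ne_eq, decide_eq_decide] at hi
      have hmb : b ∈ d.marked := by tauto
      rw [oth j (by omega) (by omega) (by omega) hj.ne]
      exact my hmb hyb.le j hj
    · have hby : b < d.partner b := by omega
      have hxa : a ≤ d.partner a := by
        by_cases hx : d.partner a = a
        · exact hx.ge
        · rw [if_neg hx] at hle
          omega
      have hmb : b ∉ d.marked := fun h ↦ by
        have := mb h hby.le a (by omega)
        by_cases hx : d.partner a = a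
        · exact this.1 hx
        · rw [if_neg hx] at hle
          omega
      rcases lt_trichotomy j.val a.val with h1 | h1 | h1
      · have hcf : c = false := by
          cases c
          · rfl
          · have := hc rfl
            omega
        simp only [hcf, Bool.xor_false, bne_iff_ne, ne_eq, decide_eq_decide] at hi
        have hma : a ∈ d.marked := by tauto
        have := ma hma hxa j (by omega)
        rw [oth j (by omega) (by omega) (by omega) (by omega)]
        exact ⟨this.1, by omega⟩
      · rw [show j = a from Fin.ext h1, hpa]
        exact ⟨hba, hby⟩
      · by_cases hjb : j = b
        · rw [hjb, hpb]
          exact ⟨hba.symm, by omega⟩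
        · have := hd.noncrossing b j (by omega) hj
          by_cases hjx : j = d.partner a
          · rw [hjx, pa] at this
            omega
          · rw [oth j (by omega) hjb hjx hj.ne]
            exact ⟨this.1, this.2.2⟩
  rw [if_neg (by tauto)] at hi
  rw [oth i ia ib ix iy] at hle
  have acc := hd.accessible i hi hle
  by_cases ja : j = a
  · rw [ja, hpa]
    exact ⟨hba, by omega⟩
  by_cases jb : j = b
  · rw [jb, hpb]
    exact ⟨hba.symm, by omega⟩
  have h := acc j hj
  by_cases jx : j = d.partner a
  · rw [Diagram.partner_join, if_neg ja, if_neg jb, if_pos jx]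
    rw [jx, pa] at h
    have hb := acc b (by omega)
    rw [if_neg hb.1, jx]
    exact ⟨hne.symm, hb.2⟩
  by_cases jy : j = d.partner b
  · rw [Diagram.partner_join, if_neg ja, if_neg jb, if_neg jx, if_pos jy]
    rw [jy, pb] at h
    have ha := acc a (by omega)
    rw [if_neg ha.1, jy]
    exact ⟨hne, ha.2⟩
  rw [oth j ja jb jx jy]
  exact h

/-- Joining the strands at neighboured vertices of a cup diagram gives a cup diagram. -/
theorem join (hd : d.IsCupDiagram) (hab : b.val = a.val + 1) (hc : c = true → a.val = 0) :
    (d.join a b c).IsCupDiagram where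
  partner_partner := hd.join_partner_partner fun h ↦ by rw [h] at hab; omega
  noncrossing := hd.join_noncrossing hab
  marked_partner := hd.join_marked_partner
  accessible := hd.join_accessible hab hc

end Diagram.IsCupDiagram

end Join

end CupHecke

namespace CupHecke

/-! ### Weights of words and the action of a cap-cup on them. -/

section Weights

variable {m : ℕ}

theorem q_mul_qInv : q * qInv = 1 := by
  rw [q, qInv, ← LaurentPolynomial.T_add]
  simp

theorem q_mul_qInv_mul_qInv : q * (qInv * qInv) = qInv := by
  rw [← mul_assoc, q_mul_qInv, one_mul]

/-- The weight of a cup with symbols `s` and `t` at its ends. -/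
noncomputable def cupWeight (s t marked : Bool) : Laurent :=
  if (s ^^ marked) = t then 0 else if t = true then 1 else -qInv

/-- The weight of a ray with symbol `s` at its end. -/
noncomputable def rayWeight (s marked : Bool) : Laurent := if s = marked then 1 else 0

/-- The contribution of the vertex `k` to the weight of a word on a diagram: rays and cups count at
their left end. -/
noncomputable def Diagram.vertexWeight (d : Diagram m) (l : Word m) (k : Fin m) : Laurent :=
  if d.partner k = k then rayWeight (l k) (decide (k ∈ d.marked))
  else if k < d.partner k then cupWeight (l k) (l (d.partner k)) (decide (k ∈ d.marked))
  else 1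

/-- The weight of a word on a diagram: `0` if the word is not an orientation of the diagram, and
otherwise `(-q⁻¹)` to the number of clockwise cups. -/
noncomputable def Diagram.weight (d : Diagram m) (l : Word m) : Laurent := ∏ k, d.vertexWeight l k

theorem Diagram.vertexWeight_ray {d : Diagram m} {k : Fin m} (h : d.partner k = k) (l : Word m) :
    d.vertexWeight l k = rayWeight (l k) (decide (k ∈ d.marked)) := by
  rw [Diagram.vertexWeight, if_pos h]

theorem Diagram.vertexWeight_left {d : Diagram m} {k k' : Fin m} (h : d.partner k = k')
    (hk : k < k') (l : Word m) :
    d.vertexWeight l k = cupWeight (l k) (l k') (decide (k ∈ d.marked)) := by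
  rw [Diagram.vertexWeight, h, if_neg hk.ne', if_pos hk]

theorem Diagram.vertexWeight_right {d : Diagram m} {k k' : Fin m} (h : d.partner k = k')
    (hk : k' < k) (l : Word m) : d.vertexWeight l k = 1 := by
  rw [Diagram.vertexWeight, h, if_neg hk.ne, if_neg hk.not_gt]

/-! Local identities for the composition of a cap with one or two strands. -/

/-- The value at `s`, `t` of the product of the cup and the cap with marker `c`, applied to `f`. -/
noncomputable def localOp (c s t : Bool) (f : Bool → Bool → Laurent) : Laurent :=
  if (s ^^ t) = !c then f (!s) (!t) - (if t = true then q else qInv) * f s t else 0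

/-- `localOp` has rank one: it pairs with the cap and then multiplies by the weight of the cup. This
and the following identities are checked for all symbols and markers, using only q q⁻¹ = 1. -/
theorem localOp_circle (c s t x : Bool) :
    localOp c s t (fun s t ↦ cupWeight s t x) =
      (if x = c then -(q + qInv) else 0) * cupWeight s t c := by
  have := q_mul_qInv
  cases c <;> cases s <;> cases t <;> cases x <;> simp [localOp, cupWeight] <;>
    first | ring1 | linear_combination -this

/-- The constants `false` here and below encode accessibility: strands to the right of a ray or
inside a cup are unmarked, and a marked cap has no vertex to its left. -/
theorem localOp_ray_ray (c s t x : Bool) :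
    localOp c s t (fun s t ↦ rayWeight s x * rayWeight t false) =
      (if (x ^^ c) = true then 1 else 0) * cupWeight s t c := by
  cases c <;> cases s <;> cases t <;> cases x <;> simp [localOp, cupWeight, rayWeight]

theorem localOp_ray_cup (c s t x v : Bool) :
    localOp c s t (fun s t ↦ rayWeight s x * cupWeight t v false) =
      cupWeight s t c * rayWeight v (x ^^ c) := by
  have := q_mul_qInv
  cases c <;> cases s <;> cases t <;> cases x <;> cases v <;>
    simp [localOp, cupWeight, rayWeight, this]

theorem localOp_cup_ray (s t x y u : Bool) :
    localOp false s t (fun s t ↦ cupWeight u s x * rayWeight t y) =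
      cupWeight s t false * rayWeight u (x ^^ y) := by
  have := q_mul_qInv
  cases s <;> cases t <;> cases x <;> cases y <;> cases u <;>
    simp [localOp, cupWeight, rayWeight, this]

theorem localOp_cup_cup (s t x y u v : Bool) :
    localOp false s t (fun s t ↦ cupWeight u s x * cupWeight t v y) =
      cupWeight s t false * cupWeight u v (x ^^ y) := by
  have := q_mul_qInv
  cases s <;> cases t <;> cases x <;> cases y <;> cases u <;> cases v <;>
    simp [localOp, cupWeight, this, q_mul_qInv_mul_qInv]

theorem localOp_nested_left (s t y u v : Bool) :
    localOp false s t (fun s t ↦ cupWeight u s false * cupWeight v t y) =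
      cupWeight s t false * cupWeight v u y := by
  have := q_mul_qInv
  cases s <;> cases t <;> cases y <;> cases u <;> cases v <;>
    simp [localOp, cupWeight, this]

theorem localOp_nested_right (c s t x u v : Bool) :
    localOp c s t (fun s t ↦ cupWeight s u x * cupWeight t v false) =
      cupWeight s t c * cupWeight v u (x ^^ c) := by
  have := q_mul_qInv
  cases c <;> cases s <;> cases t <;> cases x <;> cases u <;> cases v <;>
    simp [localOp, cupWeight, this, q_mul_qInv_mul_qInv]

/-! The composition of a cap-cup with a diagram. -/

/-- The word obtained by changing the symbols at `a` and `b`. -/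
def flipAt (a b : Fin m) (l : Word m) : Word m := fun k ↦ if k = a ∨ k = b then !(l k) else l k

/-- The action of the cap-cup at `a` and `b` with markers `c` on functions on words. -/
noncomputable def capCupOp (a b : Fin m) (c : Bool) (f : Word m → Laurent) (l : Word m) : Laurent :=
  if (l a ^^ l b) = !c then f (flipAt a b l) - (if l b = true then q else qInv) * f l else 0

open scoped Classical in
/-- The scalar that arises when the cap-cup at `a` and `b` with markers `c` is put on top of `d`. -/
noncomputable def Diagram.joinScalar (d : Diagram m) (a b : Fin m) (c : Bool) : Laurent :=
  if d.partner a = b then (if decide (a ∈ d.marked) = c then -(q + qInv) else 0)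
  else if d.partner a = a ∧ d.partner b = b then
    (if (decide (a ∈ d.marked) ^^ decide (b ∈ d.marked) ^^ c) = true then 1 else 0)
  else 1

/-- The word `l` with the symbols at `a` and `b` replaced by `s` and `t`. -/
def setAt (a b : Fin m) (l : Word m) (s t : Bool) : Word m :=
  fun k ↦ if k = a then s else if k = b then t else l k

/-- It suffices to compare the weights on the strands which meet `a` or `b`. -/
theorem Diagram.capCupOp_weight_of_local {d : Diagram m} (hd : d.IsCupDiagram) {a b : Fin m}
    (hab : a ≠ b) {c : Bool} (l : Word m) (S : Finset (Fin m)) (hS : ∀ k, k ∈ S ↔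
      k = a ∨ k = b ∨ k = d.partner a ∨ k = d.partner b) (r : Laurent)
    (h : localOp c (l a) (l b) (fun s t ↦ ∏ k ∈ S, d.vertexWeight (setAt a b l s t) k) =
      r * ∏ k ∈ S, (d.join a b c).vertexWeight l k) :
    capCupOp a b c d.weight l = r * (d.join a b c).weight l := by
  -- S is a union of strands, so weights outside S do not see the symbols at a and b and form a
  -- common factor.
  have hmem : ∀ k, k ∉ S → d.partner k ∉ S := by
    intro k hk
    have h1 := hd.partner_partner k
    rw [hS] at hk ⊢
    rintro (h | h | h | h)
    · exact hk (Or.inr (Or.inr (Or.inl (by rw [← h, h1]))))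
    · exact hk (Or.inr (Or.inr (Or.inr (by rw [← h, h1]))))
    · exact hk (Or.inl (by rw [← h1, h, hd.partner_partner]))
    · exact hk (Or.inr (Or.inl (by rw [← h1, h, hd.partner_partner])))
  have hab' : ∀ k, k ∉ S → k ≠ a ∧ k ≠ b := fun k hk ↦ by
    rw [hS] at hk
    tauto
  have h1 : ∀ l' : Word m, (∀ k, k ≠ a → k ≠ b → l' k = l k) →
      ∀ k ∈ Sᶜ, d.vertexWeight l' k = d.vertexWeight l k := by
    intro l' hl' k hk
    rw [Finset.mem_compl] at hk
    have e1 := hab' k hk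
    have e2 := hab' _ (hmem k hk)
    rw [Diagram.vertexWeight, Diagram.vertexWeight, hl' _ e1.1 e1.2, hl' _ e2.1 e2.2]
  have h2 : ∀ k ∈ Sᶜ, (d.join a b c).vertexWeight l k = d.vertexWeight l k := by
    intro k hk
    rw [Finset.mem_compl] at hk
    rw [hS] at hk
    have e1 : (d.join a b c).partner k = d.partner k := by
      rw [Diagram.partner_join, if_neg (by tauto), if_neg (by tauto), if_neg (by tauto),
        if_neg (by tauto)]
    have e2 : k ∈ (d.join a b c).marked ↔ k ∈ d.marked := by
      rw [Diagram.mem_marked_join, if_neg (by tauto), if_neg (by tauto)]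
    rw [Diagram.vertexWeight, Diagram.vertexWeight, e1]
    simp only [e2]
  have hset : ∀ s t : Bool, d.weight (setAt a b l s t) =
      (∏ k ∈ S, d.vertexWeight (setAt a b l s t) k) * ∏ k ∈ Sᶜ, d.vertexWeight l k := by
    intro s t
    rw [Diagram.weight, ← Finset.prod_mul_prod_compl S]
    congr 1
    exact Finset.prod_congr rfl (h1 _ fun k h1 h2 ↦ by rw [setAt, if_neg h1, if_neg h2])
  have hflip : flipAt a b l = setAt a b l (!(l a)) (!(l b)) := by
    funext k
    simp only [flipAt, setAt]
    by_cases h1 : k = a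
    · simp [h1]
    · by_cases h2 : k = b
      · subst h2; simp [hab.symm]
      · simp [h1, h2]
  have hself : l = setAt a b l (l a) (l b) := by
    funext k
    simp only [setAt]
    split_ifs with h1 h2
    · rw [h1]
    · rw [h2]
    · rfl
  have hl : d.weight l = (∏ k ∈ S, d.vertexWeight (setAt a b l (l a) (l b)) k) *
      ∏ k ∈ Sᶜ, d.vertexWeight l k := by
    rw [← hset, ← hself]
  rw [capCupOp, hflip, hset, hl, Diagram.weight, ← Finset.prod_mul_prod_compl S,
    Finset.prod_congr rfl h2, ← mul_assoc r, ← h, localOp]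
  split_ifs <;> ring

/-- Only the one or two strands meeting a and b matter. Each of their possible relative positions is
one of the local identities. -/
theorem Diagram.capCupOp_weight {d : Diagram m} (hd : d.IsCupDiagram) {a b : Fin m} {c : Bool}
    (hab : b.val = a.val + 1) (hc : c = true → a.val = 0) (l : Word m) :
    capCupOp a b c d.weight l = d.joinScalar a b c * (d.join a b c).weight l := by
  have hlt : a < b := by omega
  have pa := hd.partner_partner a
  have pb := hd.partner_partner b
  have hjoin := hd.join hab hc
  have ja : (d.join a b c).partner a = b := by rw [Diagram.partner_join, if_pos rfl]
  have jb : (d.join a b c).partner b = a := by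
    rw [Diagram.partner_join, if_neg hlt.ne', if_pos rfl]
  have jm : decide (a ∈ (d.join a b c).marked) = c := by
    simp [Diagram.mem_marked_join]
  have sa : ∀ s t, setAt a b l s t a = s := fun s t ↦ by simp [setAt]
  have sb : ∀ s t, setAt a b l s t b = t := fun s t ↦ by simp [setAt, hlt.ne']
  have so : ∀ s t k, k ≠ a → k ≠ b → setAt a b l s t k = l k := fun s t k h1 h2 ↦ by
    simp [setAt, h1, h2]
  have jab := Diagram.vertexWeight_left ja hlt l
  have jba := Diagram.vertexWeight_right jb hlt l
  rw [jm] at jab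
  have mk : ∀ k, k ≠ a → k ≠ b → k = d.partner a ∨ k = d.partner b →
      decide (k ∈ (d.join a b c).marked) =
        (decide (a ∈ d.marked) ^^ decide (b ∈ d.marked) ^^ c) := fun k h1 h2 h3 ↦ by
    simp only [Diagram.mem_marked_join, if_neg (show ¬ (k = a ∨ k = b) by tauto), if_pos h3,
      Bool.decide_eq_true]
  have cfalse : ∀ x : Fin m, x < a → c = false := fun x hx ↦ by
    cases c
    · rfl
    · have := hc rfl
      omega
  by_cases hcirc : d.partner a = b
  · -- a circle
    have hb : d.partner b = a := by rw [← hcirc, pa]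
    refine Diagram.capCupOp_weight_of_local hd hlt.ne l {a, b} (fun k ↦ ?_) _ ?_
    · rw [hcirc, hb, Finset.mem_insert, Finset.mem_singleton]; tauto
    · simp only [Finset.prod_pair hlt.ne, jab, jba, Diagram.vertexWeight_left hcirc hlt,
        Diagram.vertexWeight_right hb hlt, sa, sb, mul_one]
      rw [localOp_circle, Diagram.joinScalar, if_pos hcirc]
  have hcirc' : d.partner b ≠ a := fun h ↦ hcirc (by rw [← h, pb])
  have hxy : d.partner a ≠ d.partner b := fun h ↦ by
    rw [h, pb] at pa
    omega
  rw [Diagram.joinScalar, if_neg hcirc]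
  by_cases hx : d.partner a = a
  · have hmb : decide (b ∈ d.marked) = false := by
      rw [decide_eq_false_iff_not]
      intro hm
      rcases le_total b (d.partner b) with h | h
      · exact (hd.accessible b hm h a hlt).1 hx
      · have h' : d.partner b < b := lt_of_le_of_ne h fun he ↦ by
          exact (hd.accessible b hm he.ge a hlt).1 hx
        exact (hd.noncrossing (d.partner b) a (by omega) (by rwa [pb])).1 hx
    by_cases hy : d.partner b = b
    · -- two rays
      refine Diagram.capCupOp_weight_of_local hd hlt.ne l {a, b} (fun k ↦ ?_) _ ?_
      · rw [hx, hy, Finset.mem_insert, Finset.mem_singleton]; tauto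
      · simp only [Finset.prod_pair hlt.ne, jab, jba, Diagram.vertexWeight_ray hx,
          Diagram.vertexWeight_ray hy, sa, sb, mul_one, hmb]
        rw [localOp_ray_ray, if_pos (show d.partner a = a ∧ d.partner b = b from ⟨hx, hy⟩),
          Bool.xor_false]
    · -- a ray and a cup to the right
      have hby : b < d.partner b := by
        by_contra hn
        have h' : d.partner b < b := lt_of_le_of_ne (not_lt.1 hn) hy
        exact (hd.noncrossing (d.partner b) a (by omega) (by rwa [pb])).1 hx
      have hya : d.partner b ≠ a := hcirc'
      have jy : (d.join a b c).partner (d.partner b) = d.partner b := by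
        rw [Diagram.partner_join, if_neg hya, if_neg hy, if_neg hxy.symm, if_pos rfl, if_pos hx]
      refine Diagram.capCupOp_weight_of_local hd hlt.ne l {a, b, d.partner b} (fun k ↦ ?_) _ ?_
      · rw [hx]; simp only [Finset.mem_insert, Finset.mem_singleton]; tauto
      · have n1 : a ∉ ({b, d.partner b} : Finset (Fin m)) := by
          simp [hlt.ne, hya.symm]
        simp only [Finset.prod_insert n1, Finset.prod_pair hby.ne, jab, jba,
          Diagram.vertexWeight_ray hx, Diagram.vertexWeight_left rfl hby,
          Diagram.vertexWeight_right pb hby, Diagram.vertexWeight_ray jy, sa, sb, mul_one, one_mul,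
          hmb, so _ _ _ hya hy, mk _ hya hy (Or.inr rfl), Bool.xor_false]
        rw [localOp_ray_cup, if_neg (show ¬ (d.partner a = a ∧ d.partner b = b) from fun h ↦ hy h.2),
          one_mul]
  by_cases hy : d.partner b = b
  · -- a cup to the left and a ray
    have hxa : d.partner a < a := by
      have : ¬ b < d.partner a := fun h ↦ (hd.partner_lt_of_lt_partner hab h).2.2 hy
      omega
    have hxb : d.partner a ≠ b := hcirc
    have hcf := cfalse _ hxa
    have jx : (d.join a b c).partner (d.partner a) = d.partner a := by
      rw [Diagram.partner_join, if_neg hx, if_neg hxb, if_pos rfl, if_pos hy]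
    refine Diagram.capCupOp_weight_of_local hd hlt.ne l {d.partner a, a, b} (fun k ↦ ?_) _ ?_
    · rw [hy]; simp only [Finset.mem_insert, Finset.mem_singleton]; tauto
    · have n1 : d.partner a ∉ ({a, b} : Finset (Fin m)) := by
        simp [hx, hxb]
      simp only [Finset.prod_insert n1, Finset.prod_pair hlt.ne, jab, jba,
        Diagram.vertexWeight_ray hy, Diagram.vertexWeight_left pa hxa,
        Diagram.vertexWeight_right rfl hxa, Diagram.vertexWeight_ray jx, sa, sb, mul_one, one_mul,
        so _ _ _ hx hxb, mk _ hx hxb (Or.inl rfl), hd.partner_mem_marked_iff]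
      subst hcf
      rw [localOp_cup_ray, if_neg (show ¬ (d.partner a = a ∧ d.partner b = b) from fun h ↦ hx h.1),
        one_mul, Bool.xor_false, mul_comm]
  -- two cups
  rw [if_neg (fun h ↦ hx h.1), one_mul]
  have hxb : d.partner a ≠ b := hcirc
  have hya : d.partner b ≠ a := hcirc'
  have jx : (d.join a b c).partner (d.partner a) = d.partner b := by
    rw [Diagram.partner_join, if_neg hx, if_neg hxb, if_pos rfl, if_neg hy]
  have jy : (d.join a b c).partner (d.partner b) = d.partner a := by
    rw [Diagram.partner_join, if_neg hya, if_neg hy, if_neg hxy.symm, if_pos rfl, if_neg hx]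
  rw [← one_mul ((d.join a b c).weight l)]
  refine Diagram.capCupOp_weight_of_local hd hlt.ne l {d.partner a, d.partner b, a, b}
    (fun k ↦ ?_) _ ?_
  · simp only [Finset.mem_insert, Finset.mem_singleton]; tauto
  have n1 : d.partner a ∉ ({d.partner b, a, b} : Finset (Fin m)) := by simp [hx, hxb, hxy]
  have n2 : d.partner b ∉ ({a, b} : Finset (Fin m)) := by simp [hy, hya]
  simp only [Finset.prod_insert n1, Finset.prod_insert n2, Finset.prod_pair hlt.ne, jab, jba,
    mul_one, one_mul]
  rcases lt_or_gt_of_ne hx with hxa | hxa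
  · have hcf := cfalse _ hxa
    rcases lt_or_gt_of_ne hy with hyb | hyb
    · -- the cup at `a` is nested in the cup at `b`
      have hyx : d.partner b < d.partner a :=
        ((hd.noncrossing (d.partner b) a (by omega) (by rwa [pb])).2).1
      have hma : decide (a ∈ d.marked) = false := by
        rw [decide_eq_false_iff_not]
        exact hd.notMem_marked (i := d.partner b) (by omega) (by rwa [pb])
      simp only [Diagram.vertexWeight_left pa hxa, Diagram.vertexWeight_right rfl hxa,
        Diagram.vertexWeight_left pb hyb, Diagram.vertexWeight_right rfl hyb,
        Diagram.vertexWeight_left jy hyx, Diagram.vertexWeight_right jx hyx, sa, sb, mul_one,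
        one_mul, so _ _ _ hx hxb, so _ _ _ hya hy, mk _ hya hy (Or.inr rfl),
        hd.partner_mem_marked_iff, hma]
      subst hcf
      rw [localOp_nested_left, Bool.xor_false, Bool.false_xor, mul_comm]
    · -- two neighboured cups
      have hxy' : d.partner a < d.partner b := by omega
      simp only [Diagram.vertexWeight_left pa hxa, Diagram.vertexWeight_right rfl hxa,
        Diagram.vertexWeight_left rfl hyb, Diagram.vertexWeight_right pb hyb,
        Diagram.vertexWeight_left jx hxy', Diagram.vertexWeight_right jy hxy', sa, sb,
        one_mul, so _ _ _ hx hxb, so _ _ _ hya hy, mk _ hx hxb (Or.inl rfl),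
        hd.partner_mem_marked_iff]
      subst hcf
      rw [localOp_cup_cup, Bool.xor_false, mul_comm]
  · -- the cup at `b` is nested in the cup at `a`
    have hbx : b < d.partner a := by omega
    have h := hd.partner_lt_of_lt_partner hab hbx
    have hby : b < d.partner b := by omega
    have hmb : decide (b ∈ d.marked) = false := by
      rw [decide_eq_false_iff_not]
      exact hd.notMem_marked hlt hbx
    simp only [Diagram.vertexWeight_right pa hxa, Diagram.vertexWeight_left rfl hxa,
      Diagram.vertexWeight_left rfl hby, Diagram.vertexWeight_right pb hby,
      Diagram.vertexWeight_left jy h.2.1, Diagram.vertexWeight_right jx h.2.1, sa, sb,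
      one_mul, so _ _ _ hx hxb, so _ _ _ hya hy, mk _ hya hy (Or.inr rfl), hmb]
    rw [localOp_nested_right, Bool.xor_false, mul_comm]

end Weights

end CupHecke

namespace CupHecke

/-! ### Orientations, parity of the symbols ∧, and the added first symbol. -/

section Orientations

variable {m : ℕ}

theorem cupWeight_ne_zero {s t x : Bool} (h : cupWeight s t x ≠ 0) : t = !(s ^^ x) := by
  revert h
  cases s <;> cases t <;> cases x <;> simp [cupWeight]

theorem rayWeight_ne_zero {s x : Bool} (h : rayWeight s x ≠ 0) : s = x := by
  by_contra hn
  exact h (if_neg hn)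

theorem eq_iff_of_cupWeight_ne_zero {s t s' t' x : Bool} (h : cupWeight s t x ≠ 0)
    (h' : cupWeight s' t' x ≠ 0) : s = s' ↔ t = t' := by
  rw [cupWeight_ne_zero h, cupWeight_ne_zero h']
  cases s <;> cases s' <;> cases x <;> simp

theorem Diagram.vertexWeight_word (d : Diagram m) (hd : d.IsCupDiagram) (k : Fin m) :
    d.vertexWeight d.word k = 1 := by
  have hp := hd.partner_mem_marked_iff k
  have pp := hd.partner_partner k
  rcases lt_trichotomy k (d.partner k) with h | h | h
  · rw [Diagram.vertexWeight_left rfl h, cupWeight]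
    have h1 : d.word (d.partner k) = true := by
      rw [Diagram.word_eq_true, pp]; exact Or.inr h
    have h2 : d.word k = decide (k ∈ d.marked) := by simp [Diagram.word, h.le]
    rw [h1, h2]
    simp
  · rw [Diagram.vertexWeight_ray h.symm, rayWeight, if_pos]
    simp [Diagram.word, ← h]
  · rw [Diagram.vertexWeight_right rfl h]

theorem Diagram.weight_word (d : Diagram m) (hd : d.IsCupDiagram) : d.weight d.word = 1 :=
  Finset.prod_eq_one fun k _ ↦ d.vertexWeight_word hd k

/-- The weight of a word on a cup diagram is zero or a power of `-q⁻¹`, and it is not `1` unless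
the word is the word of the diagram. -/
theorem Diagram.weight_eq (d : Diagram m) (hd : d.IsCupDiagram) (l : Word m) :
    d.weight l = 0 ∨ ∃ j : ℕ, d.weight l = (-qInv) ^ j ∧ (j = 0 → l = d.word) := by
  by_cases h0 : ∃ k, d.vertexWeight l k = 0
  · obtain ⟨k, hk⟩ := h0
    exact Or.inl (Finset.prod_eq_zero (Finset.mem_univ k) hk)
  right
  push Not at h0
  let P : Fin m → Prop := fun k ↦ k < d.partner k ∧ l (d.partner k) = false
  have hP : ∀ k, d.vertexWeight l k = if P k then -qInv else 1 := by
    intro k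
    have h := h0 k
    rcases lt_trichotomy k (d.partner k) with hk | hk | hk
    · rw [Diagram.vertexWeight_left rfl hk, cupWeight] at h ⊢
      rw [if_neg fun he ↦ h (if_pos he)]
      by_cases hl : l (d.partner k) = true
      · rw [if_pos hl, if_neg fun h' ↦ absurd (h'.2.symm.trans hl) (by simp)]
      · rw [if_neg hl, if_pos ⟨hk, by simpa using hl⟩]
    · rw [Diagram.vertexWeight_ray hk.symm, rayWeight] at h ⊢
      have : ¬ P k := fun h ↦ h.1.ne hk
      rw [if_neg this]
      split_ifs at h ⊢ with h1
      · rfl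
      · exact absurd rfl h
    · rw [Diagram.vertexWeight_right rfl hk, if_neg]
      exact fun h ↦ h.1.not_gt hk
  refine ⟨(Finset.univ.filter P).card, ?_, fun hj ↦ ?_⟩
  · rw [Diagram.weight, Finset.prod_congr rfl (fun k _ ↦ hP k), Finset.prod_ite,
      Finset.prod_const, Finset.prod_const_one, mul_one]
  · rw [Finset.card_eq_zero, Finset.filter_eq_empty_iff] at hj
    have hright : ∀ k, k < d.partner k → l (d.partner k) = true := fun k hk ↦ by
      by_contra hn
      exact hj (Finset.mem_univ k) ⟨hk, by simpa using hn⟩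
    funext k
    rcases lt_trichotomy k (d.partner k) with hk | hk | hk
    · have h := h0 k
      rw [Diagram.vertexWeight_left rfl hk, cupWeight, hright k hk] at h
      by_cases hm : k ∈ d.marked <;> simp_all [Diagram.word, hk.le]
    · have h := h0 k
      rw [Diagram.vertexWeight_ray hk.symm, rayWeight] at h
      by_cases hm : k ∈ d.marked <;> simp_all [Diagram.word, ← hk]
    · have := hright (d.partner k) (by rwa [hd.partner_partner])
      rw [hd.partner_partner] at this
      rw [this, eq_comm, Diagram.word_eq_true]
      exact Or.inr hk

/-- The sign `±1` of the number of symbols `∧`. -/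
def Word.sign (l : Word m) : ℤ := ∏ k, if l k = true then -1 else 1

theorem prod_ite_neg_one (P : Fin m → Prop) [DecidablePred P] :
    (∏ k, if P k then (-1 : ℤ) else 1) = (-1) ^ (Finset.univ.filter P).card := by
  rw [Finset.prod_ite, Finset.prod_const, Finset.prod_const_one, mul_one]

theorem Word.sign_mul_self (l : Word m) : l.sign * l.sign = 1 := by
  rw [Word.sign, prod_ite_neg_one, ← mul_pow]
  norm_num

/-- Two orientations of a cup agree or differ at both ends, and on a ray they agree. The signs thus
cancel in pairs under `d.partner`. -/
theorem Diagram.sign_eq_of_weight_ne_zero (d : Diagram m) (hd : d.IsCupDiagram) {l : Word m}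
    (h : d.weight l ≠ 0) : l.sign = Word.sign d.word := by
  have h0 : ∀ k, d.vertexWeight l k ≠ 0 := fun k hk ↦
    h (Finset.prod_eq_zero (Finset.mem_univ k) hk)
  have hw : ∀ k, d.vertexWeight d.word k ≠ 0 := fun k ↦ by
    rw [d.vertexWeight_word hd]
    exact one_ne_zero
  have key : ∀ k, (l k = d.word k ↔ l (d.partner k) = d.word (d.partner k)) ∧
      (d.partner k = k → l k = d.word k) := by
    have left : ∀ k, k < d.partner k →
        (l k = d.word k ↔ l (d.partner k) = d.word (d.partner k)) := by
      intro k hk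
      have h1 := h0 k
      have h2 := hw k
      rw [Diagram.vertexWeight_left rfl hk] at h1 h2
      exact eq_iff_of_cupWeight_ne_zero h1 h2
    intro k
    rcases lt_trichotomy k (d.partner k) with hk | hk | hk
    · exact ⟨left k hk, fun h ↦ absurd h hk.ne'⟩
    · refine ⟨by rw [← hk], fun _ ↦ ?_⟩
      have h1 := h0 k
      have h2 := hw k
      rw [Diagram.vertexWeight_ray hk.symm] at h1 h2
      rw [rayWeight_ne_zero h1, rayWeight_ne_zero h2]
    · have := left (d.partner k) (by rwa [hd.partner_partner])
      rw [hd.partner_partner] at this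
      exact ⟨this.symm, fun h ↦ absurd h hk.ne⟩
  have hprod : l.sign * Word.sign d.word = 1 := by
    rw [Word.sign, Word.sign, ← Finset.prod_mul_distrib]
    have e : ∀ k, ((if l k = true then (-1 : ℤ) else 1) * if d.word k = true then -1 else 1) =
        if l k = d.word k then 1 else -1 := fun k ↦ by
      cases l k <;> cases d.word k <;> simp
    simp only [e]
    refine Finset.prod_involution (fun k _ ↦ d.partner k) (fun k _ ↦ ?_) (fun k _ hk he ↦ ?_)
      (fun k _ ↦ Finset.mem_univ _) (fun k _ ↦ hd.partner_partner k)
    · simp only [(key k).1]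
      split_ifs <;> simp
    · rw [if_pos ((key k).2 he)] at hk
      exact hk rfl
  calc l.sign = l.sign * (Word.sign d.word * Word.sign d.word) := by
        rw [Word.sign_mul_self, mul_one]
    _ = Word.sign d.word := by rw [← mul_assoc, hprod, one_mul]

/-- In the word of d an unmarked cup contributes one ∧, a marked cup two, and a ray one exactly when
it is marked. -/
theorem Diagram.even_iff_sign_word (d : Diagram m) (hd : d.IsCupDiagram) :
    Even (d.markedRays + d.unmarkedCups) ↔ Word.sign d.word = 1 := by
  have h : Word.sign d.word * ((-1) ^ d.markedRays * (-1) ^ d.unmarkedCups) = 1 := by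
    rw [Word.sign, Diagram.markedRays, Diagram.unmarkedCups, ← prod_ite_neg_one,
      ← prod_ite_neg_one, ← Finset.prod_mul_distrib, ← Finset.prod_mul_distrib]
    refine Finset.prod_involution (fun k _ ↦ d.partner k) (fun k _ ↦ ?_) (fun k _ hk he ↦ ?_)
      (fun k _ ↦ Finset.mem_univ _) (fun k _ ↦ hd.partner_partner k)
    · have hp := hd.partner_mem_marked_iff k
      have pp := hd.partner_partner k
      simp only [Diagram.word_eq_true, pp, hp]
      rcases lt_trichotomy k (d.partner k) with hk | hk | hk
      · by_cases hm : k ∈ d.marked <;> simp [hm, hk, hk.ne, hk.ne', hk.not_gt]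
      · by_cases hm : k ∈ d.marked <;> simp [hm, ← hk]
      · by_cases hm : k ∈ d.marked <;> simp [hm, hk, hk.ne, hk.ne', hk.not_gt]
    · refine hk ?_
      simp only [Diagram.word_eq_true, he]
      by_cases hm : k ∈ d.marked <;> simp [hm]
  rw [← pow_add] at h
  rcases Nat.even_or_odd (d.markedRays + d.unmarkedCups) with he | ho
  · rw [he.neg_one_pow, mul_one] at h
    exact ⟨fun _ ↦ h, fun _ ↦ he⟩
  · rw [ho.neg_one_pow] at h
    refine ⟨fun he ↦ absurd he (Nat.not_even_iff_odd.2 ho), fun h1 ↦ ?_⟩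
    rw [h1] at h
    norm_num at h

theorem sign_flipAt {a b : Fin m} (hab : a ≠ b) (l : Word m) :
    Word.sign (flipAt a b l) = l.sign := by
  have : Word.sign (flipAt a b l) * l.sign = 1 := by
    rw [Word.sign, Word.sign, ← Finset.prod_mul_distrib]
    have e : ∀ k, ((if flipAt a b l k = true then (-1 : ℤ) else 1) * if l k = true then -1 else 1) =
        (if k = a then -1 else 1) * if k = b then -1 else 1 := fun k ↦ by
      simp only [flipAt]
      have hk : ¬ (k = a ∧ k = b) := fun h ↦ hab (h.1.symm.trans h.2)
      by_cases h1 : k = a <;> by_cases h2 : k = b <;>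
        rcases Bool.eq_false_or_eq_true (l k) with h | h <;> simp_all
    simp only [e]
    rw [Finset.prod_mul_distrib]
    simp
  calc Word.sign (flipAt a b l) = Word.sign (flipAt a b l) * (l.sign * l.sign) := by
        rw [Word.sign_mul_self, mul_one]
    _ = l.sign := by rw [← mul_assoc, this, one_mul]

theorem sign_dagger {n : ℕ} (l : Word n) : Word.sign (dagger l) = 1 := by
  rw [Word.sign, Fin.prod_univ_succ]
  simp only [dagger, Fin.cons_zero, Fin.cons_succ]
  rw [prod_ite_neg_one]
  rcases Nat.even_or_odd (Finset.univ.filter fun k ↦ l k = true).card with h | h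
  · rw [h.neg_one_pow]
    simp [h]
  · rw [h.neg_one_pow]
    simp [h]

theorem dagger_succ {n : ℕ} (l : Word n) (k : Fin n) : dagger l k.succ = l k := by
  simp [dagger]

theorem eq_of_sign_eq {n : ℕ} {l l' : Word (n + 1)} (h : l.sign = l'.sign)
    (hs : ∀ k : Fin n, l k.succ = l' k.succ) : l = l' := by
  rw [Word.sign, Word.sign, Fin.prod_univ_succ, Fin.prod_univ_succ] at h
  simp only [hs] at h
  have hne : (∏ k : Fin n, if l' k.succ = true then (-1 : ℤ) else 1) ≠ 0 := by
    rw [prod_ite_neg_one]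
    exact pow_ne_zero _ (by norm_num)
  have h0 := mul_right_cancel₀ hne h
  refine funext fun k ↦ Fin.cases ?_ hs k
  revert h0
  cases l 0 <;> cases l' 0 <;> simp

theorem dagger_tail {n : ℕ} {l : Word (n + 1)} (h : l.sign = 1) :
    dagger (fun k : Fin n ↦ l k.succ) = l :=
  eq_of_sign_eq (by rw [sign_dagger, h]) fun k ↦ dagger_succ _ k

theorem dagger_injective {n : ℕ} {l l' : Word n} (h : dagger l = dagger l') : l = l' := by
  funext k
  rw [← dagger_succ l, h, dagger_succ]

theorem dagger_castSucc {n : ℕ} (l : Word n) {i : Fin n} (hi : i.val ≠ 0) :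
    dagger l i.castSucc = l ⟨i.val - 1, by omega⟩ := by
  rw [← dagger_succ l]
  congr 1
  exact Fin.ext (by simp; omega)

/-- Exchanging two different symbols changes both of them. For i = 0, changing the first symbol also
changes the added parity symbol. So all moves have the same form on l†. -/
theorem dagger_simpleOnWord {n : ℕ} {i : Fin n} {l : Word n} (h : simpleOnWord i l ≠ l) :
    dagger (simpleOnWord i l) = flipAt i.castSucc i.succ (dagger l) := by
  have hne : i.castSucc ≠ i.succ := by
    rw [Ne, Fin.ext_iff]; simp
  refine eq_of_sign_eq (by rw [sign_flipAt hne, sign_dagger, sign_dagger]) fun k ↦ ?_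
  rw [dagger_succ, flipAt, simpleOnWord_apply, dagger_succ]
  have e1 : k.succ = i.castSucc ↔ k.val + 1 = i.val := by rw [Fin.ext_iff]; simp
  have e2 : k.succ = i.succ ↔ k = i := Fin.succ_inj
  simp only [e1, e2]
  by_cases h0 : i.val = 0
  · rw [if_pos h0]
    by_cases hk : k = i
    · simp [hk]
    · have : ¬ k.val + 1 = i.val := by omega
      simp [hk, this]
  · rw [if_neg h0]
    have hl : l ⟨i.val - 1, by omega⟩ = !(l i) := by
      by_contra hn
      refine h ?_
      funext k
      rw [simpleOnWord_apply, if_neg h0]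
      have he : l ⟨i.val - 1, by omega⟩ = l i := by
        revert hn
        cases l ⟨i.val - 1, by omega⟩ <;> cases l i <;> simp
      split_ifs with h1 h2
      · rw [h1, he]
      · rw [← he]
        congr 1
        exact Fin.ext (by simp; omega)
      · rfl
    by_cases hk : k = i
    · simp [hk, hl]
    · by_cases hk' : k.val + 1 = i.val
      · have : k = ⟨i.val - 1, by omega⟩ := Fin.ext (by simp; omega)
        rw [if_neg hk, if_pos hk', if_pos (Or.inl hk'), this, hl, Bool.not_not]
      · simp [hk, hk']

theorem simpleOnWord_eq_self_iff_dagger {n : ℕ} {i : Fin n} (hi : i.val ≠ 0) (l : Word n) :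
    simpleOnWord i l = l ↔ dagger l i.castSucc = dagger l i.succ := by
  rw [dagger_castSucc l hi, dagger_succ]
  constructor
  · intro h
    have h1 := congrFun h i
    rw [simpleOnWord_apply, if_neg hi, if_pos rfl] at h1
    exact h1
  · intro h
    funext k
    rw [simpleOnWord_apply, if_neg hi]
    split_ifs with h1 h2
    · rw [h1, h]
    · rw [← h]
      congr 1
      exact Fin.ext (by simp; omega)
    · rfl

end Orientations

end CupHecke

namespace CupHecke

/-! ### Components of a cap-cup stacked on a diagram. -/

section StackCapCup

variable {n : ℕ} (i : Fin n) (c : Bool) (d : Diagram (n + 1))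

theorem castSucc_ne_succ : i.castSucc ≠ i.succ := by
  rw [Ne, Fin.ext_iff]; simp

theorem comp_partner {m : ℕ} (t : Tangle m) (d : Diagram m) (x : Fin m ⊕ Fin m) :
    comp t d (t.partner x) = comp t d x :=
  (Quotient.sound (show stackSetoid t d _ _ from Relation.EqvGen.rel _ _ (Or.inl rfl))).symm

theorem comp_inr_partner {m : ℕ} (t : Tangle m) (d : Diagram m) (k : Fin m) :
    comp t d (Sum.inr (d.partner k)) = comp t d (Sum.inr k) :=
  (Quotient.sound (show stackSetoid t d _ _ from
    Relation.EqvGen.rel _ _ (Or.inr ⟨k, rfl, rfl⟩))).symm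

/-- The vertices of `d` on the same component as the cap, when the cap at `a` and `b` is put on top
of `d`. -/
def Diagram.capSupport {m : ℕ} (d : Diagram m) (a b : Fin m) : Finset (Fin m) :=
  {a, b, d.partner a, d.partner b}

theorem Diagram.mem_capSupport {m : ℕ} {d : Diagram m} {a b k : Fin m} :
    k ∈ d.capSupport a b ↔ k = a ∨ k = b ∨ k = d.partner a ∨ k = d.partner b := by
  simp [Diagram.capSupport]

theorem comp_inl_succ : comp (capCup i c) d (Sum.inl i.succ) =
    comp (capCup i c) d (Sum.inl i.castSucc) := by
  rw [← comp_partner _ _ (Sum.inl i.castSucc)]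
  simp [capCup]

theorem comp_inr_succ : comp (capCup i c) d (Sum.inr i.succ) =
    comp (capCup i c) d (Sum.inr i.castSucc) := by
  rw [← comp_partner _ _ (Sum.inr i.castSucc)]
  simp [capCup]

variable {i} in
theorem comp_inl_of_ne {k : Fin (n + 1)} (ha : k ≠ i.castSucc) (hb : k ≠ i.succ) :
    comp (capCup i c) d (Sum.inl k) = comp (capCup i c) d (Sum.inr k) := by
  rw [← comp_partner _ _ (Sum.inl k)]
  simp [capCup, ha, hb]

/-- A function which separates the components of the stacked picture. -/
def componentLabel : Fin (n + 1) ⊕ Fin (n + 1) → Option (Fin (n + 1))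
  | Sum.inl k => if k = i.castSucc ∨ k = i.succ then none else
      some (if k ∈ d.capSupport i.castSucc i.succ then i.castSucc else min k (d.partner k))
  | Sum.inr k =>
      some (if k ∈ d.capSupport i.castSucc i.succ then i.castSucc else min k (d.partner k))

variable {d}

theorem partner_mem_capSupport {m : ℕ} {d : Diagram m} (hp : ∀ k, d.partner (d.partner k) = k)
    {a b k : Fin m} : d.partner k ∈ d.capSupport a b ↔ k ∈ d.capSupport a b := by
  have h1 := hp k
  have h2 := hp a
  have h3 := hp b
  simp only [Diagram.mem_capSupport]
  grind

/-- The label is invariant along every generating link. It is `none` on the new cup, `i.castSucc` on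
the component of the cap, and the left end of the strand elsewhere. -/
theorem componentLabel_eq (hp : ∀ k, d.partner (d.partner k) = k)
    {x y : Fin (n + 1) ⊕ Fin (n + 1)} (h : comp (capCup i c) d x = comp (capCup i c) d y) :
    componentLabel i d x = componentLabel i d y := by
  have h' : Relation.EqvGen _ x y := Quotient.exact h
  clear h
  induction h' with
  | rel x y h =>
    rcases h with rfl | ⟨k, rfl, rfl⟩
    · rcases x with k | k
      · simp only [capCup]
        split_ifs with h1 h2 <;> simp [componentLabel, *]
      · simp only [capCup]
        split_ifs with h1 h2 <;> simp [componentLabel, Diagram.mem_capSupport, *]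
    · simp only [componentLabel, partner_mem_capSupport hp, hp, min_comm]
  | refl x => rfl
  | symm x y _ ih => exact ih.symm
  | trans x y z _ _ ih1 ih2 => exact ih1.trans ih2

theorem comp_inr_of_mem_capSupport {k : Fin (n + 1)}
    (h : k ∈ d.capSupport i.castSucc i.succ) :
    comp (capCup i c) d (Sum.inr k) = comp (capCup i c) d (Sum.inr i.castSucc) := by
  rcases Diagram.mem_capSupport.1 h with rfl | rfl | rfl | rfl
  · rfl
  · exact comp_inr_succ i c d
  · exact comp_inr_partner _ _ _
  · rw [comp_inr_partner]
    exact comp_inr_succ i c d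

theorem comp_inr_eq_iff (hp : ∀ k, d.partner (d.partner k) = k) {k k' : Fin (n + 1)} :
    comp (capCup i c) d (Sum.inr k) = comp (capCup i c) d (Sum.inr k') ↔
      k = k' ∨ k = d.partner k' ∨
        (k ∈ d.capSupport i.castSucc i.succ ∧ k' ∈ d.capSupport i.castSucc i.succ) := by
  constructor
  · intro h
    have h' := componentLabel_eq i c hp h
    simp only [componentLabel, Option.some.injEq] at h'
    have e1 := hp k
    have e2 := hp k'
    have m1 := partner_mem_capSupport hp (a := i.castSucc) (b := i.succ) (k := k)
    have m2 := partner_mem_capSupport hp (a := i.castSucc) (b := i.succ) (k := k')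
    have m0 : i.castSucc ∈ d.capSupport i.castSucc i.succ := Diagram.mem_capSupport.2 (Or.inl rfl)
    -- A strand outside the support cannot have the label `i.castSucc`, as that vertex is in the
    -- support, which is closed under `d.partner`.
    rcases min_choice k (d.partner k) with h1 | h1 <;>
      rcases min_choice k' (d.partner k') with h2 | h2 <;> rw [h1, h2] at h' <;> grind
  · rintro (rfl | rfl | ⟨h1, h2⟩)
    · rfl
    · exact comp_inr_partner _ _ _
    · rw [comp_inr_of_mem_capSupport i c h1, comp_inr_of_mem_capSupport i c h2]

theorem comp_inr_ne_comp_cup (hp : ∀ k, d.partner (d.partner k) = k) (k : Fin (n + 1)) :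
    comp (capCup i c) d (Sum.inr k) ≠ comp (capCup i c) d (Sum.inl i.castSucc) := by
  intro h
  have h' := componentLabel_eq i c hp h
  simp [componentLabel] at h'

theorem partner_join_eq_iff (hp : ∀ k, d.partner (d.partner k) = k) {k k' : Fin (n + 1)}
    (hk : k' ≠ k) :
    comp (capCup i c) d (Sum.inl k') = comp (capCup i c) d (Sum.inl k) ↔
      (d.join i.castSucc i.succ c).partner k = k' := by
  have hab := castSucc_ne_succ i
  rw [Diagram.partner_join]
  have hb := comp_inl_succ i c d
  have hne := comp_inr_ne_comp_cup i c hp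
  by_cases h1 : k = i.castSucc
  · rw [if_pos h1, h1]
    by_cases h2 : k' = i.succ
    · simp [h2, hb]
    · rw [comp_inl_of_ne c d (h1 ▸ hk) h2]
      simp [hne k', Ne.symm h2]
  rw [if_neg h1]
  by_cases h2 : k = i.succ
  · rw [if_pos h2, h2, hb]
    by_cases h3 : k' = i.castSucc
    · simp [h3]
    · rw [comp_inl_of_ne c d h3 (h2 ▸ hk)]
      simp [hne k', Ne.symm h3]
  rw [if_neg h2, comp_inl_of_ne c d h1 h2]
  have e1 := hp k
  have e2 := hp k'
  have e3 := hp i.castSucc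
  have e4 := hp i.succ
  by_cases h3 : k' = i.castSucc
  · rw [h3]
    simp only [(hne k).symm, false_iff]
    grind
  by_cases h4 : k' = i.succ
  · rw [h4, hb]
    simp only [(hne k).symm, false_iff]
    grind
  rw [comp_inl_of_ne c d h3 h4, comp_inr_eq_iff i c hp]
  simp only [Diagram.mem_capSupport]
  grind

theorem reduced_partner (hp : ∀ k, d.partner (d.partner k) = k) (k : Fin (n + 1)) :
    (reduced (capCup i c) d).partner k = (d.join i.castSucc i.succ c).partner k := by
  simp only [reduced]
  split_ifs with h
  · exact ((partner_join_eq_iff i c hp h.choose_spec.1).1 h.choose_spec.2).symm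
  · by_contra hne
    exact h ⟨_, Ne.symm hne, (partner_join_eq_iff i c hp (Ne.symm hne)).2 rfl⟩

theorem card_markedArcs_capCup (P : Fin (n + 1) ⊕ Fin (n + 1) → Prop) [DecidablePred P]
    (h1 : P (Sum.inl i.succ) ↔ P (Sum.inl i.castSucc))
    (h2 : P (Sum.inr i.succ) ↔ P (Sum.inr i.castSucc)) :
    ((capCup i c).markedArcs.filter fun e ↦ ∀ x ∈ e, P x).card =
      if c = true then (if P (Sum.inl i.castSucc) then 1 else 0) +
        (if P (Sum.inr i.castSucc) then 1 else 0) else 0 := by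
  have hne := castSucc_ne_succ i
  cases c with
  | false => simp [Tangle.markedArcs, capCup]
  | true =>
    have e : (capCup i true).markedArcs = {s(Sum.inl i.castSucc, Sum.inl i.succ),
        s(Sum.inr i.castSucc, Sum.inr i.succ)} := by
      simp [Tangle.markedArcs, capCup, hne.symm, Finset.image_insert, Sym2.eq_swap]
    rw [e, Finset.filter_insert, Finset.filter_singleton]
    simp only [Sym2.ball, h1, h2, and_self]
    split_ifs <;> simp_all

/-- Markers belong to arcs, not to vertices. It is enough that S meets each marked arc of the
component, because passing to unordered pairs merges the two ends of a cup. -/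
theorem card_markedArcs_eq {m : ℕ} {t : Tangle m} {d : Diagram m} (X : Component t d)
    (S : Finset (Fin m)) (hS : ∀ k ∈ d.marked, comp t d (Sum.inr k) = X →
      k ∈ S ∨ d.partner k ∈ S) (hp : ∀ k, d.partner (d.partner k) = k)
    (hX : ∀ k ∈ S, comp t d (Sum.inr k) = X) (hm : ∀ k ∈ d.marked, d.partner k ∈ d.marked)
    [DecidablePred fun e : Sym2 (Fin m) ↦ ∀ k ∈ e, comp t d (Sum.inr k) = X] :
    (d.markedArcs.filter fun e ↦ ∀ k ∈ e, comp t d (Sum.inr k) = X).card =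
      ((S.filter (· ∈ d.marked)).image fun k ↦ s(k, d.partner k)).card := by
  congr 1
  ext e
  simp only [Diagram.markedArcs, Finset.mem_filter, Finset.mem_image]
  constructor
  · rintro ⟨⟨k, hk, rfl⟩, h⟩
    rcases hS k hk (h k (Sym2.mem_mk_left _ _)) with hs | hs
    · exact ⟨k, ⟨hs, hk⟩, rfl⟩
    · exact ⟨d.partner k, ⟨hs, hm k hk⟩, by rw [hp, Sym2.eq_swap]⟩
  · rintro ⟨k, ⟨hs, hk⟩, rfl⟩
    refine ⟨⟨k, hk, rfl⟩, fun x hx ↦ ?_⟩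
    rcases Sym2.mem_iff.1 hx with rfl | rfl
    · exact hX _ hs
    · rw [comp_inr_partner]
      exact hX _ hs

theorem markers_cup (hp : ∀ k, d.partner (d.partner k) = k)
    (hm : ∀ k ∈ d.marked, d.partner k ∈ d.marked) :
    markers (capCup i c) d (comp (capCup i c) d (Sum.inl i.castSucc)) =
      if c = true then 1 else 0 := by
  classical
  have hne := comp_inr_ne_comp_cup i c hp
  rw [markers, card_markedArcs_capCup i c (fun x ↦ comp (capCup i c) d x = _)
    (by rw [comp_inl_succ]) (by rw [comp_inr_succ]),
    card_markedArcs_eq _ ∅ (fun k _ h ↦ absurd h (hne k)) hp (by simp) hm]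
  simp [hne]

theorem markers_of_notMem (hp : ∀ k, d.partner (d.partner k) = k)
    (hm : ∀ k ∈ d.marked, d.partner k ∈ d.marked) {k : Fin (n + 1)}
    (hk : k ∉ d.capSupport i.castSucc i.succ) :
    markers (capCup i c) d (comp (capCup i c) d (Sum.inr k)) = if k ∈ d.marked then 1 else 0 := by
  classical
  have hne := comp_inr_ne_comp_cup i c hp
  have h0 : comp (capCup i c) d (Sum.inr i.castSucc) ≠ comp (capCup i c) d (Sum.inr k) := by
    rw [Ne, comp_inr_eq_iff i c hp]
    have e := hp k
    simp only [Diagram.mem_capSupport] at hk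
    simp only [Diagram.mem_capSupport]
    grind
  rw [markers, card_markedArcs_capCup i c (fun x ↦ comp (capCup i c) d x = _)
    (by rw [comp_inl_succ]) (by rw [comp_inr_succ]),
    card_markedArcs_eq _ {k} (fun k' _ h ↦ ?_) hp (by simp) hm]
  · rw [if_neg (hne k).symm, if_neg h0, Finset.filter_singleton]
    split_ifs <;> simp
  · rw [comp_inr_eq_iff i c hp] at h
    simp only [Finset.mem_singleton]
    have e := hp k
    grind

/-- If the two vertices are joined by a cup of d, its marker must be counted only once, whence the
inner `if`. -/
theorem odd_markers_cap (hp : ∀ k, d.partner (d.partner k) = k)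
    (hm : ∀ k ∈ d.marked, d.partner k ∈ d.marked) :
    Odd (markers (capCup i c) d (comp (capCup i c) d (Sum.inr i.castSucc))) ↔
      (decide (i.castSucc ∈ d.marked) ^^
        (if d.partner i.castSucc = i.succ then false else decide (i.succ ∈ d.marked)) ^^ c)
          = true := by
  classical
  have hab := castSucc_ne_succ i
  have hne := comp_inr_ne_comp_cup i c hp
  rw [markers, card_markedArcs_capCup i c (fun x ↦ comp (capCup i c) d x = _)
    (by rw [comp_inl_succ]) (by rw [comp_inr_succ]),
    card_markedArcs_eq _ {i.castSucc, i.succ} (fun k' _ h ↦ ?_) hp ?_ hm]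
  · rw [if_neg (hne _).symm, if_pos rfl, Finset.filter_insert, Finset.filter_singleton]
    by_cases hx : d.partner i.castSucc = i.succ
    · have hy : d.partner i.succ = i.castSucc := by rw [← hx, hp]
      have hmm : i.succ ∈ d.marked ↔ i.castSucc ∈ d.marked :=
        ⟨fun h ↦ hy ▸ hm _ h, fun h ↦ hx ▸ hm _ h⟩
      rw [if_pos hx]
      by_cases h1 : i.castSucc ∈ d.marked
      · cases c <;> simp [hmm, h1, Finset.image_insert, hx, hy, Sym2.eq_swap]
      · cases c <;> simp [hmm, h1]
    · rw [if_neg hx]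
      have hs : s(i.castSucc, d.partner i.castSucc) ≠ s(i.succ, d.partner i.succ) := by
        intro h
        rw [Sym2.eq_iff] at h
        rcases h with h | h
        · exact hab h.1
        · exact hx h.2
      by_cases h1 : i.castSucc ∈ d.marked <;> by_cases h2 : i.succ ∈ d.marked <;> cases c <;>
        simp [h1, h2, Finset.image_insert, Finset.card_pair hs, Nat.odd_iff]
  · intro k hk
    simp only [Finset.mem_insert, Finset.mem_singleton] at hk
    rcases hk with rfl | rfl
    · rfl
    · exact comp_inr_succ i c d
  · rw [comp_inr_eq_iff i c hp] at h
    have e := hp i.castSucc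
    have e' := hp i.succ
    simp only [Diagram.mem_capSupport] at h
    simp only [Finset.mem_insert, Finset.mem_singleton]
    grind

theorem reduced_eq_join (hp : ∀ k, d.partner (d.partner k) = k)
    (hm : ∀ k ∈ d.marked, d.partner k ∈ d.marked) :
    reduced (capCup i c) d = d.join i.castSucc i.succ c := by
  refine Diagram.ext (funext (reduced_partner i c hp)) (Finset.ext fun k ↦ ?_)
  have hab := castSucc_ne_succ i
  rw [Diagram.mem_marked_join, reduced, Finset.mem_filter]
  simp only [Finset.mem_univ, true_and]
  have hcup : Odd (markers (capCup i c) d (comp (capCup i c) d (Sum.inl i.castSucc))) ↔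
      c = true := by
    rw [markers_cup i c hp hm]
    split_ifs with h <;> simp [h]
  by_cases h1 : k = i.castSucc
  · rw [if_pos (Or.inl h1), h1, hcup]
  by_cases h2 : k = i.succ
  · rw [if_pos (Or.inr h2), h2, comp_inl_succ, hcup]
  rw [if_neg (by tauto), comp_inl_of_ne c d h1 h2]
  by_cases h3 : k = d.partner i.castSucc ∨ k = d.partner i.succ
  · have hk : k ∈ d.capSupport i.castSucc i.succ := by
      rw [Diagram.mem_capSupport]
      tauto
    have hx : d.partner i.castSucc ≠ i.succ := by
      have := hp i.castSucc
      grind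
    rw [if_pos h3, comp_inr_of_mem_capSupport i c hk, odd_markers_cap i c hp hm, if_neg hx,
      Bool.xor_assoc]
  · have hk : k ∉ d.capSupport i.castSucc i.succ := by
      rw [Diagram.mem_capSupport]
      tauto
    rw [if_neg h3, markers_of_notMem i c hp hm hk]
    split_ifs with h <;> simp [h]

/-- The component of the cap is a circle if a cup of d closes it. Otherwise it lacks an upper end
exactly when both strands are rays. -/
theorem weight_cap (hp : ∀ k, d.partner (d.partner k) = k)
    (hm : ∀ k ∈ d.marked, d.partner k ∈ d.marked) :
    weight (capCup i c) d (comp (capCup i c) d (Sum.inr i.castSucc)) =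
      d.joinScalar i.castSucc i.succ c := by
  have hab := castSucc_ne_succ i
  have hx := hp i.castSucc
  have hy := hp i.succ
  have hup : HasUpperEnd (capCup i c) d (comp (capCup i c) d (Sum.inr i.castSucc)) ↔
      ∃ k ∈ d.capSupport i.castSucc i.succ, k ≠ i.castSucc ∧ k ≠ i.succ := by
    constructor
    · rintro ⟨k, hk⟩
      have h1 : k ≠ i.castSucc := by
        rintro rfl
        exact comp_inr_ne_comp_cup i c hp _ hk.symm
      have h2 : k ≠ i.succ := by
        rintro rfl
        rw [comp_inl_succ] at hk
        exact comp_inr_ne_comp_cup i c hp _ hk.symm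
      rw [comp_inl_of_ne c d h1 h2, comp_inr_eq_iff i c hp] at hk
      refine ⟨k, ?_, h1, h2⟩
      rw [Diagram.mem_capSupport] at hk ⊢
      tauto
    · rintro ⟨k, hk, h1, h2⟩
      exact ⟨k, by rw [comp_inl_of_ne c d h1 h2, comp_inr_of_mem_capSupport i c hk]⟩
  have hlow : HasLowerEnd (capCup i c) d (comp (capCup i c) d (Sum.inr i.castSucc)) ↔
      ∃ k ∈ d.capSupport i.castSucc i.succ, d.partner k = k := by
    constructor
    · rintro ⟨k, hk, h⟩
      rw [comp_inr_eq_iff i c hp] at h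
      refine ⟨k, ?_, hk⟩
      rw [Diagram.mem_capSupport] at h ⊢
      tauto
    · rintro ⟨k, hk, h⟩
      exact ⟨k, h, comp_inr_of_mem_capSupport i c hk⟩
  simp only [Diagram.mem_capSupport] at hup hlow
  rw [weight, Diagram.joinScalar]
  by_cases h1 : d.partner i.castSucc = i.succ
  · rw [if_pos h1, if_neg (by rw [hup]; grind), if_neg (by rw [hlow]; grind)]
    simp only [odd_markers_cap i c hp hm, if_pos h1]
    by_cases h : i.castSucc ∈ d.marked <;> cases c <;> simp [h]
  rw [if_neg h1]
  by_cases h2 : d.partner i.castSucc = i.castSucc ∧ d.partner i.succ = i.succ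
  · rw [if_pos h2, if_neg (by rw [hup]; grind), if_pos (by rw [hlow]; grind)]
    simp only [odd_markers_cap i c hp hm, if_neg h1, Bool.xor_assoc]
  · rw [if_neg h2, if_pos]
    rw [hup]
    by_cases h3 : d.partner i.castSucc = i.castSucc
    · exact ⟨d.partner i.succ, by grind⟩
    · exact ⟨d.partner i.castSucc, by grind⟩

/-- Every component other than that of the cap has an upper end and hence weight 1, so the product
reduces to one factor. -/
theorem stack_capCup (hp : ∀ k, d.partner (d.partner k) = k)
    (hm : ∀ k ∈ d.marked, d.partner k ∈ d.marked) :
    stack (capCup i c) d =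
      Finsupp.single (d.join i.castSucc i.succ c) (d.joinScalar i.castSucc i.succ c) := by
  rw [stack, reduced_eq_join i c hp hm]
  congr 1
  rw [Finset.prod_eq_single (comp (capCup i c) d (Sum.inr i.castSucc)), weight_cap i c hp hm]
  · intro X _ hX
    rw [weight, if_pos]
    obtain ⟨x, rfl⟩ : ∃ x, comp (capCup i c) d x = X := Quotient.exists_rep X
    rcases x with k | k
    · exact ⟨k, rfl⟩
    · have h1 : k ≠ i.castSucc := fun h ↦ hX (by rw [h])
      have h2 : k ≠ i.succ := fun h ↦ hX (by rw [h, comp_inr_succ])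
      exact ⟨k, comp_inl_of_ne c d h1 h2⟩
  · intro h
    exact absurd (@Finset.mem_univ _ (_) _) h

end StackCapCup

end CupHecke

namespace CupHecke

/-! ### The free module on cup diagrams and its expansion into words. -/

section CupModule

variable {n : ℕ}

/-- The word of a diagram in `C_KL` without its first symbol. -/
def CKL.word (a : CKL (n + 1)) : Word n := fun k ↦ a.1.word k.succ

theorem CKL.dagger_word (a : CKL (n + 1)) : dagger a.word = a.1.word :=
  dagger_tail ((a.1.even_iff_sign_word a.2.1).1 a.2.2)

theorem CKL.word_injective : Function.Injective (CKL.word (n := n)) := fun a b h ↦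
  Subtype.ext (a.2.1.eq_of_word_eq b.2.1 (by rw [← a.dagger_word, ← b.dagger_word, h]))

instance : Finite (CKL (n + 1)) := Finite.of_injective _ CKL.word_injective

/-- The expansion of a cup diagram into words. -/
noncomputable def CKL.vec (a : CKL (n + 1)) : Word n → Laurent := fun l ↦ a.1.weight (dagger l)

theorem CKL.vec_word (a : CKL (n + 1)) : a.vec a.word = 1 := by
  rw [CKL.vec, CKL.dagger_word, Diagram.weight_word _ a.2.1]

/-- An orientation other than the word of a has at least one clockwise cup, which supplies the
factor q⁻¹. -/
theorem CKL.exists_vec_eq (a : CKL (n + 1)) {l : Word n} (h : l ≠ a.word) :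
    ∃ p : Polynomial ℤ, a.vec l = qInv * Polynomial.aeval qInv p := by
  rcases a.1.weight_eq a.2.1 (dagger l) with h0 | ⟨j, hj, hl⟩
  · exact ⟨0, by rw [CKL.vec, h0, map_zero, mul_zero]⟩
  · cases j with
    | zero =>
      refine absurd (dagger_injective ?_) h
      rw [hl rfl, a.dagger_word]
    | succ j =>
      refine ⟨-(-Polynomial.X) ^ j, ?_⟩
      rw [CKL.vec, hj]
      simp only [map_neg, map_pow, Polynomial.aeval_X]
      ring

/-- The linear map which sends a cup diagram to its expansion into words. -/
noncomputable def cupExpansion (n : ℕ) : (CKL (n + 1) →₀ Laurent) →ₗ[Laurent] (Word n → Laurent) :=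
  Finsupp.linearCombination Laurent CKL.vec

theorem cupExpansion_single (a : CKL (n + 1)) (r : Laurent) :
    cupExpansion n (Finsupp.single a r) = r • a.vec := Finsupp.linearCombination_single ..

/-- All coefficients of `f` in degree at least `k` vanish. -/
def DegreeLT (k : ℤ) (f : Laurent) : Prop := ∀ j, k ≤ j → f.coeff j = 0

theorem coeff_qInv_mul (f : Laurent) (j : ℤ) : (qInv * f).coeff j = f.coeff (j + 1) := by
  rw [qInv, LaurentPolynomial.T, AddMonoidAlgebra.coeff_single_mul_eq_mul_coeff (j + 1), one_mul]
  intro k _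
  omega

namespace DegreeLT

variable {k : ℤ} {f g : Laurent}

theorem zero : DegreeLT k 0 := fun _ _ ↦ rfl

theorem add (hf : DegreeLT k f) (hg : DegreeLT k g) : DegreeLT k (f + g) := fun j hj ↦ by
  rw [AddMonoidAlgebra.coeff_add, Finsupp.add_apply, hf j hj, hg j hj, add_zero]

theorem sub (hf : DegreeLT k f) (hg : DegreeLT k g) : DegreeLT k (f - g) := fun j hj ↦ by
  rw [AddMonoidAlgebra.coeff_sub, Finsupp.sub_apply, hf j hj, hg j hj, sub_zero]

theorem qInv_mul (hf : DegreeLT (k + 1) f) : DegreeLT k (qInv * f) := fun j hj ↦ by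
  rw [coeff_qInv_mul]
  exact hf _ (by omega)

theorem mono {k' : ℤ} (hf : DegreeLT k f) (h : k ≤ k') : DegreeLT k' f :=
  fun j hj ↦ hf j (h.trans hj)

theorem sum {ι : Type*} (s : Finset ι) {F : ι → Laurent} (h : ∀ i ∈ s, DegreeLT k (F i)) :
    DegreeLT k (∑ i ∈ s, F i) := fun j hj ↦ by
  rw [AddMonoidAlgebra.coeff_sum, Finsupp.finsetSum_apply]
  exact Finset.sum_eq_zero fun i hi ↦ h i hi j hj

theorem aeval_mul (hf : DegreeLT k f) (p : Polynomial ℤ) :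
    DegreeLT k (Polynomial.aeval qInv p * f) := by
  induction p using Polynomial.induction_on' with
  | add p r hp hr =>
    rw [map_add, add_mul]
    exact hp.add hr
  | monomial j a =>
    induction j with
    | zero =>
      intro j hj
      rw [Polynomial.aeval_monomial, pow_zero, mul_one,
        eq_intCast (algebraMap ℤ Laurent), ← zsmul_eq_mul, AddMonoidAlgebra.coeff_smul_apply, hf j hj, smul_zero]
    | succ j ih =>
      have e : Polynomial.aeval qInv (Polynomial.monomial (j + 1) a) * f =
          qInv * (Polynomial.aeval qInv (Polynomial.monomial j a) * f) := by
        simp only [Polynomial.aeval_monomial]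
        ring
      rw [e]
      exact (ih.mono (by omega)).qInv_mul

theorem one : DegreeLT 1 1 := fun j hj ↦ by
  rw [← LaurentPolynomial.T_zero, LaurentPolynomial.T_apply, if_neg (by omega)]

theorem qInv_mul_aeval (p : Polynomial ℤ) : DegreeLT 0 (qInv * Polynomial.aeval qInv p) := by
  have := (one.aeval_mul p)
  rw [mul_one] at this
  exact qInv_mul (by simpa using this)

theorem eventually (f : Laurent) : ∃ k : ℤ, DegreeLT k f := by
  obtain ⟨K, hK⟩ := f.coeff.support.bddAbove
  refine ⟨K + 1, fun j hj ↦ ?_⟩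
  by_contra hne
  have := hK (Finsupp.mem_support_iff.2 hne)
  omega

end DegreeLT

theorem cupExpansion_apply (g : CKL (n + 1) →₀ Laurent) (l : Word n) [Fintype (CKL (n + 1))] :
    cupExpansion n g l = ∑ a, g a * a.vec l := by
  rw [cupExpansion, Finsupp.linearCombination_apply, Finsupp.sum_fintype _ _ (by simp),
    Finset.sum_apply]
  rfl

/-- The expansion is unitriangular with respect to degree: evaluating at the word of b isolates g b
up to terms with a factor q⁻¹. A common degree bound for all coefficients thus improves by one until
it reaches k. -/
theorem degreeLT_of_cupExpansion {g : CKL (n + 1) →₀ Laurent} {k : ℤ}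
    (h : ∀ l, DegreeLT k (cupExpansion n g l)) (a : CKL (n + 1)) : DegreeLT k (g a) := by
  classical
  let : Fintype (CKL (n + 1)) := Fintype.ofFinite _
  have step : ∀ j : ℤ, k ≤ j → (∀ a, DegreeLT (j + 1) (g a)) → ∀ a, DegreeLT j (g a) := by
    intro j hj hg b
    have e : g b = cupExpansion n g b.word - ∑ a ∈ Finset.univ.erase b, g a * a.vec b.word := by
      rw [cupExpansion_apply, ← Finset.add_sum_erase _ _ (Finset.mem_univ b), b.vec_word]
      ring
    rw [e]
    refine ((h _).mono hj).sub (DegreeLT.sum _ fun a ha ↦ ?_)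
    obtain ⟨p, hp⟩ := a.exists_vec_eq (l := b.word) fun hab ↦
      Finset.ne_of_mem_erase ha (CKL.word_injective hab).symm
    rw [hp, mul_left_comm, mul_comm (g a)]
    exact ((hg a).aeval_mul p).qInv_mul
  -- There are finitely many diagrams, so their coefficients have a common degree bound N, from
  -- which the descent starts.
  choose K hK using fun a ↦ DegreeLT.eventually (g a)
  obtain ⟨N, hN⟩ := (Finset.univ.image K).bddAbove
  have hN' : ∀ a, DegreeLT N (g a) := fun a ↦
    (hK a).mono (hN (by simp))
  have key : ∀ d : ℕ, ∀ j : ℤ, k ≤ j → N - d ≤ j → ∀ a, DegreeLT j (g a) := by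
    intro d
    induction d with
    | zero => exact fun j _ hj a ↦ (hN' a).mono (by simpa using hj)
    | succ d ih => exact fun j hj hd ↦ step j hj (ih (j + 1) (by omega) (by push_cast at hd; omega))
  exact key (N - k).toNat k le_rfl (by omega) a

theorem cupExpansion_injective : Function.Injective (cupExpansion n) := by
  rw [injective_iff_map_eq_zero]
  intro g hg
  refine Finsupp.ext fun a ↦ LaurentPolynomial.ext fun k ↦ ?_
  -- The zero expansion satisfies the bound for every k, so each coefficient of g vanishes in turn.
  exact degreeLT_of_cupExpansion (k := k) (fun l ↦ by rw [hg]; exact DegreeLT.zero) a k le_rfl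

/-- For i = 0 the unmarked and the marked cap cover the cases of different and equal first symbols,
and s_0 moves every word. For i ≥ 1 the symbols differ exactly when s_i moves the word. -/
theorem wordOpC_eq_capCupOp (i : Fin n) (f : Word (n + 1) → Laurent) (l : Word n) :
    wordOpC i (fun l ↦ f (dagger l)) l =
      if i.val = 0 then capCupOp i.castSucc i.succ false f (dagger l) +
          capCupOp i.castSucc i.succ true f (dagger l)
        else capCupOp i.castSucc i.succ false f (dagger l) := by
  rw [wordOpC_apply]
  by_cases hi : i.val = 0
  · have hne : simpleOnWord i l ≠ l := fun h ↦ by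
      have := congrFun h i
      rw [simpleOnWord_apply, if_pos hi, if_pos rfl] at this
      revert this
      cases l i <;> simp
    rw [if_neg hne, dagger_simpleOnWord hne, if_pos hi]
    simp only [capCupOp, dagger_succ]
    cases dagger l i.castSucc <;> cases l i <;> simp
  · rw [if_neg hi, capCupOp]
    by_cases h : simpleOnWord i l = l
    · rw [if_pos h, if_neg]
      rw [(simpleOnWord_eq_self_iff_dagger hi l).1 h]
      simp
    · have hx : (dagger l i.castSucc ^^ dagger l i.succ) = !false := by
        have h' := mt (simpleOnWord_eq_self_iff_dagger hi l).2 h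
        revert h'
        cases dagger l i.castSucc <;> cases dagger l i.succ <;> simp
      rw [if_neg h, if_pos hx, dagger_simpleOnWord h, dagger_succ]

/-- At the word of the join, `Diagram.capCupOp_weight` takes the nonzero scalar as its value. So d
has nonzero weight at that word or at its flip, which have the same sign, and such a sign is that of
d. -/
theorem Diagram.even_join {m : ℕ} {d : Diagram m} (hd : d.IsCupDiagram)
    (he : Even (d.markedRays + d.unmarkedCups)) {a b : Fin m} {c : Bool}
    (hab : b.val = a.val + 1) (hc : c = true → a.val = 0) (h : d.joinScalar a b c ≠ 0) :
    Even ((d.join a b c).markedRays + (d.join a b c).unmarkedCups) := by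
  have hD := hd.join hab hc
  rw [Diagram.even_iff_sign_word _ hd] at he
  rw [Diagram.even_iff_sign_word _ hD]
  have hne : a ≠ b := fun h ↦ by rw [h] at hab; omega
  have key := Diagram.capCupOp_weight hd hab hc (d.join a b c).word
  rw [Diagram.weight_word _ hD, mul_one, capCupOp] at key
  by_contra hs
  have h0 : ∀ l : Word m, l.sign = Word.sign (d.join a b c).word → d.weight l = 0 := fun l hl ↦ by
    by_contra hw
    exact hs (by rw [← hl, d.sign_eq_of_weight_ne_zero hd hw, he])
  rw [h0 _ rfl, h0 _ (sign_flipAt hne _), mul_zero, sub_zero, ite_self] at key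
  exact h key.symm

/-- This invariance of the structure constants is what makes the diagrams bar invariant. -/
theorem conj_joinScalar {m : ℕ} (d : Diagram m) (a b : Fin m) (c : Bool) :
    conj (d.joinScalar a b c) = d.joinScalar a b c := by
  rw [Diagram.joinScalar]
  split_ifs <;> simp [q, qInv, conj_T, add_comm]

/-- Coefficientwise application of `q ↦ q⁻¹`. -/
noncomputable def conjCups (m : ℕ) : (CKL m →₀ Laurent) →+ (CKL m →₀ Laurent) :=
  Finsupp.mapRange.addMonoidHom conj.toAddMonoidHom

theorem conjCups_apply {m : ℕ} (g : CKL m →₀ Laurent) (a : CKL m) :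
    conjCups m g a = conj (g a) := rfl

theorem conjCups_smul {m : ℕ} (r : Laurent) (g : CKL m →₀ Laurent) :
    conjCups m (r • g) = conj r • conjCups m g := by
  ext1 a
  simp only [conjCups_apply, Finsupp.smul_apply, smul_eq_mul, map_mul]

theorem conjCups_single {m : ℕ} (a : CKL m) (r : Laurent) :
    conjCups m (Finsupp.single a r) = Finsupp.single a (conj r) :=
  Finsupp.mapRange_single (hf := map_zero conj)

theorem exists_stack_capCup (a : CKL (n + 1)) (i : Fin n) (c : Bool)
    (hc : c = true → i.val = 0) :
    ∃ g : CKL (n + 1) →₀ Laurent, inclusion (n + 1) g = stack (capCup i c) a.1 ∧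
      conjCups (n + 1) g = g ∧
      ∀ l, cupExpansion n g l = capCupOp i.castSucc i.succ c a.1.weight (dagger l) := by
  have hab : i.succ.val = i.castSucc.val + 1 := by simp
  have hc' : c = true → i.castSucc.val = 0 := fun h ↦ by simpa using hc h
  rw [stack_capCup i c a.2.1.partner_partner a.2.1.marked_partner]
  simp only [Diagram.capCupOp_weight a.2.1 hab hc']
  by_cases h : a.1.joinScalar i.castSucc i.succ c = 0
  · exact ⟨0, by simp [h], by simp, by simp [h]⟩
  · obtain ⟨b, hb⟩ : ∃ b : CKL (n + 1), b.1 = a.1.join i.castSucc i.succ c :=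
      ⟨⟨_, a.2.1.join hab hc', Diagram.even_join a.2.1 a.2.2 hab hc' h⟩, rfl⟩
    rw [← hb]
    refine ⟨Finsupp.single b (a.1.joinScalar i.castSucc i.succ c), ?_, ?_, fun l ↦ ?_⟩
    · exact Finsupp.mapDomain_single
    · rw [conjCups_single, conj_joinScalar]
    · rw [cupExpansion_single]
      rfl

theorem exists_generatorStack (a : CKL (n + 1)) (i : Fin n) :
    ∃ g : CKL (n + 1) →₀ Laurent, inclusion (n + 1) g = generatorStack i a.1 ∧
      conjCups (n + 1) g = g ∧ cupExpansion n g = wordOpC i a.vec := by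
  obtain ⟨g, hg, hg', hgl⟩ := exists_stack_capCup a i false (by simp)
  have hw := wordOpC_eq_capCupOp i a.1.weight
  by_cases hi : i.val = 0
  · obtain ⟨k, hk, hk', hkl⟩ := exists_stack_capCup a i true (fun _ ↦ hi)
    refine ⟨g + k, ?_, ?_, funext fun l ↦ ?_⟩
    · rw [map_add, hg, hk, generatorStack, if_pos hi]
    · rw [map_add, hg', hk']
    · rw [map_add, Pi.add_apply, hgl, hkl]
      exact ((hw l).trans (if_pos hi)).symm
  · refine ⟨g, ?_, hg', funext fun l ↦ ?_⟩
    · rw [hg, generatorStack, if_neg hi]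
    · rw [hgl]
      exact ((hw l).trans (if_neg hi)).symm

/-- The diagram which consists of unmarked rays. -/
def unmarkedRays (m : ℕ) : CKL m :=
  ⟨⟨id, ∅⟩, ⟨fun _ ↦ rfl, fun i j h1 h2 ↦ absurd (h1.trans h2) (lt_irrefl i),
    fun i hi ↦ by simp at hi, fun i hi ↦ by simp at hi⟩, by
      simp [Diagram.markedRays, Diagram.unmarkedCups]⟩

theorem vec_unmarkedRays : (unmarkedRays (n + 1)).vec = Pi.single (allDown n) 1 := by
  funext l
  have hw : (unmarkedRays (n + 1)).word = allDown n := by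
    funext k
    simp [CKL.word, Diagram.word, unmarkedRays, allDown]
  by_cases h : l = allDown n
  · rw [h, Pi.single_eq_same, ← hw, CKL.vec_word]
  · rw [Pi.single_eq_of_ne h]
    obtain ⟨k, hk⟩ := Function.ne_iff.1 h
    refine Finset.prod_eq_zero (Finset.mem_univ k.succ) ?_
    rw [Diagram.vertexWeight_ray rfl, dagger_succ, rayWeight, if_neg]
    simpa [unmarkedRays, allDown] using hk

/-- The diagram of unmarked rays gives ∨⋯∨, and C_{s_i} takes a word to the next one up to a
multiple of the word itself. -/
theorem range_cupExpansion : LinearMap.range (cupExpansion n) = ⊤ := by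
  have hop : ∀ i : Fin n, ∀ f ∈ LinearMap.range (cupExpansion n),
      wordOpC i f ∈ LinearMap.range (cupExpansion n) := by
    rintro i _ ⟨g, rfl⟩
    induction g using Finsupp.induction_linear with
    | zero =>
      rw [map_zero, map_zero]
      exact zero_mem _
    | add f g hf hg =>
      rw [map_add, map_add]
      exact add_mem hf hg
    | single a r =>
      obtain ⟨g, -, -, hg⟩ := exists_generatorStack a i
      rw [cupExpansion_single, map_smul, ← hg]
      exact Submodule.smul_mem _ _ ⟨g, rfl⟩
  have hs : ∀ l : Word n, (Pi.single l 1 : Word n → Laurent) ∈ LinearMap.range (cupExpansion n) := by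
    refine word_induction ?_ fun l i _ hne hl ↦ ?_
    · exact ⟨Finsupp.single (unmarkedRays (n + 1)) 1, by
        rw [cupExpansion_single, one_smul, vec_unmarkedRays]⟩
    · have := hop i _ hl
      rw [wordOpC_single, if_neg hne] at this
      simpa using add_mem this (Submodule.smul_mem _ (if l i = true then q else qInv) hl)
  rw [eq_top_iff, ← (Pi.basisFun Laurent (Word n)).span_eq, Submodule.span_le]
  rintro _ ⟨l, rfl⟩
  rw [Pi.basisFun_apply]
  exact hs l

/-- The free module on `C_KL` is the free module on words. -/
noncomputable def cupEquiv (n : ℕ) : (CKL (n + 1) →₀ Laurent) ≃ₗ[Laurent] (Word n → Laurent) :=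
  LinearEquiv.ofBijective (cupExpansion n)
    ⟨cupExpansion_injective, LinearMap.range_eq_top.1 range_cupExpansion⟩

/-- Surjectivity comes from equality of ranks: every word has a diagram although none is
constructed. -/
theorem CKL.word_bijective : Function.Bijective (CKL.word (n := n)) := by
  let : Fintype (CKL (n + 1)) := Fintype.ofFinite _
  refine (Fintype.bijective_iff_injective_and_card _).2 ⟨CKL.word_injective, ?_⟩
  rw [← Module.finrank_finsupp_self Laurent, (cupEquiv n).finrank_eq,
    Module.finrank_fintype_fun_eq_card]

/-- The bijection between minimal coset representatives and cup diagrams. -/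
noncomputable def cosetCupEquiv (n : ℕ) : MinCoset (coxC n) (typeA n) ≃ CKL (n + 1) :=
  (minCosetEquiv n).trans (Equiv.ofBijective CKL.word CKL.word_bijective).symm

theorem word_cosetCupEquiv (w : MinCoset (coxC n) (typeA n)) :
    (cosetCupEquiv n w).word = minCosetEquiv n w :=
  (Equiv.ofBijective CKL.word CKL.word_bijective).apply_symm_apply _

theorem isDiagramOf_dagger_iff (w : MinCoset (coxC n) (typeA n)) (a : CKL (n + 1)) :
    IsDiagramOf (dagger (wordAct (allDown n) w.1)) a.1 ↔ a = cosetCupEquiv n w := by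
  rw [isDiagramOf_iff a.2.1, ← a.dagger_word, ← minCosetEquiv_apply, ← word_cosetCupEquiv]
  exact ⟨fun h ↦ CKL.word_injective (dagger_injective h), fun h ↦ by rw [h]⟩

/-- The parabolic module is the free module on `C_KL`. -/
noncomputable def parabolicCupEquiv (n : ℕ) : Parabolic n ≃ₗ[Laurent] (CKL (n + 1) →₀ Laurent) :=
  (wordEquiv n).trans (cupEquiv n).symm

theorem cupExpansion_parabolicCupEquiv (x : Parabolic n) :
    cupExpansion n (parabolicCupEquiv n x) = wordEquiv n x :=
  (cupEquiv n).apply_symm_apply _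

theorem parabolicCupEquiv_eq_iff {x : Parabolic n} {g : CKL (n + 1) →₀ Laurent} :
    parabolicCupEquiv n x = g ↔ wordEquiv n x = cupExpansion n g := by
  rw [← cupExpansion_parabolicCupEquiv]
  exact cupExpansion_injective.eq_iff.symm

theorem wordEquiv_symm_single (a : CKL (n + 1)) :
    wordEquiv n ((parabolicCupEquiv n).symm (Finsupp.single a 1)) = a.vec := by
  rw [← cupExpansion_parabolicCupEquiv, LinearEquiv.apply_symm_apply, cupExpansion_single, one_smul]

theorem inclusion_rightAct (a : CKL (n + 1)) (i : Fin n) :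
    inclusion (n + 1) (parabolicCupEquiv n (rightAct (coxC n) (typeA n) (C (coxC n) i)
      ((parabolicCupEquiv n).symm (Finsupp.single a 1)))) = generatorStack i a.1 := by
  obtain ⟨g, hg, -, hgw⟩ := exists_generatorStack a i
  rw [← hg]
  congr 1
  rw [parabolicCupEquiv_eq_iff, hgw, wordEquiv_rightAct_C, wordEquiv_symm_single]

end CupModule

end CupHecke

namespace CupHecke

/-! ### Bar invariance and the Kazhdan–Lusztig elements. -/

section KazhdanLusztig

variable {n : ℕ}

theorem barModule_smul {B : Type} (M : CoxeterMatrix B) (J : Set B) (r : Laurent)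
    (x : ParabolicModule M J) : barModule M J (r • x) = conj r • barModule M J x := by
  obtain ⟨t, rfl⟩ := Submodule.mkQ_surjective _ x
  exact congrArg (balanced M J).mkQ (barTensor_smul M r t)

theorem barModule_rightAct_C {B : Type} (M : CoxeterMatrix B) (J : Set B) (i : B)
    (x : ParabolicModule M J) :
    barModule M J (rightAct M J (C M i) x) = rightAct M J (C M i) (barModule M J x) := by
  obtain ⟨t, rfl⟩ := Submodule.mkQ_surjective _ x
  induction t with
  | zero => simp
  | tmul l h =>
    change barModule M J (rightAct M J (C M i) (tmul M J l h)) =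
      rightAct M J (C M i) (barModule M J (tmul M J l h))
    rw [rightAct_tmul, barModule_tmul, barModule_tmul, rightAct_tmul, map_mul, bar_C]
  | add s t hs ht => simp only [map_add, hs, ht]

/-- The coefficients of a . C_{s_i} are invariant under q ↦ q⁻¹, so coefficientwise conjugation
commutes with C_{s_i}. -/
theorem conjCups_rightAct_C (i : Fin n) (x y : Parabolic n)
    (h : parabolicCupEquiv n y = conjCups (n + 1) (parabolicCupEquiv n x)) :
    parabolicCupEquiv n (rightAct (coxC n) (typeA n) (C (coxC n) i) y) =
      conjCups (n + 1) (parabolicCupEquiv n (rightAct (coxC n) (typeA n) (C (coxC n) i) x)) := by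
  obtain ⟨g, rfl⟩ := (parabolicCupEquiv n).symm.surjective x
  rw [LinearEquiv.apply_symm_apply, ← LinearEquiv.eq_symm_apply] at h
  subst h
  induction g using Finsupp.induction_linear with
  | zero => simp
  | add f g hf hg => simp only [map_add, hf, hg]
  | single a r =>
    obtain ⟨g, -, hg, hgw⟩ := exists_generatorStack a i
    have key : ∀ r : Laurent, parabolicCupEquiv n (rightAct (coxC n) (typeA n) (C (coxC n) i)
        ((parabolicCupEquiv n).symm (Finsupp.single a r))) = r • g := by
      intro r
      rw [parabolicCupEquiv_eq_iff, map_smul, hgw, wordEquiv_rightAct_C,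
        ← cupExpansion_parabolicCupEquiv, LinearEquiv.apply_symm_apply, cupExpansion_single,
        map_smul]
    rw [conjCups_single, key, key, conjCups_smul, hg]

/-- The bar involution fixes the cup diagrams. -/
theorem parabolicCupEquiv_barModule (x : Parabolic n) :
    parabolicCupEquiv n (barModule (coxC n) (typeA n) x) =
      conjCups (n + 1) (parabolicCupEquiv n x) := by
  have hsmul : ∀ (r : Laurent) (x : Parabolic n),
      parabolicCupEquiv n (barModule (coxC n) (typeA n) x) =
        conjCups (n + 1) (parabolicCupEquiv n x) →
      parabolicCupEquiv n (barModule (coxC n) (typeA n) (r • x)) =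
        conjCups (n + 1) (parabolicCupEquiv n (r • x)) := fun r x h ↦ by
    rw [barModule_smul, map_smul, map_smul, conjCups_smul, h]
  -- Both involutions are semilinear, commute with all C_{s_i} and fix M_e. These data determine
  -- them on every word by `word_induction`.
  have hword : ∀ l : Word n, parabolicCupEquiv n (barModule (coxC n) (typeA n)
      ((wordEquiv n).symm (Pi.single l 1))) =
        conjCups (n + 1) (parabolicCupEquiv n ((wordEquiv n).symm (Pi.single l 1))) := by
    refine word_induction ?_ fun l i _ hne hl ↦ ?_
    · have h1 : ∀ i ∈ typeA n, len (coxC n) 1 < len (coxC n) ((coxC n).simple i * 1) := by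
        intro i _
        rw [mul_one, len_one, len_simple]
        exact one_pos
      obtain ⟨w, hw⟩ : ∃ w : MinCoset (coxC n) (typeA n), w.1 = 1 := ⟨⟨1, h1⟩, rfl⟩
      have e : (wordEquiv n).symm (Pi.single (allDown n) 1) = stdBasis (coxC n) (typeA n) w := by
        rw [LinearEquiv.symm_apply_eq, wordEquiv_stdBasis, minCosetEquiv_apply, hw, wordAct_one]
      have e' : parabolicCupEquiv n ((wordEquiv n).symm (Pi.single (allDown n) 1)) =
          Finsupp.single (unmarkedRays (n + 1)) 1 := by
        rw [parabolicCupEquiv_eq_iff, LinearEquiv.apply_symm_apply, cupExpansion_single, one_smul,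
          vec_unmarkedRays]
      have hb : barModule (coxC n) (typeA n) ((wordEquiv n).symm (Pi.single (allDown n) 1)) =
          (wordEquiv n).symm (Pi.single (allDown n) 1) := by
        rw [e, stdBasis, hw, barModule_tmul, map_one, H_one, map_one]
      rw [hb, e', conjCups_single, map_one]
    · have e : (wordEquiv n).symm (Pi.single (simpleOnWord i l) 1) =
          rightAct (coxC n) (typeA n) (C (coxC n) i) ((wordEquiv n).symm (Pi.single l 1)) +
            (if l i = true then q else qInv) • (wordEquiv n).symm (Pi.single l 1) := by
        rw [LinearEquiv.symm_apply_eq, map_add, map_smul, wordEquiv_rightAct_C,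
          LinearEquiv.apply_symm_apply, wordOpC_single, if_neg hne, sub_add_cancel]
      rw [e, map_add, map_add, map_add, map_add, hsmul _ _ hl, barModule_rightAct_C,
        conjCups_rightAct_C i _ _ hl]
  obtain ⟨f, rfl⟩ := (wordEquiv n).symm.surjective x
  rw [← Finset.univ_sum_single f]
  simp only [map_sum]
  refine Finset.sum_congr rfl fun l _ ↦ ?_
  have e : (Pi.single l (f l) : Word n → Laurent) = f l • Pi.single l 1 := by
    rw [← Pi.single_smul, smul_eq_mul, mul_one]
  rw [e, map_smul]
  exact hsmul _ _ (hword l)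

instance : Finite (MinCoset (coxC n) (typeA n)) := Finite.of_equiv _ (minCosetEquiv n).symm

theorem eq_stdBasis_add_sum_iff (w : MinCoset (coxC n) (typeA n)) (x : Parabolic n)
    (c : MinCoset (coxC n) (typeA n) →₀ Polynomial ℤ) :
    (x = stdBasis (coxC n) (typeA n) w + c.sum fun v p ↦
      (qInv * Polynomial.aeval qInv p : Laurent) • stdBasis (coxC n) (typeA n) v) ↔
      ∀ v, wordEquiv n x (minCosetEquiv n v) =
        (Pi.single (minCosetEquiv n w) 1 : Word n → Laurent) (minCosetEquiv n v) +
          qInv * Polynomial.aeval qInv (c v) := by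
  classical
  let : Fintype (MinCoset (coxC n) (typeA n)) := Fintype.ofFinite _
  rw [← (wordEquiv n).injective.eq_iff, funext_iff, (minCosetEquiv n).symm.forall_congr_left]
  refine forall_congr' fun v ↦ ?_
  rw [Finsupp.sum_fintype _ _ (by simp), map_add, map_sum, wordEquiv_stdBasis]
  simp only [map_smul, wordEquiv_stdBasis, Pi.add_apply, Finset.sum_apply, Pi.smul_apply,
    Pi.single_apply, smul_eq_mul, Equiv.symm_symm, (minCosetEquiv n).injective.eq_iff]
  simp

/-- A Laurent polynomial invariant under q ↦ q⁻¹ with only negative degrees would also have only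
positive ones. -/
theorem conjCups_eq_zero {g : CKL (n + 1) →₀ Laurent} (h : conjCups (n + 1) g = g)
    (hg : ∀ a, DegreeLT 0 (g a)) : g = 0 := by
  refine Finsupp.ext fun a ↦ LaurentPolynomial.ext fun k ↦ ?_
  rcases le_total 0 k with hk | hk
  · exact hg a k hk
  · rw [← h, conjCups_apply]
    change (LaurentPolynomial.invert (g a)).coeff k = 0
    rw [LaurentPolynomial.invert_apply]
    exact hg a (-k) (by omega)

/-- For uniqueness, the difference to the diagram is bar invariant and has word coordinates of
negative degree; by `degreeLT_of_cupExpansion` its diagram coordinates have negative degree too. For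
existence, the expansion of the diagram provides the polynomials. -/
theorem isKL_iff (w : MinCoset (coxC n) (typeA n)) (x : Parabolic n) :
    IsKL (coxC n) (typeA n) w x ↔
      parabolicCupEquiv n x = Finsupp.single (cosetCupEquiv n w) 1 := by
  have hvec : ∀ v ≠ w, ∃ p : Polynomial ℤ,
      (cosetCupEquiv n w).vec (minCosetEquiv n v) = qInv * Polynomial.aeval qInv p := fun v hv ↦
    (cosetCupEquiv n w).exists_vec_eq (by
      rw [word_cosetCupEquiv]
      exact (minCosetEquiv n).injective.ne hv)
  have hvec' : (cosetCupEquiv n w).vec (minCosetEquiv n w) = 1 := by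
    rw [← word_cosetCupEquiv, CKL.vec_word]
  constructor
  · rintro ⟨hb, c, hc, hx⟩
    rw [eq_stdBasis_add_sum_iff] at hx
    refine sub_eq_zero.1 (conjCups_eq_zero ?_ (degreeLT_of_cupExpansion fun l ↦ ?_))
    · rw [map_sub, ← parabolicCupEquiv_barModule, hb, conjCups_single, map_one]
    · obtain ⟨v, rfl⟩ := (minCosetEquiv n).surjective l
      rw [map_sub, Pi.sub_apply, cupExpansion_parabolicCupEquiv, cupExpansion_single, one_smul, hx]
      by_cases hv : v = w
      · rw [hv, hvec', hc, Pi.single_eq_same, map_zero, mul_zero, add_zero, sub_self]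
        exact DegreeLT.zero
      · obtain ⟨p, hp⟩ := hvec v hv
        rw [hp, Pi.single_eq_of_ne ((minCosetEquiv n).injective.ne hv), zero_add]
        exact (DegreeLT.qInv_mul_aeval _).sub (DegreeLT.qInv_mul_aeval _)
  · intro hx
    refine ⟨?_, ?_⟩
    · refine (parabolicCupEquiv n).injective ?_
      rw [parabolicCupEquiv_barModule, hx, conjCups_single, map_one]
    · classical
      choose p hp using hvec
      -- The value at w is 0 since the leading term is separate in `IsKL`.
      refine ⟨Finsupp.equivFunOnFinite.symm fun v ↦ if hv : v = w then 0 else p v hv, by simp, ?_⟩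
      rw [eq_stdBasis_add_sum_iff]
      intro v
      rw [parabolicCupEquiv_eq_iff, cupExpansion_single, one_smul] at hx
      rw [hx, Finsupp.equivFunOnFinite_symm_apply_apply]
      by_cases hv : v = w
      · rw [hv, dif_pos rfl, hvec', Pi.single_eq_same, map_zero, mul_zero, add_zero]
      · rw [dif_neg hv, Pi.single_eq_of_ne ((minCosetEquiv n).injective.ne hv), zero_add, hp v hv]

end KazhdanLusztig

end CupHecke

theorem mainTheorem11 (n : ℕ) :
    ∃ (e : CupHecke.MinCoset (CupHecke.coxC n) (CupHecke.typeA n) ≃ CupHecke.CKL (n + 1))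
      (Φ : CupHecke.ParabolicModule (CupHecke.coxC n) (CupHecke.typeA n) ≃ₗ[CupHecke.Laurent]
        (CupHecke.CKL (n + 1) →₀ CupHecke.Laurent)),
      (∀ w a, CupHecke.IsDiagramOf
          (CupHecke.dagger (CupHecke.wordAct (CupHecke.allDown n) w.1)) a.1 ↔ a = e w) ∧
      (∀ w x, CupHecke.IsKL (CupHecke.coxC n) (CupHecke.typeA n) w x ↔
          Φ x = Finsupp.single (e w) 1) ∧
      ∀ (a : CupHecke.CKL (n + 1)) (i : Fin n),
        CupHecke.inclusion (n + 1)
            (Φ (CupHecke.rightAct (CupHecke.coxC n) (CupHecke.typeA n)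
              (CupHecke.C (CupHecke.coxC n) i) (Φ.symm (Finsupp.single a 1)))) =
          CupHecke.generatorStack i a.1 :=
  ⟨CupHecke.cosetCupEquiv n, CupHecke.parabolicCupEquiv n, CupHecke.isDiagramOf_dagger_iff,
    CupHecke.isKL_iff, CupHecke.inclusion_rightAct⟩
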